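/- **Setting.** For smooth real functions $f,g,h,r$ of one real variable let $$\Delta=\tfrac12u_x^2+h(u)u_y^2+r(u)u_{xx}+g(u)u_{yy}-u_{xxxx}-2u_{xxyy}-u_{yyyy}-u_t+f(u),$$ and consider the equation $\Delta=0$ for $u=u(x,y,t)$. Differential functions are smooth functions of $x,y,t$ and finitely many derivatives of $u$ (here with complex values); $D_x,D_y,D_t$ are the total derivatives. A jet is on shell if $\Delta$ and all its total derivatives vanish there. A triple $C=(C^1,C^2,C^3)$ of differential functions is a *conserved vector* if $D_xC^1+D_yC^2+D_tC^3=0$ on shell and along every smooth solution on every open subset of $\mathbb R^3$. It is *trivial* if it is the sum of a triple vanishing on shell and a triple whose total divergence vanishes identically. For a generator $X=\xi^1\partial_x+\xi^2\partial_y+\xi^3\partial_t+\eta\,\partial_u$ with coefficients depending on $(x,y,t,u)$, put $W=\eta-\xi^1u_x-\xi^2u_y-\xi^3u_t$. For a function $\upsilon(x,y,t)$ put $\mathcal L=\upsilon\Delta$ and $$N^i_X[\upsilon]=\xi^i\mathcal L+W\Big(\tfrac{\partial\mathcal L}{\partial u_i}-D_l\tfrac{\partial\mathcal L}{\partial u_{il}}+D_lD_m\tfrac{\partial\mathcal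 L}{\partial u_{ilm}}-\cdots\Big)+D_l(W)\Big(\tfrac{\partial\mathcal L}{\partial u_{il}}-D_m\tfrac{\partial\mathcal L}{\partial u_{ilm}}+\cdots\Big)+\cdots$$ (symmetric partial derivatives, summation over repeated indices). We say that $C$ is *built from $X$ and $\upsilon$* if $X$ is a Lie point symmetry of $\Delta=0$, $C$ is a conserved vector, and $C+N_X[\upsilon]$ is trivial, i.e. $C$ is $-N_X[\upsilon]$ up to a trivial conserved vector. **Quasi self-adjoint case.** Let $f=\alpha$, $r=u/2+\beta$, $h=g'$, and let $\upsilon=c\neq0$ be constant. Then $\upsilon$ solves the adjoint equation $\delta(\upsilon\Delta)/\delta u=0$ identically, $\partial_t,\partial_x,\partial_y$ are Lie point symmetries, and $N_{\partial_t}[\upsilon],N_{\partial_x}[\upsilon],N_{\partial_y}[\upsilon]$ are all trivial. **Nonlinearly self-adjoint cases.** In each of the following cases the given $\upsilon$ satisfies $\delta(\upsilon\Delta)/\delta u=0$ identically, and the given vectors are built from the indicated symmetries and $\upsilon$. They are nontrivial exactly under the stated conditions (always, if no condition is stated). All parameters $\alpha,\dots,\zeta,c$ are real. In cases 2–5, $g$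 is smooth, $g''\not\equiv0$, $G=\int g\,du$ is an antiderivative of $g$, and $c_1,\dots,c_4\in\mathbb C$ are not all zero; $\sqrt{\cdot}$ is any complex square root. **1.** $r=\frac u2+\alpha$, $g=\beta u+\gamma$, $h=\beta$, $f=\delta u^2+\epsilon u+\zeta$; $\upsilon=F(x,y,t)$ is any smooth (complex-valued) solution on $\mathbb R^3$ of $$2\delta F+\beta F_{yy}+\tfrac12F_{xx}=0,\qquad \epsilon F+F_t+\gamma F_{yy}-F_{yyyy}+\alpha F_{xx}-2F_{xxyy}-F_{xxxx}=0.$$ $\partial_t$ (nontrivial iff $F_t\not\equiv0$): $$\begin{aligned}C^1={}&\tfrac1{12}\big(4(1-6\beta)F_{yyt}u_x+3u^2F_{xt}-8F_{yt}u_{xy}+8u_yF_{xyt}-6F_t((2\alpha+8\delta+u)u_x-2(u_{xyy}+u_{xxx}))-4F_{xt}(u_{yy}+3u_{xx})\big)\\&+u((\alpha+4\delta)F_{xt}-F_{xyyt})+2\beta uF_{xyyt},\\C^2={}&\tfrac16\big(3\beta u^2F_{yt}+F_t(-2(3\gamma+4\delta+3\beta u)u_y+6(u_{yyy}+u_{xxy}))\\&-2((2\beta-3)u_yF_{yyt}+2F_{xt}u_{xy}-2u_xF_{xyt}+F_{yt}(3u_{yy}+u_{xx}))\big)+u((\gamma+4\delta)F_{yt}+(2\beta-1)F_{yyyt}),\\C^3={}&-\zeta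 F+uF_t.\end{aligned}$$ $\partial_x$ (nontrivial iff $F_x\not\equiv0$): $$\begin{aligned}C^1={}&\tfrac16\big(3u_x(2(1-2\beta)F_{xyy}-(2\alpha+8\delta+u)F_x)-2F_yu_{xxy}+2((6\beta-1)F_{yy}u_{xx}+F_x(u_{xyy}+3u_{xxx})-2u_{xy}F_{xy})\big)\\&-F_yu_{yyy}-F(\zeta-u_t+\beta u_y^2+\gamma u_{yy}+u(\epsilon+\delta u+\beta u_{yy})-4\delta u_{xx}),\\C^2={}&\tfrac13\big((2\beta-3)F_{yy}u_{xy}+F(3\beta u_yu_x+(3\gamma+4\delta+3\beta u)u_{xy})-2F_{xy}u_{xx}+F_x(3u_{yyy}+5u_{xxy})+F_yu_{xxx}\big)\\&+(1-2\beta)F_{yyy}u_x+F_y(u_{xyy}-(\gamma+4\delta+\beta u)u_x),\\C^3={}&-Fu_x.\end{aligned}$$ $\partial_y$ (nontrivial iff $F_y\not\equiv0$): $$\begin{aligned}C^1={}&\tfrac16\big(3u_y(2(1-2\beta)F_{xyy}-(2\alpha+8\delta+u)F_x)+2((6\beta-1)F_{yy}u_{xy}-2F_{xy}u_{yy}+F_x(u_{yyy}+3u_{xxy})+F_y(5u_{xyy}+3u_{xxx}))\\&+3F(u_yu_x+(2\alpha+8\delta+u)u_{xy})\big),\\C^2={}&\tfrac13\big((2\beta-3)F_{yy}u_{yy}+4\delta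 Fu_{yy}-2F_{xy}u_{xy}+F_y(3u_{yyy}+u_{xxy})-F_x(u_{xyy}+3u_{xxx})\big)\\&+(1-2\beta)F_{yyy}u_y-(\gamma+4\delta+\beta u)F_yu_y-F(\zeta-u_t+\tfrac12u_x^2+\alpha u_{xx}+u(\epsilon+\delta u+\tfrac12u_{xx})),\\C^3={}&-Fu_y.\end{aligned}$$ $x\partial_y-y\partial_x$, if $\beta=\frac12$, $\gamma=\alpha$ (nontrivial iff $F$ is not a function of $(x^2+y^2,t)$): $$\begin{aligned}C^1={}&\tfrac16\big(2xu_{yyy}F_x+3yuu_xF_x+u_y(4F_{yy}-3x(2\alpha+8\delta+u)F_x)+4xF_{yy}u_{xy}+8F_xu_{xy}-4xu_{yy}F_{xy}+4u_xF_{xy}\\&+4yu_{xy}F_{xy}-2yF_xu_{xyy}-4yF_{yy}u_{xx}+2F_y(2u_{yy}+2xu_{xyy}-2u_{xx}+yu_{xxy})\\&+3F(yu_y^2+xu_yu_x+u(u_y+yu_{yy}+xu_{xy}))\big)+y\alpha u_xF_x+4y\delta u_xF_x+xF_xu_{xxy}-yF_xu_{xxx}+F_y(yu_{yyy}+xu_{xxx})\\&+F(y\zeta+y\delta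 u^2-yu_t+(\alpha+4\delta)u_y+y\alpha u_{yy}+x\alpha u_{xy}+4x\delta u_{xy}+\epsilon yu-xu_{xyyy}-4y\delta u_{xx}),\\C^2={}&\tfrac16\big(-4xu_{yy}F_{yy}+3yuF_yu_x+4F_{yy}u_x+4u_{yy}F_x-8F_yu_{xy}+4yF_{yy}u_{xy}-u_y(3x(2\alpha+8\delta+u)F_y+4F_{xy})\\&-4xu_{xy}F_{xy}+4xF_xu_{xyy}-4F_xu_{xx}+4yF_{xy}u_{xx}+2xF_yu_{xxy}-10yF_xu_{xxy}-2yF_yu_{xxx}\\&-F(8\delta u_x-8x\delta u_{yy}+3yu_yu_x+3xu_x^2+8y\delta u_{xy}+3u(u_x+yu_{xy}+xu_{xx}))\big)+xF_yu_{yyy}+y\alpha F_yu_x+4y\delta F_yu_x\\&-yu_{yyy}F_x-yF_yu_{xyy}-xF_xu_{xxx}-F(x\zeta+x\delta u^2-xu_t+\alpha u_x+y\alpha u_{xy}-u_{xyy}+x\alpha u_{xx}+\epsilon xu-xu_{xxyy}),\\C^3={}&F(yu_x-xu_y).\end{aligned}$$ **2.** $r=\frac u2+\delta$, $h=g'$,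 $f=\frac{\alpha u^2}2+\beta u+\gamma+cG$, $\alpha,c\ne0$. Put $s=\sqrt{2\alpha}$, $k=\sqrt c$, $\mathcal D=2\alpha(2\alpha+\delta)+4\alpha c+c^2-\beta$, $$\begin{aligned}\mathcal A&=\cos sx\,(c_2\cos ky+c_4\sin ky)-\sin sx\,(c_1\cos ky+c_3\sin ky),\\\mathcal B&=\cos sx\,(c_1\cos ky+c_3\sin ky)+\sin sx\,(c_2\cos ky+c_4\sin ky),\\\mathcal C&=\cos sx\,(c_3\cos ky-c_1\sin ky)+\sin sx\,(c_4\cos ky-c_2\sin ky),\\\mathcal E&=\sin sx\,(c_1\sin ky-c_3\cos ky)+\cos sx\,(c_4\cos ky-c_2\sin ky),\end{aligned}$$ $\upsilon=e^{\mathcal Dt}\mathcal B$. $\partial_t$ (nontrivial iff $\mathcal D\ne0$): $$\begin{aligned}C^1&=\tfrac14e^{\mathcal Dt}\mathcal D\big(\mathcal As(8\alpha+4\delta+8c+u)u-2\mathcal B(4\alpha+2\delta+4c+u)u_x-4\mathcal Asu_{xx}+4\mathcal Bu_{xxx}\big),\\C^2&=e^{\mathcal Dt}\mathcal D\big(\mathcal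 Ck(G+cu)-\mathcal B(c+g)u_y-\mathcal Cku_{yy}+\mathcal Bu_{yyy}-2\mathcal Cku_{xx}+2\mathcal Bu_{xxy}\big),\quad C^3=-e^{\mathcal Dt}\mathcal B(\gamma-\mathcal Du).\end{aligned}$$ $\partial_x$: $$\begin{aligned}C^1&=\tfrac12e^{\mathcal Dt}\big(4\mathcal B\alpha u_{xx}+2s\mathcal Au_{xxx}-2\mathcal B\gamma-4\mathcal B\alpha(2\alpha+\delta+2c)u-\mathcal B\alpha u^2-s\mathcal A(4\alpha+2\delta+4c+u)u_x\big),\\C^2&=se^{\mathcal Dt}\big(\mathcal EkG+\mathcal Ekcu-\mathcal A(c+g)u_y-\mathcal Eku_{yy}+\mathcal Au_{yyy}-2\mathcal Eku_{xx}+2\mathcal Au_{xxy}\big),\quad C^3=se^{\mathcal Dt}\mathcal Au.\end{aligned}$$ $\partial_y$: $$\begin{aligned}C^1&=\tfrac14ke^{\mathcal Dt}\big(4\mathcal Cu_{xxx}+s\mathcal E(u(8\alpha+4\delta+8c+u)-4u_{xx})-2\mathcal C(4\alpha+2\delta+4c+u)u_x\big),\\C^2&=-e^{\mathcal Dt}\big(\mathcal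 B\gamma+\mathcal BcG+\mathcal Bc^2u+\mathcal Ck(c+g)u_y-k(\mathcal Bk(u_{yy}+2u_{xx})+\mathcal C(u_{yyy}+2u_{xxy}))\big),\quad C^3=\mathcal Cke^{\mathcal Dt}u.\end{aligned}$$ **3.** $r=\frac u2+\gamma$, $h=g'$, $f=\alpha u+\beta+cG$, $c\neq0$. Put $k=\sqrt c$, $\mathcal D=c^2-\alpha$, $\mathcal A=(c_1+c_2x)\cos ky+(c_3+c_4x)\sin ky$, $\mathcal B=c_2\cos ky+c_4\sin ky$, $\mathcal C=(c_3+c_4x)\cos ky-(c_1+c_2x)\sin ky$, $\mathcal E=c_4\cos ky-c_2\sin ky$, $\upsilon=e^{\mathcal Dt}\mathcal A$. $\partial_t$ (nontrivial iff $\mathcal D\ne0$): $$\begin{aligned}C^1&=\tfrac14e^{\mathcal Dt}\mathcal D\big(\mathcal Bu(4\gamma+8c+u)-2\mathcal A(2\gamma+4c+u)u_x-4\mathcal Bu_{xx}+4\mathcal Au_{xxx}\big),\\C^2&=e^{\mathcal Dt}\mathcal D\big(\mathcal CkG+\mathcal Ckcu-\mathcal Acu_y-\mathcal Agu_y-\mathcal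 Cku_{yy}+\mathcal Au_{yyy}-2\mathcal Cku_{xx}+2\mathcal Au_{xxy}\big),\quad C^3=-e^{\mathcal Dt}\mathcal A(\beta-\mathcal Du).\end{aligned}$$ $\partial_x$ (nontrivial iff $(c_2,c_4)\ne(0,0)$): $$\begin{aligned}C^1&=\tfrac12e^{\mathcal Dt}\mathcal B\big(u(2\mathcal Dx-u_x)+2(xu_t-\beta x-\gamma u_x+2u_{xyy}+u_{xxx})\big),\\C^2&=e^{\mathcal Dt}\big(\mathcal Ek(G+cu)-\mathcal B(c+g)u_y-\mathcal Eku_{yy}+\mathcal Bu_{yyy}\big),\quad C^3=-e^{\mathcal Dt}\mathcal Bxu_x.\end{aligned}$$ $\partial_y$: $$\begin{aligned}C^1={}&\tfrac14e^{\mathcal Dt}k\big(2\beta x(2c_1+c_2x)\sin ky+\mathcal Eu^2-4\mathcal E(2u_{yy}+u_{xx})-2\beta x(2c_3+c_4x)\cos ky\\&+u(4\mathcal E\gamma-2\mathcal Cu_x)+4\mathcal C(u_{xxx}-\gamma u_x+2u_{xyy})\big),\\C^2={}&ke^{\mathcal Dt}\big(\mathcal Aku_{yy}+\mathcal Cu_{yyy}-\mathcal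 Ak(G+cu)-\mathcal C(c+g)u_y\big),\quad C^3=\mathcal Cke^{\mathcal Dt}u.\end{aligned}$$ **4.** $r=\frac u2+\delta$, $h=g'$, $f=\alpha u^2+\beta u+\gamma$, $\alpha\ne0$. Put $q=\sqrt\alpha$, $\mathcal D=16\alpha^2-\beta+4\alpha\delta$, $\mathcal A=(c_1y+c_2)\cos2qx+(c_3y+c_4)\sin2qx$, $\mathcal B=(c_3y+c_4)\cos2qx-(c_1y+c_2)\sin2qx$, $\mathcal C=c_1\cos2qx+c_3\sin2qx$, $\mathcal E=c_3\cos2qx-c_1\sin2qx$, $\upsilon=e^{\mathcal Dt}\mathcal A$. $\partial_t$ (nontrivial iff $\mathcal D\neq0$): $$\begin{aligned}C^1&=\tfrac12e^{\mathcal Dt}\mathcal D\big(\mathcal Bqu^2-2(\mathcal A(4\alpha+\delta)u_x+2\mathcal Bqu_{xx}-\mathcal Au_{xxx})+(4\mathcal Bq(4\alpha+\delta)-\mathcal Au_x)u\big),\\C^2&=-e^{\mathcal Dt}\big(g(\mathcal Cu_t+\mathcal A\mathcal Du_y)+\mathcal D(\mathcal Cu_{yy}-\mathcal Au_{yyy}+2(\mathcal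 Cu_{xx}-\mathcal Au_{xxy}))\big),\quad C^3=e^{\mathcal Dt}(\mathcal A\mathcal Du+\mathcal Cgu_y-\mathcal A\gamma).\end{aligned}$$ $\partial_x$: $$\begin{aligned}C^1={}&e^{\mathcal Dt}\big(\mathcal Cgu_y-\mathcal A\alpha u^2-u(4\mathcal A\alpha(4\alpha+\delta)+\mathcal Bqu_x)-2q(\mathcal B(4\alpha+\delta)u_x-2\mathcal Aqu_{xx}-\mathcal Bu_{xxx})\big),\\C^2={}&e^{\mathcal Dt}\big(q(2\mathcal Bu_{yyy}+\sin2qx\,(\gamma(c_1y+2c_2)y-4(c_1y+c_2)u_{xxy}+2c_1(u_{yy}+2u_{xx}))\\&-\cos2qx\,(2c_3(u_{yy}+2u_{xx})+\gamma(c_3y+2c_4)y-4(c_3y+c_4)u_{xxy}))-g(2\mathcal Bqu_y+\mathcal Cu_x)\big),\\C^3={}&2e^{\mathcal Dt}\mathcal Bqu.\end{aligned}$$ $\partial_y$ (nontrivial iff $(c_1,c_3)\ne(0,0)$): $$\begin{aligned}C^1&=\tfrac12e^{\mathcal Dt}\big(\mathcal Equ^2+(4\mathcal Eq(4\alpha+\delta)-\mathcal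 Cu_x)u-2(\mathcal C(4\alpha+\delta)u_x+2\mathcal Equ_{xx}-\mathcal Cu_{xxx})\big),\\C^2&=\mathcal Ce^{\mathcal Dt}(u_{yyy}+2u_{xxy}-\gamma y-gu_y),\quad C^3=e^{\mathcal Dt}\mathcal Cu.\end{aligned}$$ **5.** $r=\frac u2+\gamma$, $h=g'$, $f=\alpha u+\beta$. Put $\mathcal A=(c_1+c_2x)y+c_3+c_4x$, $\mathcal B=c_2y+c_4$, $\mathcal C=c_1+c_2x$, $\upsilon=e^{-\alpha t}\mathcal A$. $\partial_t$ (nontrivial iff $\alpha\ne0$): $$\begin{aligned}C^1&=\tfrac\alpha4e^{-\alpha t}\big(2u(\mathcal Au_x-2\gamma\mathcal B)+4\gamma\mathcal Au_x+4\mathcal Bu_{xx}-\mathcal Bu^2-4\mathcal Au_{xxx}\big),\\C^2&=e^{-\alpha t}\big(g(\alpha\mathcal Au_y-\mathcal Cu_t)+\alpha(\mathcal Cu_{yy}-\mathcal Au_{yyy}+2\mathcal Cu_{xx}-2\mathcal Au_{xxy})\big),\quad C^3=e^{-\alpha t}(\mathcal Cgu_y-\mathcal A(\beta+\alpha u)).\end{aligned}$$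 $\partial_x$ (nontrivial iff $(c_2,c_4)\ne(0,0)$): $$\begin{aligned}C^1&=\tfrac12e^{-\alpha t}\big(2c_2xgu_y-\mathcal B(2\beta x+(2\gamma+u)u_x-4u_{xyy}-2u_{xxx})\big),\\C^2&=e^{-\alpha t}\big(\mathcal Bu_{yyy}-c_2u_{yy}-g(\mathcal Bu_y+c_2xu_x)\big),\quad C^3=e^{-\alpha t}\mathcal Bu.\end{aligned}$$ $\partial_y$ (nontrivial iff $(c_1,c_2)\neq(0,0)$): $$\begin{aligned}C^1&=\tfrac14e^{-\alpha t}\big(c_2u^2-4\gamma\mathcal Cu_x+2u(2\gamma c_2-\mathcal Cu_x)-4c_2u_{xx}+4\mathcal Cu_{xxx}\big),\\C^2&=e^{-\alpha t}\mathcal C(u_{yyy}+2u_{xxy}-\beta y-gu_y),\quad C^3=e^{-\alpha t}\mathcal Cu.\end{aligned}$$ -/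

import Mathlib

open scoped ContDiff

noncomputable section

namespace KS

/-- Infinite jets of functions `u(x, y, t)`: a base point `(x, y, t)` together with the values
`u_{K}` of all partial derivatives, `K = (a, b, c)` counting the `x`-, `y`- and `t`-derivatives. -/
abbrev Jet : Type := (ℝ × ℝ × ℝ) × (ℕ × ℕ × ℕ → ℝ)

/-- The coordinate directions of the space of independent variables (`0 = x`, `1 = y`, `2 = t`). -/
def ev : Fin 3 → ℝ × ℝ × ℝ := ![(1, 0, 0), (0, 1, 0), (0, 0, 1)]

/-- The multi-indices of the first order derivatives. -/
def e : Fin 3 → ℕ × ℕ × ℕ := ![(1, 0, 0), (0, 1, 0), (0, 0, 1)]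

section Calculus

variable {V : Type*} [NormedAddCommGroup V] [NormedSpace ℝ V]

/-- Partial derivative of a function of `(x, y, t)`. -/
def pd (i : Fin 3) (F : ℝ × ℝ × ℝ → V) : ℝ × ℝ × ℝ → V :=
  fun p => lineDeriv ℝ F p (ev i)

/-- The iterated partial derivative `∂_x^a ∂_y^b ∂_t^c F`. -/
def d (a b c : ℕ) (F : ℝ × ℝ × ℝ → V) : ℝ × ℝ × ℝ → V :=
  (pd 0)^[a] ((pd 1)^[b] ((pd 2)^[c] F))

/-- The infinite jet of the function `u` at the point `p`. -/
def jet (u : ℝ × ℝ × ℝ → ℝ) (p : ℝ × ℝ × ℝ) : Jet :=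
  (p, fun K => d K.1 K.2.1 K.2.2 u p)

/-- Differential functions: smooth functions of `x, y, t` and of finitely many derivatives of `u`. -/
def IsDiffFun (F : Jet → V) : Prop :=
  ∃ (S : Finset (ℕ × ℕ × ℕ)) (P : (ℝ × ℝ × ℝ) × (S → ℝ) → V),
    ContDiff ℝ ∞ P ∧ ∀ j : Jet, F j = P (j.1, fun K => j.2 K)

/-- The total derivative `D_i = ∂_i + ∑_K u_{K+e_i} ∂/∂u_K`, as the derivative along this vector
field on the jet space. -/
def D (i : Fin 3) (F : Jet → V) : Jet → V :=
  fun j => lineDeriv ℝ F j (ev i, fun K => j.2 (K + e i))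

/-- The iterated total derivative `D_x^a D_y^b D_t^c` for `K = (a, b, c)`. -/
def DD (K : ℕ × ℕ × ℕ) (F : Jet → V) : Jet → V :=
  (D 0)^[K.1] ((D 1)^[K.2.1] ((D 2)^[K.2.2] F))

/-- The partial derivative `∂/∂u_K` of a function on the jet space. -/
def dU (K : ℕ × ℕ × ℕ) (F : Jet → V) : Jet → V :=
  fun j => lineDeriv ℝ F j (0, Pi.single K 1)

/-- The total divergence `D_x C¹ + D_y C² + D_t C³`. -/
def div (C : Fin 3 → Jet → V) : Jet → V :=
  fun j => ∑ i, D i (C i) j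

end Calculus

/-! ### Coordinates of a jet

The independent variables are `x = j.1.1`, `y = j.1.2.1`, `t = j.1.2.2`. -/

def u_0 (j : Jet) : ℝ := j.2 (0, 0, 0)
def u_x (j : Jet) : ℝ := j.2 (1, 0, 0)
def u_y (j : Jet) : ℝ := j.2 (0, 1, 0)
def u_t (j : Jet) : ℝ := j.2 (0, 0, 1)
def u_xx (j : Jet) : ℝ := j.2 (2, 0, 0)
def u_xy (j : Jet) : ℝ := j.2 (1, 1, 0)
def u_yy (j : Jet) : ℝ := j.2 (0, 2, 0)
def u_xxx (j : Jet) : ℝ := j.2 (3, 0, 0)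
def u_xxy (j : Jet) : ℝ := j.2 (2, 1, 0)
def u_xyy (j : Jet) : ℝ := j.2 (1, 2, 0)
def u_yyy (j : Jet) : ℝ := j.2 (0, 3, 0)
def u_xxxx (j : Jet) : ℝ := j.2 (4, 0, 0)
def u_xxyy (j : Jet) : ℝ := j.2 (2, 2, 0)
def u_xyyy (j : Jet) : ℝ := j.2 (1, 3, 0)
def u_yyyy (j : Jet) : ℝ := j.2 (0, 4, 0)

/-- The differential function `Δ`; the equation is `Δ = 0`, that is
`u_t = u_x²/2 + h(u) u_y² + r(u) u_xx + g(u) u_yy - u_xxxx - 2 u_xxyy - u_yyyy + f(u)`. -/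
def Delta (f g h r : ℝ → ℝ) : Jet → ℝ := fun j =>
  1 / 2 * u_x j ^ 2 + h (u_0 j) * u_y j ^ 2 + r (u_0 j) * u_xx j + g (u_0 j) * u_yy j
    - u_xxxx j - 2 * u_xxyy j - u_yyyy j - u_t j + f (u_0 j)

/-! ### Conserved vectors -/

/-- The jets satisfying the equation `Δ = 0` together with all its differential consequences. -/
def OnShell (Δ : Jet → ℝ) (j : Jet) : Prop := ∀ K, DD K Δ j = 0

/-- Conserved vectors of `Δ = 0`: differential functions whose total divergence vanishes on the
solutions, both on the formal solutions (jets on shell) and, as an identity between ordinary partial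
derivatives, along every smooth solution `u` on every open set of `(x, y, t)`. -/
def IsConserved (Δ : Jet → ℝ) (C : Fin 3 → Jet → ℂ) : Prop :=
  (∀ i, IsDiffFun (C i)) ∧
  (∀ j, OnShell Δ j → div C j = 0) ∧
  ∀ (Ω : Set (ℝ × ℝ × ℝ)) (u : ℝ × ℝ × ℝ → ℝ), IsOpen Ω → ContDiffOn ℝ ∞ u Ω →
    (∀ p ∈ Ω, Δ (jet u p) = 0) → ∀ p ∈ Ω, ∑ i, pd i (fun q => C i (jet u q)) p = 0

/-- Trivial conserved vectors: sums of a vector whose components vanish on the solutions and of a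
vector whose divergence vanishes identically. -/
def IsTrivial (Δ : Jet → ℝ) (C : Fin 3 → Jet → ℂ) : Prop :=
  ∃ A B : Fin 3 → Jet → ℂ,
    (∀ i, IsDiffFun (A i)) ∧ (∀ i, IsDiffFun (B i)) ∧
    (∀ i j, OnShell Δ j → A i j = 0) ∧ (∀ j, div B j = 0) ∧
    ∀ i j, C i j = A i j + B i j

/-! ### Symmetries, the formal Lagrangian and the Noether operator -/

/-- The infinitesimal generator `ξ¹ ∂_x + ξ² ∂_y + ξ³ ∂_t + η ∂_u`, with coefficients depending on
`(x, y, t)` and `u`. -/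
structure Generator where
  ξ : Fin 3 → ℝ × ℝ × ℝ → ℝ → ℝ
  η : ℝ × ℝ × ℝ → ℝ → ℝ

namespace Generator

/-- `∂_x` (`i = 0`), `∂_y` (`i = 1`), `∂_t` (`i = 2`). -/
def translation (i : Fin 3) : Generator := ⟨fun l _ _ => if l = i then 1 else 0, fun _ _ => 0⟩

/-- `x ∂_y - y ∂_x`. -/
def rotation : Generator := ⟨fun l p _ => ![-p.2.1, p.1, 0] l, fun _ _ => 0⟩

/-- The coefficient `ξ^i` as a function on the jet space. -/
def xi (X : Generator) (i : Fin 3) : Jet → ℝ := fun j => X.ξ i j.1 (u_0 j)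

/-- The coefficient `η` as a function on the jet space. -/
def eta (X : Generator) : Jet → ℝ := fun j => X.η j.1 (u_0 j)

/-- The coefficients `η_K` of `∂/∂u_K` in the prolongation of `X`, `K = (0, 0, c)`, by the
recursion `η_{K+e_i} = D_i η_K - ∑_l (D_i ξ^l) u_{K+e_l}` that starts from `η_0 = η`. -/
def prolT (X : Generator) : ℕ → Jet → ℝ
  | 0 => X.eta
  | c + 1 => fun j => D 2 (prolT X c) j - ∑ l, D 2 (X.xi l) j * j.2 ((0, 0, c) + e l)

/-- The coefficients `η_K` for `K = (0, b, c)`. -/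
def prolY (X : Generator) : ℕ → ℕ → Jet → ℝ
  | 0, c => X.prolT c
  | b + 1, c => fun j => D 1 (prolY X b c) j - ∑ l, D 1 (X.xi l) j * j.2 ((0, b, c) + e l)

/-- The coefficients `η_K` for `K = (a, b, c)`. -/
def prol (X : Generator) : ℕ → ℕ → ℕ → Jet → ℝ
  | 0, b, c => X.prolY b c
  | a + 1, b, c => fun j => D 0 (prol X a b c) j - ∑ l, D 0 (X.xi l) j * j.2 ((a, b, c) + e l)

/-- The action of the prolonged generator on functions on the jet space. -/
def act (X : Generator) (F : Jet → ℝ) : Jet → ℝ := fun j =>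
  lineDeriv ℝ F j ((X.xi 0 j, X.xi 1 j, X.xi 2 j), fun K => X.prol K.1 K.2.1 K.2.2 j)

/-- The linearized symmetry condition: `X` is a Lie point symmetry of `Δ = 0`. -/
def IsSymmetry (X : Generator) (Δ : Jet → ℝ) : Prop := ∀ j, Δ j = 0 → X.act Δ j = 0

/-- `W = η - ξ¹ u_x - ξ² u_y - ξ³ u_t`. -/
def W (X : Generator) : Jet → ℝ := fun j => X.eta j - ∑ i, X.xi i j * j.2 (e i)

end Generator

/-- The formal Lagrangian `υ Δ`, where `υ` is a function of `(x, y, t)`. -/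
def lagr (υ : ℝ × ℝ × ℝ → ℂ) (Δ : Jet → ℝ) : Jet → ℂ := fun j => υ j.1 * Δ j

/-- The total order of a multi-index. -/
def ord (K : ℕ × ℕ × ℕ) : ℕ := K.1 + K.2.1 + K.2.2

/-- The multi-indices of order at most `n`. -/
def idx (n : ℕ) : Finset (ℕ × ℕ × ℕ) :=
  (Finset.range (n + 1) ×ˢ (Finset.range (n + 1) ×ˢ Finset.range (n + 1))).filter (ord · ≤ n)

/-- The multinomial coefficient `(a + b + c)! / (a! b! c!)`. -/
def mult (K : ℕ × ℕ × ℕ) : ℝ :=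
  ((ord K).factorial : ℝ) / (K.1.factorial * K.2.1.factorial * K.2.2.factorial)

/-- The Euler-Lagrange operator `δL/δu` on functions `L` of order at most four. -/
def euler (L : Jet → ℂ) : Jet → ℂ := fun j =>
  ∑ K ∈ idx 4, (-1) ^ ord K * DD K (dU K L) j

/-- `υ = υ(x, y, t)` makes the adjoint equation `δ(υ Δ)/δu = 0` hold identically. -/
def SolvesAdjoint (Δ : Jet → ℝ) (υ : ℝ × ℝ × ℝ → ℂ) : Prop := ∀ j, euler (lagr υ Δ) j = 0

/-- The Noether operator of `X` applied to a function `L` of order at most four,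
`N^i = ξ^i L + ∑_K D_K(W) δ*L/δ*u_{i K}`. In terms of the symmetric partial derivatives with respect
to `u_{i₁ i₂ ⋯}` this is the usual
`ξ^i L + W (L_{u_i} - D_l L_{u_{il}} + ⋯) + D_l(W) (L_{u_{il}} - D_m L_{u_{ilm}} + ⋯) + ⋯`;
collecting equal derivatives produces the quotients of multinomial coefficients. -/
def noether (X : Generator) (L : Jet → ℂ) (i : Fin 3) : Jet → ℂ := fun j =>
  X.xi i j * L j +
    ∑ K ∈ idx 3, ((DD K X.W j : ℝ) : ℂ) * ∑ J ∈ idx (3 - ord K),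
      (-1) ^ ord J * ((mult K * mult J / mult (K + J + e i) : ℝ) : ℂ) *
        DD J (dU (K + J + e i) L) j

/-- `C` is a conserved vector of `Δ = 0` built from the symmetry `X` and the multiplier `υ`:
`X` is a Lie point symmetry, `C` is conserved, and, up to the overall sign and up to a trivial
conserved vector, `C` is the vector given by the Noether operator of `X` and the formal Lagrangian
`υ Δ`. -/
def BuiltFrom (Δ : Jet → ℝ) (υ : ℝ × ℝ × ℝ → ℂ) (X : Generator) (C : Fin 3 → Jet → ℂ) : Prop :=
  X.IsSymmetry Δ ∧ IsConserved Δ C ∧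
    IsTrivial Δ (fun i j => C i j + noether X (lagr υ Δ) i j)

/-! ### Explicit vectors: `r = u/2 + α`, `g = β u + γ`, `h = β`, `f = δ u² + ε u + ζ` -/

namespace Case1

/-- `Δ` for `r = u/2 + α`, `g = β u + γ`, `h = β`, `f = δ u² + ε u + ζ`. -/
def eqn (α β γ δ ε ζ : ℝ) : Jet → ℝ :=
  Delta (fun w => δ * w ^ 2 + ε * w + ζ) (fun w => β * w + γ) (fun _ => β) (fun w => w / 2 + α)

/-- The linear system for the multiplier `F`. -/
def System (α β γ δ ε : ℝ) (F : ℝ × ℝ × ℝ → ℂ) : Prop :=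
  ∀ p, 2 * δ * F p + β * d 0 2 0 F p + d 2 0 0 F p / 2 = 0 ∧
    ε * F p + d 0 0 1 F p + γ * d 0 2 0 F p - d 0 4 0 F p + α * d 2 0 0 F p
      - 2 * d 2 2 0 F p - d 4 0 0 F p = 0

/-- The vector of `∂_t`. -/
def Ct (α β γ δ ζ : ℝ) (F : ℝ × ℝ × ℝ → ℂ) : Fin 3 → Jet → ℂ := ![
  fun j => (4 * (1 - 6 * β) * d 0 2 1 F j.1 * u_x j + 3 * u_0 j ^ 2 * d 1 0 1 F j.1 - 8 *
    d 0 1 1 F j.1 * u_xy j + 8 * u_y j * d 1 1 1 F j.1 - 6 * d 0 0 1 F j.1 * ((2 * α + 8 * δ +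
    u_0 j) * u_x j - 2 * (u_xyy j + u_xxx j)) - 4 * d 1 0 1 F j.1 * (u_yy j + 3 * u_xx j)) / 12 +
    u_0 j * ((α + 4 * δ) * d 1 0 1 F j.1 - d 1 2 1 F j.1) + 2 * β * u_0 j * d 1 2 1 F j.1,
  fun j => (3 * β * u_0 j ^ 2 * d 0 1 1 F j.1 + d 0 0 1 F j.1 * (-2 * (3 * γ + 4 * δ + 3 * β *
    u_0 j) * u_y j + 6 * (u_yyy j + u_xxy j)) - 2 * ((-3 + 2 * β) * u_y j * d 0 2 1 F j.1 + 2 *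
    d 1 0 1 F j.1 * u_xy j - 2 * u_x j * d 1 1 1 F j.1 + d 0 1 1 F j.1 * (3 * u_yy j + u_xx j))) /
    6 + u_0 j * ((γ + 4 * δ) * d 0 1 1 F j.1 + (-1 + 2 * β) * d 0 3 1 F j.1),
  fun j => -ζ * F j.1 + u_0 j * d 0 0 1 F j.1]

/-- The vector of `∂_x`. -/
def Cx (α β γ δ ε ζ : ℝ) (F : ℝ × ℝ × ℝ → ℂ) : Fin 3 → Jet → ℂ := ![
  fun j => (3 * u_x j * (2 * (1 - 2 * β) * d 1 2 0 F j.1 - (2 * α + 8 * δ + u_0 j) *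
    d 1 0 0 F j.1) - 2 * d 0 1 0 F j.1 * u_xxy j + 2 * ((6 * β - 1) * d 0 2 0 F j.1 * u_xx j +
    d 1 0 0 F j.1 * (u_xyy j + 3 * u_xxx j) - 2 * u_xy j * d 1 1 0 F j.1)) / 6 - d 0 1 0 F j.1 *
    u_yyy j - F j.1 * (ζ - u_t j + β * u_y j ^ 2 + γ * u_yy j + u_0 j * (ε + δ * u_0 j + β *
    u_yy j) - 4 * δ * u_xx j),
  fun j => ((-3 + 2 * β) * d 0 2 0 F j.1 * u_xy j + F j.1 * (3 * β * u_y j * u_x j + (3 * γ +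
    4 * δ + 3 * β * u_0 j) * u_xy j) - 2 * d 1 1 0 F j.1 * u_xx j + d 1 0 0 F j.1 * (3 * u_yyy j +
    5 * u_xxy j) + d 0 1 0 F j.1 * u_xxx j) / 3 + (1 - 2 * β) * d 0 3 0 F j.1 * u_x j +
    d 0 1 0 F j.1 * (u_xyy j - (γ + 4 * δ + β * u_0 j) * u_x j),
  fun j => -F j.1 * u_x j]

/-- The vector of `∂_y`. -/
def Cy (α β γ δ ε ζ : ℝ) (F : ℝ × ℝ × ℝ → ℂ) : Fin 3 → Jet → ℂ := ![
  fun j => (3 * u_y j * (2 * (1 - 2 * β) * d 1 2 0 F j.1 - (2 * α + 8 * δ + u_0 j) *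
    d 1 0 0 F j.1) + 2 * ((6 * β - 1) * d 0 2 0 F j.1 * u_xy j - 2 * d 1 1 0 F j.1 * u_yy j +
    d 1 0 0 F j.1 * (u_yyy j + 3 * u_xxy j) + d 0 1 0 F j.1 * (5 * u_xyy j + 3 * u_xxx j)) + 3 *
    F j.1 * (u_y j * u_x j + (2 * α + 8 * δ + u_0 j) * u_xy j)) / 6,
  fun j => ((-3 + 2 * β) * d 0 2 0 F j.1 * u_yy j + 4 * δ * F j.1 * u_yy j - 2 * d 1 1 0 F j.1 *
    u_xy j + d 0 1 0 F j.1 * (3 * u_yyy j + u_xxy j) - d 1 0 0 F j.1 * (u_xyy j + 3 * u_xxx j)) /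
    3 + (1 - 2 * β) * d 0 3 0 F j.1 * u_y j - (γ + 4 * δ + β * u_0 j) * d 0 1 0 F j.1 * u_y j -
    F j.1 * (ζ - u_t j + u_x j ^ 2 / 2 + α * u_xx j + u_0 j * (ε + δ * u_0 j + u_xx j / 2)),
  fun j => -F j.1 * u_y j]

/-- The vector of `x ∂_y - y ∂_x`, for `β = 1/2` and `γ = α`. -/
def Crot (α δ ε ζ : ℝ) (F : ℝ × ℝ × ℝ → ℂ) : Fin 3 → Jet → ℂ := ![
  fun j => (2 * j.1.1 * u_yyy j * d 1 0 0 F j.1 + 3 * j.1.2.1 * u_0 j * u_x j * d 1 0 0 F j.1 +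
    u_y j * (4 * d 0 2 0 F j.1 - 3 * j.1.1 * (2 * α + 8 * δ + u_0 j) * d 1 0 0 F j.1) + 4 *
    j.1.1 * d 0 2 0 F j.1 * u_xy j + 8 * d 1 0 0 F j.1 * u_xy j - 4 * j.1.1 * u_yy j *
    d 1 1 0 F j.1 + 4 * u_x j * d 1 1 0 F j.1 + 4 * j.1.2.1 * u_xy j * d 1 1 0 F j.1 - 2 *
    j.1.2.1 * d 1 0 0 F j.1 * u_xyy j - 4 * j.1.2.1 * d 0 2 0 F j.1 * u_xx j + 2 * d 0 1 0 F j.1 *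
    (2 * u_yy j + 2 * j.1.1 * u_xyy j - 2 * u_xx j + j.1.2.1 * u_xxy j) + 3 * F j.1 * (j.1.2.1 *
    u_y j ^ 2 + j.1.1 * u_y j * u_x j + u_0 j * (u_y j + j.1.2.1 * u_yy j + j.1.1 * u_xy j))) / 6
    + j.1.2.1 * α * u_x j * d 1 0 0 F j.1 + 4 * j.1.2.1 * δ * u_x j * d 1 0 0 F j.1 + j.1.1 *
    d 1 0 0 F j.1 * u_xxy j - j.1.2.1 * d 1 0 0 F j.1 * u_xxx j + d 0 1 0 F j.1 * (j.1.2.1 *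
    u_yyy j + j.1.1 * u_xxx j) + F j.1 * (j.1.2.1 * ζ + j.1.2.1 * δ * u_0 j ^ 2 - j.1.2.1 * u_t j
    + (α + 4 * δ) * u_y j + j.1.2.1 * α * u_yy j + j.1.1 * α * u_xy j + 4 * j.1.1 * δ * u_xy j +
    ε * j.1.2.1 * u_0 j - j.1.1 * u_xyyy j - 4 * j.1.2.1 * δ * u_xx j),
  fun j => (-4 * j.1.1 * u_yy j * d 0 2 0 F j.1 + 3 * j.1.2.1 * u_0 j * d 0 1 0 F j.1 * u_x j +
    4 * d 0 2 0 F j.1 * u_x j + 4 * u_yy j * d 1 0 0 F j.1 - 8 * d 0 1 0 F j.1 * u_xy j + 4 *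
    j.1.2.1 * d 0 2 0 F j.1 * u_xy j - u_y j * (3 * j.1.1 * (2 * α + 8 * δ + u_0 j) *
    d 0 1 0 F j.1 + 4 * d 1 1 0 F j.1) - 4 * j.1.1 * u_xy j * d 1 1 0 F j.1 + 4 * j.1.1 *
    d 1 0 0 F j.1 * u_xyy j - 4 * d 1 0 0 F j.1 * u_xx j + 4 * j.1.2.1 * d 1 1 0 F j.1 * u_xx j +
    2 * j.1.1 * d 0 1 0 F j.1 * u_xxy j - 10 * j.1.2.1 * d 1 0 0 F j.1 * u_xxy j - 2 * j.1.2.1 *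
    d 0 1 0 F j.1 * u_xxx j - F j.1 * (8 * δ * u_x j - 8 * j.1.1 * δ * u_yy j + 3 * j.1.2.1 *
    u_y j * u_x j + 3 * j.1.1 * u_x j ^ 2 + 8 * j.1.2.1 * δ * u_xy j + 3 * u_0 j * (u_x j +
    j.1.2.1 * u_xy j + j.1.1 * u_xx j))) / 6 + j.1.1 * d 0 1 0 F j.1 * u_yyy j + j.1.2.1 * α *
    d 0 1 0 F j.1 * u_x j + 4 * j.1.2.1 * δ * d 0 1 0 F j.1 * u_x j - j.1.2.1 * u_yyy j *
    d 1 0 0 F j.1 - j.1.2.1 * d 0 1 0 F j.1 * u_xyy j - j.1.1 * d 1 0 0 F j.1 * u_xxx j - F j.1 *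
    (j.1.1 * ζ + j.1.1 * δ * u_0 j ^ 2 - j.1.1 * u_t j + α * u_x j + j.1.2.1 * α * u_xy j -
    u_xyy j + j.1.1 * α * u_xx j + ε * j.1.1 * u_0 j - j.1.1 * u_xxyy j),
  fun j => F j.1 * (j.1.2.1 * u_x j - j.1.1 * u_y j)]

end Case1

/-- The data of the remaining cases: real parameters of the equation, the function `g` and an
antiderivative `G = ∫ g du` of it, two complex numbers `a`, `b` that stand for the square roots in
the multipliers, and the constants of the multipliers. -/
structure Params where
  (α β γ δ c : ℝ)
  (g G : ℝ → ℝ)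
  (a b : ℂ)
  (c₁ c₂ c₃ c₄ : ℂ)

namespace Params

/-- `g` is smooth and `g''` is not identically zero. -/
def Admissible (P : Params) : Prop := ContDiff ℝ ∞ P.g ∧ ∃ w, iteratedDeriv 2 P.g w ≠ 0

/-- `G` is an antiderivative of `g`. -/
def Antideriv (P : Params) : Prop := ∀ w, HasDerivAt P.G (P.g w) w

/-- The constants of the multiplier are not all zero. -/
def NonzeroConsts (P : Params) : Prop := ¬ (P.c₁ = 0 ∧ P.c₂ = 0 ∧ P.c₃ = 0 ∧ P.c₄ = 0)

end Params

/-! ### Explicit vectors: `r = u/2 + δ`, `h = g'`, `f = α u²/2 + β u + γ + c ∫ g du` -/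

namespace Case2

variable (P : Params)

/-- `Δ` for `r = u/2 + δ`, `h = g'`, `f = α u²/2 + β u + γ + c ∫ g du`. -/
def eqn : Jet → ℝ :=
  Delta (fun w => P.α * w ^ 2 / 2 + P.β * w + P.γ + P.c * P.G w) P.g (deriv P.g)
    (fun w => w / 2 + P.δ)

/-- The exponential rate of the multiplier. -/
def rate : ℝ := 2 * P.α * (2 * P.α + P.δ) + 4 * P.α * P.c + P.c ^ 2 - P.β

def ex (p : ℝ × ℝ × ℝ) : ℂ := Complex.exp (rate P * p.2.2)

def A (p : ℝ × ℝ × ℝ) : ℂ :=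
  Complex.cos (P.a * p.1) * (P.c₂ * Complex.cos (P.b * p.2.1) + P.c₄ * Complex.sin (P.b * p.2.1))
    - Complex.sin (P.a * p.1) * (P.c₁ * Complex.cos (P.b * p.2.1) + P.c₃ * Complex.sin (P.b * p.2.1))

def B (p : ℝ × ℝ × ℝ) : ℂ :=
  Complex.cos (P.a * p.1) * (P.c₁ * Complex.cos (P.b * p.2.1) + P.c₃ * Complex.sin (P.b * p.2.1))
    + Complex.sin (P.a * p.1) * (P.c₂ * Complex.cos (P.b * p.2.1) + P.c₄ * Complex.sin (P.b * p.2.1))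

def C (p : ℝ × ℝ × ℝ) : ℂ :=
  Complex.cos (P.a * p.1) * (P.c₃ * Complex.cos (P.b * p.2.1) - P.c₁ * Complex.sin (P.b * p.2.1))
    + Complex.sin (P.a * p.1) * (P.c₄ * Complex.cos (P.b * p.2.1) - P.c₂ * Complex.sin (P.b * p.2.1))

def E (p : ℝ × ℝ × ℝ) : ℂ :=
  Complex.sin (P.a * p.1) * (P.c₁ * Complex.sin (P.b * p.2.1) - P.c₃ * Complex.cos (P.b * p.2.1))
    + Complex.cos (P.a * p.1) * (P.c₄ * Complex.cos (P.b * p.2.1) - P.c₂ * Complex.sin (P.b * p.2.1))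

/-- The multiplier. -/
def υ (p : ℝ × ℝ × ℝ) : ℂ := ex P p * B P p

/-- The vector of `∂_t`. -/
def Ct : Fin 3 → Jet → ℂ := ![
  fun j => ex P j.1 * rate P * (A P j.1 * P.a * (8 * P.α + 4 * P.δ + 8 * P.c + u_0 j) * u_0 j -
    2 * B P j.1 * (4 * P.α + 2 * P.δ + 4 * P.c + u_0 j) * u_x j - 4 * A P j.1 * P.a * u_xx j + 4 *
    B P j.1 * u_xxx j) / 4,
  fun j => ex P j.1 * rate P * (C P j.1 * P.b * (P.G (u_0 j) + P.c * u_0 j) - B P j.1 * (P.c +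
    P.g (u_0 j)) * u_y j - C P j.1 * P.b * u_yy j + B P j.1 * u_yyy j - 2 * C P j.1 * P.b * u_xx j
    + 2 * B P j.1 * u_xxy j),
  fun j => -ex P j.1 * B P j.1 * (P.γ - rate P * u_0 j)]

/-- The vector of `∂_x`. -/
def Cx : Fin 3 → Jet → ℂ := ![
  fun j => ex P j.1 * (4 * B P j.1 * P.α * u_xx j + 2 * P.a * A P j.1 * u_xxx j - 2 * B P j.1 *
    P.γ - 4 * B P j.1 * P.α * (2 * P.α + P.δ + 2 * P.c) * u_0 j - B P j.1 * P.α * u_0 j ^ 2 -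
    P.a * A P j.1 * (4 * P.α + 2 * P.δ + 4 * P.c + u_0 j) * u_x j) / 2,
  fun j => P.a * ex P j.1 * (E P j.1 * P.b * P.G (u_0 j) + E P j.1 * P.b * P.c * u_0 j -
    (A P j.1 * P.c + A P j.1 * P.g (u_0 j)) * u_y j - E P j.1 * P.b * u_yy j + A P j.1 * u_yyy j -
    2 * E P j.1 * P.b * u_xx j + 2 * A P j.1 * u_xxy j),
  fun j => P.a * ex P j.1 * A P j.1 * u_0 j]

/-- The vector of `∂_y`. -/
def Cy : Fin 3 → Jet → ℂ := ![
  fun j => P.b * ex P j.1 * (4 * C P j.1 * u_xxx j + P.a * E P j.1 * (u_0 j * (8 * P.α + 4 * P.δ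
    + 8 * P.c + u_0 j) - 4 * u_xx j) - 2 * C P j.1 * (4 * P.α + 2 * P.δ + 4 * P.c + u_0 j) *
    u_x j) / 4,
  fun j => -ex P j.1 * (B P j.1 * P.γ + B P j.1 * P.c * P.G (u_0 j) + B P j.1 * P.c ^ 2 * u_0 j
    + C P j.1 * P.b * (P.c + P.g (u_0 j)) * u_y j - P.b * (B P j.1 * P.b * (u_yy j + 2 * u_xx j) +
    C P j.1 * (u_yyy j + 2 * u_xxy j))),
  fun j => C P j.1 * P.b * ex P j.1 * u_0 j]

end Case2

/-! ### Explicit vectors: `r = u/2 + γ`, `h = g'`, `f = α u + β + c ∫ g du` -/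

namespace Case3

variable (P : Params)

/-- `Δ` for `r = u/2 + γ`, `h = g'`, `f = α u + β + c ∫ g du`. -/
def eqn : Jet → ℝ :=
  Delta (fun w => P.α * w + P.β + P.c * P.G w) P.g (deriv P.g) (fun w => w / 2 + P.γ)

/-- The exponential rate of the multiplier. -/
def rate : ℝ := P.c ^ 2 - P.α

def ex (p : ℝ × ℝ × ℝ) : ℂ := Complex.exp (rate P * p.2.2)

def A (p : ℝ × ℝ × ℝ) : ℂ :=
  (P.c₁ + P.c₂ * p.1) * Complex.cos (P.b * p.2.1)
    + (P.c₃ + P.c₄ * p.1) * Complex.sin (P.b * p.2.1)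

def B (p : ℝ × ℝ × ℝ) : ℂ :=
  P.c₂ * Complex.cos (P.b * p.2.1) + P.c₄ * Complex.sin (P.b * p.2.1)

def C (p : ℝ × ℝ × ℝ) : ℂ :=
  (P.c₃ + P.c₄ * p.1) * Complex.cos (P.b * p.2.1)
    - (P.c₁ + P.c₂ * p.1) * Complex.sin (P.b * p.2.1)

def E (p : ℝ × ℝ × ℝ) : ℂ :=
  P.c₄ * Complex.cos (P.b * p.2.1) - P.c₂ * Complex.sin (P.b * p.2.1)

/-- The multiplier. -/
def υ (p : ℝ × ℝ × ℝ) : ℂ := ex P p * A P p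

/-- The vector of `∂_t`. -/
def Ct : Fin 3 → Jet → ℂ := ![
  fun j => ex P j.1 * rate P * (B P j.1 * u_0 j * (4 * P.γ + 8 * P.c + u_0 j) - 2 * A P j.1 *
    (2 * P.γ + 4 * P.c + u_0 j) * u_x j - 4 * B P j.1 * u_xx j + 4 * A P j.1 * u_xxx j) / 4,
  fun j => ex P j.1 * rate P * (C P j.1 * P.b * P.G (u_0 j) + C P j.1 * P.b * P.c * u_0 j -
    A P j.1 * P.c * u_y j - A P j.1 * P.g (u_0 j) * u_y j - C P j.1 * P.b * u_yy j + A P j.1 *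
    u_yyy j - 2 * C P j.1 * P.b * u_xx j + 2 * A P j.1 * u_xxy j),
  fun j => -ex P j.1 * A P j.1 * (P.β - rate P * u_0 j)]

/-- The vector of `∂_x`. -/
def Cx : Fin 3 → Jet → ℂ := ![
  fun j => ex P j.1 * B P j.1 * (u_0 j * (2 * rate P * j.1.1 - u_x j) + 2 * (j.1.1 * u_t j -
    P.β * j.1.1 - P.γ * u_x j + 2 * u_xyy j + u_xxx j)) / 2,
  fun j => ex P j.1 * (E P j.1 * P.b * (P.G (u_0 j) + P.c * u_0 j) - B P j.1 * (P.c +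
    P.g (u_0 j)) * u_y j - E P j.1 * P.b * u_yy j + B P j.1 * u_yyy j),
  fun j => -ex P j.1 * B P j.1 * j.1.1 * u_x j]

/-- The vector of `∂_y`. -/
def Cy : Fin 3 → Jet → ℂ := ![
  fun j => ex P j.1 * P.b * (2 * P.β * j.1.1 * (2 * P.c₁ + P.c₂ * j.1.1) * Complex.sin (P.b *
    j.1.2.1) + E P j.1 * u_0 j ^ 2 - 4 * E P j.1 * (2 * u_yy j + u_xx j) - 2 * P.β * j.1.1 * (2 *
    P.c₃ + P.c₄ * j.1.1) * Complex.cos (P.b * j.1.2.1) + u_0 j * (4 * E P j.1 * P.γ - 2 *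
    C P j.1 * u_x j) + 4 * C P j.1 * (u_xxx j - P.γ * u_x j + 2 * u_xyy j)) / 4,
  fun j => P.b * ex P j.1 * (A P j.1 * P.b * u_yy j + C P j.1 * u_yyy j - A P j.1 * P.b *
    (P.G (u_0 j) + P.c * u_0 j) - C P j.1 * (P.c + P.g (u_0 j)) * u_y j),
  fun j => C P j.1 * P.b * ex P j.1 * u_0 j]

end Case3

/-! ### Explicit vectors: `r = u/2 + δ`, `h = g'`, `f = α u² + β u + γ` -/

namespace Case4

variable (P : Params)

/-- `Δ` for `r = u/2 + δ`, `h = g'`, `f = α u² + β u + γ`. -/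
def eqn : Jet → ℝ :=
  Delta (fun w => P.α * w ^ 2 + P.β * w + P.γ) P.g (deriv P.g) (fun w => w / 2 + P.δ)

/-- The exponential rate of the multiplier. -/
def rate : ℝ := 16 * P.α ^ 2 - P.β + 4 * P.α * P.δ

def ex (p : ℝ × ℝ × ℝ) : ℂ := Complex.exp (rate P * p.2.2)

def A (p : ℝ × ℝ × ℝ) : ℂ :=
  (P.c₁ * p.2.1 + P.c₂) * Complex.cos (2 * P.a * p.1)
    + (P.c₃ * p.2.1 + P.c₄) * Complex.sin (2 * P.a * p.1)

def B (p : ℝ × ℝ × ℝ) : ℂ :=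
  (P.c₃ * p.2.1 + P.c₄) * Complex.cos (2 * P.a * p.1)
    - (P.c₁ * p.2.1 + P.c₂) * Complex.sin (2 * P.a * p.1)

def C (p : ℝ × ℝ × ℝ) : ℂ :=
  P.c₁ * Complex.cos (2 * P.a * p.1) + P.c₃ * Complex.sin (2 * P.a * p.1)

def E (p : ℝ × ℝ × ℝ) : ℂ :=
  P.c₃ * Complex.cos (2 * P.a * p.1) - P.c₁ * Complex.sin (2 * P.a * p.1)

/-- The multiplier. -/
def υ (p : ℝ × ℝ × ℝ) : ℂ := ex P p * A P p

/-- The vector of `∂_t`. -/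
def Ct : Fin 3 → Jet → ℂ := ![
  fun j => ex P j.1 * rate P * (B P j.1 * P.a * u_0 j ^ 2 - 2 * (A P j.1 * (4 * P.α + P.δ) *
    u_x j + 2 * B P j.1 * P.a * u_xx j - A P j.1 * u_xxx j) + (4 * B P j.1 * P.a * (4 * P.α + P.δ)
    - A P j.1 * u_x j) * u_0 j) / 2,
  fun j => -ex P j.1 * (P.g (u_0 j) * (C P j.1 * u_t j + A P j.1 * rate P * u_y j) + rate P *
    (C P j.1 * u_yy j - A P j.1 * u_yyy j + 2 * (C P j.1 * u_xx j - A P j.1 * u_xxy j))),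
  fun j => ex P j.1 * (A P j.1 * rate P * u_0 j + C P j.1 * P.g (u_0 j) * u_y j - A P j.1 * P.γ)]

/-- The vector of `∂_x`. -/
def Cx : Fin 3 → Jet → ℂ := ![
  fun j => ex P j.1 * (C P j.1 * P.g (u_0 j) * u_y j - A P j.1 * P.α * u_0 j ^ 2 - u_0 j * (4 *
    A P j.1 * P.α * (4 * P.α + P.δ) + B P j.1 * P.a * u_x j) - 2 * P.a * (B P j.1 * (4 * P.α +
    P.δ) * u_x j - 2 * A P j.1 * P.a * u_xx j - B P j.1 * u_xxx j)),
  fun j => ex P j.1 * (P.a * (2 * B P j.1 * u_yyy j + Complex.sin (2 * P.a * j.1.1) * (P.γ *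
    (P.c₁ * j.1.2.1 + 2 * P.c₂) * j.1.2.1 - 4 * (P.c₁ * j.1.2.1 + P.c₂) * u_xxy j + 2 * P.c₁ *
    (u_yy j + 2 * u_xx j)) - Complex.cos (2 * P.a * j.1.1) * (2 * P.c₃ * (u_yy j + 2 * u_xx j) +
    P.γ * (P.c₃ * j.1.2.1 + 2 * P.c₄) * j.1.2.1 - 4 * (P.c₃ * j.1.2.1 + P.c₄) * u_xxy j)) -
    P.g (u_0 j) * (2 * B P j.1 * P.a * u_y j + C P j.1 * u_x j)),
  fun j => 2 * ex P j.1 * B P j.1 * P.a * u_0 j]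

/-- The vector of `∂_y`. -/
def Cy : Fin 3 → Jet → ℂ := ![
  fun j => ex P j.1 * (E P j.1 * P.a * u_0 j ^ 2 + (4 * E P j.1 * P.a * (4 * P.α + P.δ) -
    C P j.1 * u_x j) * u_0 j - 2 * (C P j.1 * (4 * P.α + P.δ) * u_x j + 2 * E P j.1 * P.a * u_xx j
    - C P j.1 * u_xxx j)) / 2,
  fun j => C P j.1 * ex P j.1 * (u_yyy j + 2 * u_xxy j - P.γ * j.1.2.1 - P.g (u_0 j) * u_y j),
  fun j => ex P j.1 * C P j.1 * u_0 j]

end Case4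

/-! ### Explicit vectors: `r = u/2 + γ`, `h = g'`, `f = α u + β` -/

namespace Case5

variable (P : Params)

/-- `Δ` for `r = u/2 + γ`, `h = g'`, `f = α u + β`. -/
def eqn : Jet → ℝ :=
  Delta (fun w => P.α * w + P.β) P.g (deriv P.g) (fun w => w / 2 + P.γ)

/-- The exponential rate of the multiplier. -/
def rate : ℝ := -P.α

def ex (p : ℝ × ℝ × ℝ) : ℂ := Complex.exp (rate P * p.2.2)

def A (p : ℝ × ℝ × ℝ) : ℂ :=
  (P.c₁ + P.c₂ * p.1) * p.2.1 + P.c₃ + P.c₄ * p.1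

def B (p : ℝ × ℝ × ℝ) : ℂ :=
  P.c₂ * p.2.1 + P.c₄

def C (p : ℝ × ℝ × ℝ) : ℂ :=
  P.c₁ + P.c₂ * p.1

/-- The multiplier. -/
def υ (p : ℝ × ℝ × ℝ) : ℂ := ex P p * A P p

/-- The vector of `∂_t`. -/
def Ct : Fin 3 → Jet → ℂ := ![
  fun j => P.α / 4 * ex P j.1 * (2 * u_0 j * (A P j.1 * u_x j - 2 * P.γ * B P j.1) + 4 * P.γ *
    A P j.1 * u_x j + 4 * B P j.1 * u_xx j - B P j.1 * u_0 j ^ 2 - 4 * A P j.1 * u_xxx j),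
  fun j => ex P j.1 * (P.g (u_0 j) * (P.α * A P j.1 * u_y j - C P j.1 * u_t j) + P.α *
    (C P j.1 * u_yy j - A P j.1 * u_yyy j + 2 * C P j.1 * u_xx j - 2 * A P j.1 * u_xxy j)),
  fun j => ex P j.1 * (C P j.1 * P.g (u_0 j) * u_y j - A P j.1 * (P.β + P.α * u_0 j))]

/-- The vector of `∂_x`. -/
def Cx : Fin 3 → Jet → ℂ := ![
  fun j => ex P j.1 * (2 * P.c₂ * j.1.1 * P.g (u_0 j) * u_y j - B P j.1 * (2 * P.β * j.1.1 +
    (2 * P.γ + u_0 j) * u_x j - 4 * u_xyy j - 2 * u_xxx j)) / 2,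
  fun j => ex P j.1 * (B P j.1 * u_yyy j - P.c₂ * u_yy j - P.g (u_0 j) * (B P j.1 * u_y j +
    P.c₂ * j.1.1 * u_x j)),
  fun j => ex P j.1 * B P j.1 * u_0 j]

/-- The vector of `∂_y`. -/
def Cy : Fin 3 → Jet → ℂ := ![
  fun j => ex P j.1 * (P.c₂ * u_0 j ^ 2 - 4 * P.γ * C P j.1 * u_x j + 2 * u_0 j * (2 * P.γ *
    P.c₂ - C P j.1 * u_x j) - 4 * P.c₂ * u_xx j + 4 * C P j.1 * u_xxx j) / 4,
  fun j => ex P j.1 * C P j.1 * (u_yyy j + 2 * u_xxy j - P.β * j.1.2.1 - P.g (u_0 j) * u_y j),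
  fun j => ex P j.1 * C P j.1 * u_0 j]

end Case5

end KS

end

open KS

/-! Conservation rests on an identity that holds on all jets, on shell or not: each listed vector
satisfies `div C = -(Q * Δ)`, where `Q` is the generator applied to the multiplier, that is `υ_t`,
`υ_x`, `υ_y` or `x υ_y - y υ_x`. On the Noether side, integration by parts (`div_noether`) gives,
for `L = υ Δ`, that `div N` equals `D_l (ξ^l L) + ∑ D_K(W) ∂L/∂u_K - W δL/δu`. The last term
vanishes by the adjoint equation. The others combine into the prolonged generator acting on `L` plus
`L` times the divergence of `ξ`. Translations and the rotation have divergence-free coefficients,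
and their prolongations annihilate the relevant `Δ` identically, so only `Q Δ` survives
(`div_noether_translation`, `div_noether_rotation`). Hence `C` is conserved and `C + N` has
identically zero divergence, so it is trivial (`builtFrom_of_div`). For a constant multiplier `Q =
0` and `N` itself is trivial.

Nontriviality is the statement that `C` is trivial exactly when `Q = 0` (`isTrivial_iff`). If `Q =
0`, then `div C` vanishes identically. For the converse let `C = A + B` with `A` zero on shell and
`B` identically divergence-free. Up to `D_x M + D_y N` the third component is `a + Q u`, with `a`
and `Q` functions of the base point. No existence theorem for the equation is needed: `u_t` can be
solved for, so any initial datum on a slice `t = t₀` has a formal solution in powers of `t - t₀`,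
and a truncation `taylorSol` of high enough degree makes `A 2` vanish on the slice. Take the
truncations for a compactly supported datum `φ` and for the datum zero, and glue them by a cutoff in
time. The glued function need not solve the equation, but `div B = 0` holds along every function.
The divergence theorem on a box then yields `∫ φ Q = 0` on the slice for every `φ`, so `Q = 0`
(`integral_charge_eq_zero`, `charge_eq_zero_of_isTrivial`).

What remains is computation. When `h = g'` and `r' = 1/2`, the adjoint expression contains no
derivatives of `u` (`euler_lagr_of_half`), so the multiplier condition is linear in `υ`, with
coefficients `1`, `u` and possibly `g(u)`. The identities `div C = -(Q * Δ)` become polynomial once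
the derivatives of `υ` are in normal form, either through the linear system for `F` or through
finite families of functions closed under differentiation. The stated nontriviality conditions
express `Q ≠ 0`, by linear independence of the trigonometric and affine functions involved. -/

namespace KS

/-! ### Differential functions and total derivatives -/

section Calculus

variable {V W : Type*} [NormedAddCommGroup V] [NormedSpace ℝ V]
  [NormedAddCommGroup W] [NormedSpace ℝ W]

/-- The projection of a jet to its base point and finitely many derivatives. -/
def proj (S : Finset (ℕ × ℕ × ℕ)) (j : Jet) : (ℝ × ℝ × ℝ) × (S → ℝ) := (j.1, fun K => j.2 K)

/-- The direction of the total derivative `D i` at the jet `j`. -/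
def dir (i : Fin 3) (j : Jet) : Jet := (ev i, fun K => j.2 (K + e i))

theorem isDiffFun_iff {F : Jet → V} :
    IsDiffFun F ↔ ∃ (S : Finset (ℕ × ℕ × ℕ)) (P : (ℝ × ℝ × ℝ) × (S → ℝ) → V),
      ContDiff ℝ ∞ P ∧ F = P ∘ proj S := by
  simp only [IsDiffFun, funext_iff]; rfl

theorem exists_proj_of_subset {F : Jet → V} {S T : Finset (ℕ × ℕ × ℕ)} (h : S ⊆ T)
    {P : (ℝ × ℝ × ℝ) × (S → ℝ) → V} (hP : ContDiff ℝ ∞ P) (hF : F = P ∘ proj S) :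
    ∃ Q : (ℝ × ℝ × ℝ) × (T → ℝ) → V, ContDiff ℝ ∞ Q ∧ F = Q ∘ proj T := by
  refine ⟨fun q => P (q.1, fun K => q.2 ⟨K, h K.2⟩), by fun_prop, hF⟩

theorem IsDiffFun.comp {F : Jet → V} (hF : IsDiffFun F) {Φ : V → W} (hΦ : ContDiff ℝ ∞ Φ) :
    IsDiffFun fun j => Φ (F j) := by
  obtain ⟨S, P, hP, rfl⟩ := isDiffFun_iff.1 hF
  exact isDiffFun_iff.2 ⟨S, Φ ∘ P, hΦ.comp hP, rfl⟩

theorem IsDiffFun.prodMk {F : Jet → V} {G : Jet → W} (hF : IsDiffFun F) (hG : IsDiffFun G) :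
    IsDiffFun fun j => (F j, G j) := by
  classical
  obtain ⟨S, P, hP, hF⟩ := isDiffFun_iff.1 hF
  obtain ⟨T, Q, hQ, hG⟩ := isDiffFun_iff.1 hG
  obtain ⟨P', hP', hF⟩ := exists_proj_of_subset (Finset.subset_union_left (s₂ := T)) hP hF
  obtain ⟨Q', hQ', hG⟩ := exists_proj_of_subset (Finset.subset_union_right (s₁ := S)) hQ hG
  subst hF; rw [hG]
  exact isDiffFun_iff.2 ⟨S ∪ T, fun q => (P' q, Q' q), hP'.prodMk hQ', rfl⟩

theorem isDiffFun_base {φ : ℝ × ℝ × ℝ → V} (hφ : ContDiff ℝ ∞ φ) :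
    IsDiffFun fun j : Jet => φ j.1 :=
  isDiffFun_iff.2 ⟨∅, fun q => φ q.1, by fun_prop, rfl⟩

theorem isDiffFun_const (c : V) : IsDiffFun fun _ : Jet => c := isDiffFun_base contDiff_const

theorem isDiffFun_coord (K : ℕ × ℕ × ℕ) : IsDiffFun fun j : Jet => j.2 K :=
  isDiffFun_iff.2 ⟨{K}, fun q => q.2 ⟨K, by simp⟩, by fun_prop, rfl⟩

theorem isDiffFun_u_0 : IsDiffFun u_0 := isDiffFun_coord _

theorem isDiffFun_fun_u {φ : ℝ → ℝ} (hφ : ContDiff ℝ ∞ φ) : IsDiffFun fun j => φ (j.2 (0, 0, 0)) :=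
  (isDiffFun_coord _).comp hφ

theorem isDiffFun_x : IsDiffFun fun j : Jet => j.1.1 := isDiffFun_base contDiff_fst

theorem isDiffFun_y : IsDiffFun fun j : Jet => j.1.2.1 :=
  isDiffFun_base (φ := fun p => p.2.1) (by fun_prop)

theorem IsDiffFun.add {F G : Jet → V} (hF : IsDiffFun F) (hG : IsDiffFun G) :
    IsDiffFun fun j => F j + G j := (hF.prodMk hG).comp contDiff_add

theorem IsDiffFun.neg {F : Jet → V} (hF : IsDiffFun F) : IsDiffFun fun j => -F j :=
  hF.comp contDiff_neg

theorem IsDiffFun.sub {F G : Jet → V} (hF : IsDiffFun F) (hG : IsDiffFun G) :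
    IsDiffFun fun j => F j - G j := by
  simpa only [sub_eq_add_neg] using hF.add hG.neg

theorem IsDiffFun.mul {A : Type*} [NormedRing A] [NormedAlgebra ℝ A] {F G : Jet → A}
    (hF : IsDiffFun F) (hG : IsDiffFun G) : IsDiffFun fun j => F j * G j :=
  (hF.prodMk hG).comp (Φ := fun q : A × A => q.1 * q.2) (by fun_prop)

theorem IsDiffFun.div_const {𝕜 : Type*} [NormedField 𝕜] [NormedAlgebra ℝ 𝕜] {F : Jet → 𝕜}
    (hF : IsDiffFun F) (c : 𝕜) : IsDiffFun fun j => F j / c := by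
  simpa only [div_eq_mul_inv] using hF.mul (isDiffFun_const c⁻¹)

theorem IsDiffFun.pow {A : Type*} [NormedRing A] [NormedAlgebra ℝ A] {F : Jet → A}
    (hF : IsDiffFun F) (n : ℕ) : IsDiffFun fun j => F j ^ n :=
  hF.comp (Φ := fun q : A => q ^ n) (by fun_prop)

theorem IsDiffFun.ofReal {F : Jet → ℝ} (hF : IsDiffFun F) : IsDiffFun fun j => (F j : ℂ) :=
  hF.comp Complex.ofRealCLM.contDiff

theorem IsDiffFun.sum {ι : Type*} {s : Finset ι} {F : ι → Jet → V} (hF : ∀ k ∈ s, IsDiffFun (F k)) :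
    IsDiffFun fun j => ∑ k ∈ s, F k j := by
  classical
  induction s using Finset.induction_on with
  | empty => simpa using isDiffFun_const (0 : V)
  | insert a s ha ih =>
    simp only [Finset.sum_insert ha]
    exact (hF a (by simp)).add (ih fun k hk => hF k (by simp [hk]))

/-- The infinite jet space carries no norm, so derivatives there are taken along lines. Since `proj
S` is linear, such a derivative is a Fréchet derivative of `P` in finite dimension; all calculus on
jets passes through this. -/
theorem hasLineDerivAt_proj {S : Finset (ℕ × ℕ × ℕ)} {P : (ℝ × ℝ × ℝ) × (S → ℝ) → V}
    (hP : ContDiff ℝ ∞ P) (j v : Jet) :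
    HasLineDerivAt ℝ (P ∘ proj S) (fderiv ℝ P (proj S j) (proj S v)) j v := by
  have h := ((hP.differentiable (by simp)) (proj S j)).hasFDerivAt.hasLineDerivAt (proj S v)
  exact h

theorem IsDiffFun.hasLineDerivAt {F : Jet → V} (hF : IsDiffFun F) (j v : Jet) :
    HasLineDerivAt ℝ F (lineDeriv ℝ F j v) j v := by
  obtain ⟨S, P, hP, rfl⟩ := isDiffFun_iff.1 hF
  exact (hasLineDerivAt_proj hP j v).lineDifferentiableAt.hasLineDerivAt

theorem D_proj {S : Finset (ℕ × ℕ × ℕ)} {P : (ℝ × ℝ × ℝ) × (S → ℝ) → V}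
    (hP : ContDiff ℝ ∞ P) (i : Fin 3) (j : Jet) :
    D i (P ∘ proj S) j = fderiv ℝ P (proj S j) (proj S (dir i j)) :=
  (hasLineDerivAt_proj hP j _).lineDeriv

theorem isDiffFun_proj_dir (S : Finset (ℕ × ℕ × ℕ)) (i : Fin 3) :
    IsDiffFun fun j => proj S (dir i j) := by
  classical
  refine isDiffFun_iff.2 ⟨S.image (· + e i), fun q => (ev i, fun K => q.2 ⟨K + e i,
    Finset.mem_image_of_mem _ K.2⟩), by fun_prop, rfl⟩

theorem isDiffFun_proj (S : Finset (ℕ × ℕ × ℕ)) : IsDiffFun (proj S) :=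
  isDiffFun_iff.2 ⟨S, id, contDiff_id, rfl⟩

/-- The derivative of `P` is evaluated at the coordinates in `S` and applied to the coordinates in
`S` shifted by `e i`: again finitely many coordinates, with smooth dependence. -/
theorem IsDiffFun.D {F : Jet → V} (hF : IsDiffFun F) (i : Fin 3) : IsDiffFun (D i F) := by
  obtain ⟨S, P, hP, rfl⟩ := isDiffFun_iff.1 hF
  rw [funext (D_proj hP i)]
  refine ((isDiffFun_proj S).prodMk (isDiffFun_proj_dir S i)).comp
    (Φ := fun q => fderiv ℝ P q.1 q.2) ?_
  exact ((hP.fderiv_right (by simp)).comp contDiff_fst).clm_apply contDiff_snd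

/-- The direction `dir k` itself varies along `dir i`. So the iterated derivative is a second
derivative of `P` plus a first-order term containing `u_{K + e i + e k}`, and both are symmetric in
`i` and `k`. -/
theorem D_comm {F : Jet → V} (hF : IsDiffFun F) (i k : Fin 3) : D i (D k F) = D k (D i F) := by
  obtain ⟨S, P, hP, rfl⟩ := isDiffFun_iff.1 hF
  have key : ∀ (i k : Fin 3) (j : Jet), D i (D k (P ∘ proj S)) j =
      fderiv ℝ (fderiv ℝ P) (proj S j) (proj S (dir i j)) (proj S (dir k j)) +
        fderiv ℝ P (proj S j) (0, fun K => j.2 (K + e i + e k)) := by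
    intro i k j
    rw [funext (D_proj hP k)]
    have h1 : HasLineDerivAt ℝ (fun j => fderiv ℝ P (proj S j))
        (fderiv ℝ (fderiv ℝ P) (proj S j) (proj S (dir i j))) j (dir i j) :=
      hasLineDerivAt_proj (hP.fderiv_right (m := ∞) (by simp)) j (dir i j)
    have h2 : HasLineDerivAt ℝ (fun j => proj S (dir k j))
        (0, fun K => j.2 (K + e i + e k)) j (dir i j) := by
      refine HasDerivAt.prodMk (hasDerivAt_const _ _) (hasDerivAt_pi.2 fun K => ?_)
      have : HasDerivAt (fun s : ℝ => j.2 (K + e k) + s * j.2 (K + e k + e i))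
          (1 * j.2 (K + e k + e i)) 0 := ((hasDerivAt_id 0).mul_const _).const_add _
      rw [one_mul] at this
      rw [add_right_comm]
      exact this
    have h3 := HasDerivAt.clm_apply h1 h2
    simp only [zero_smul, add_zero] at h3
    exact HasLineDerivAt.lineDeriv h3
  funext j
  rw [key, key]
  have hs := (hP.contDiffAt (x := proj S j)).isSymmSndFDerivAt
    (by rw [minSmoothness_of_isRCLikeNormedField]; exact WithTop.coe_le_coe.2 le_top)
  rw [hs.eq]
  simp only [add_right_comm]

theorem D_base (i : Fin 3) (φ : ℝ × ℝ × ℝ → V) : D i (fun j => φ j.1) = fun j => pd i φ j.1 := rfl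

theorem D_const (i : Fin 3) (c : V) : D i (fun _ => c) = fun _ => 0 := by
  funext j; simp [D, lineDeriv]

theorem D_coord (i : Fin 3) (K : ℕ × ℕ × ℕ) : D i (fun j => j.2 K) = fun j => j.2 (K + e i) := by
  funext j
  have : HasDerivAt (fun s : ℝ => j.2 K + s * j.2 (K + e i)) (1 * j.2 (K + e i)) 0 :=
    ((hasDerivAt_id 0).mul_const _).const_add _
  rw [one_mul] at this
  exact HasLineDerivAt.lineDeriv this

theorem D_add {F G : Jet → V} (hF : IsDiffFun F) (hG : IsDiffFun G) (i : Fin 3) :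
    D i (fun j => F j + G j) = fun j => D i F j + D i G j :=
  funext fun j => HasLineDerivAt.lineDeriv (HasDerivAt.add (hF.hasLineDerivAt j (dir i j))
    (hG.hasLineDerivAt j (dir i j)))

theorem D_neg (F : Jet → V) (i : Fin 3) : D i (fun j => -F j) = fun j => -D i F j := by
  funext j
  simp only [D, lineDeriv]
  exact deriv.fun_neg

theorem D_sub {F G : Jet → V} (hF : IsDiffFun F) (hG : IsDiffFun G) (i : Fin 3) :
    D i (fun j => F j - G j) = fun j => D i F j - D i G j :=
  funext fun j => HasLineDerivAt.lineDeriv (HasDerivAt.sub (hF.hasLineDerivAt j (dir i j))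
    (hG.hasLineDerivAt j (dir i j)))

theorem D_mul {A : Type*} [NormedCommRing A] [NormedAlgebra ℝ A] {F G : Jet → A}
    (hF : IsDiffFun F) (hG : IsDiffFun G) (i : Fin 3) :
    D i (fun j => F j * G j) = fun j => D i F j * G j + F j * D i G j := by
  funext j
  have h := HasDerivAt.mul (hF.hasLineDerivAt j (dir i j)) (hG.hasLineDerivAt j (dir i j))
  simp only [zero_smul, add_zero] at h
  exact HasLineDerivAt.lineDeriv h

theorem D_pow {A : Type*} [NormedCommRing A] [NormedAlgebra ℝ A] {F : Jet → A}
    (hF : IsDiffFun F) (n : ℕ) (i : Fin 3) :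
    D i (fun j => F j ^ n) = fun j => n * F j ^ (n - 1) * D i F j := by
  funext j
  have h := HasDerivAt.fun_pow (hF.hasLineDerivAt j (dir i j)) n
  simp only [zero_smul, add_zero] at h
  exact HasLineDerivAt.lineDeriv h

theorem D_div_const {𝕜 : Type*} [NormedField 𝕜] [NormedAlgebra ℝ 𝕜] {F : Jet → 𝕜}
    (hF : IsDiffFun F) (c : 𝕜) (i : Fin 3) : D i (fun j => F j / c) = fun j => D i F j / c := by
  simp only [div_eq_mul_inv]
  rw [D_mul hF (isDiffFun_const _), D_const]
  simp

theorem D_ofReal {F : Jet → ℝ} (hF : IsDiffFun F) (i : Fin 3) :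
    D i (fun j => (F j : ℂ)) = fun j => ((D i F j : ℝ) : ℂ) :=
  funext fun j => HasLineDerivAt.lineDeriv (HasDerivAt.ofReal_comp (hF.hasLineDerivAt j (dir i j)))

theorem D_fun_u {φ : ℝ → ℝ} (hφ : ContDiff ℝ ∞ φ) (i : Fin 3) :
    D i (fun j => φ (j.2 (0, 0, 0))) = fun j => deriv φ (j.2 (0, 0, 0)) * j.2 (e i) := by
  funext j
  have h1 : HasDerivAt φ (deriv φ (j.2 (0, 0, 0))) (j.2 (0, 0, 0) + 0 * j.2 (0 + e i)) := by
    rw [zero_mul, add_zero]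
    exact (hφ.differentiable (by simp) _).hasDerivAt
  have h2 : HasDerivAt (fun s : ℝ => j.2 0 + s * j.2 (0 + e i)) (1 * j.2 (0 + e i)) 0 :=
    ((hasDerivAt_id 0).mul_const _).const_add _
  have h := HasDerivAt.comp (0 : ℝ) h1 h2
  rw [one_mul] at h
  rw [← zero_add (e i)]
  exact HasLineDerivAt.lineDeriv (f := fun j : Jet => φ (j.2 (0, 0, 0))) (v := dir i j) h

end Calculus

end KS

namespace KS

/-! ### Partial derivatives and jets of functions -/

section Functions

variable {V : Type*} [NormedAddCommGroup V] [NormedSpace ℝ V] {Ω : Set (ℝ × ℝ × ℝ)}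

theorem pd_eqOn_fderiv (hΩ : IsOpen Ω) {F : ℝ × ℝ × ℝ → V} (hF : ContDiffOn ℝ ∞ F Ω) (i : Fin 3) :
    Set.EqOn (pd i F) (fun p => fderiv ℝ F p (ev i)) Ω := fun _ hp =>
  ((hF.contDiffAt (hΩ.mem_nhds hp)).differentiableAt (by simp)).lineDeriv_eq_fderiv

theorem pd_congr (hΩ : IsOpen Ω) {F G : ℝ × ℝ × ℝ → V} (h : Set.EqOn F G Ω) (i : Fin 3) :
    Set.EqOn (pd i F) (pd i G) Ω := fun _ hp =>
  (h.eventuallyEq_of_mem (hΩ.mem_nhds hp)).lineDeriv_eq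

theorem pd_contDiffOn (hΩ : IsOpen Ω) {F : ℝ × ℝ × ℝ → V} (hF : ContDiffOn ℝ ∞ F Ω) (i : Fin 3) :
    ContDiffOn ℝ ∞ (pd i F) Ω :=
  ((hF.fderiv_of_isOpen hΩ (by simp)).clm_apply contDiffOn_const).congr (pd_eqOn_fderiv hΩ hF i)

theorem pd_comm (hΩ : IsOpen Ω) {F : ℝ × ℝ × ℝ → V} (hF : ContDiffOn ℝ ∞ F Ω) (i k : Fin 3) :
    Set.EqOn (pd i (pd k F)) (pd k (pd i F)) Ω := by
  have key : ∀ i k : Fin 3, ∀ p ∈ Ω,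
      pd i (pd k F) p = fderiv ℝ (fderiv ℝ F) p (ev i) (ev k) := by
    intro i k p hp
    rw [pd_congr hΩ (pd_eqOn_fderiv hΩ hF k) i hp]
    have h1 : HasFDerivAt (fderiv ℝ F) (fderiv ℝ (fderiv ℝ F) p) p :=
      (((hF.fderiv_of_isOpen hΩ (m := ∞) (by simp)).contDiffAt (hΩ.mem_nhds hp)).differentiableAt
        (by simp)).hasFDerivAt
    simpa [pd] using (h1.clm_apply (hasFDerivAt_const (ev k) p)).hasLineDerivAt (ev i) |>.lineDeriv
  intro p hp
  rw [key i k p hp, key k i p hp]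
  exact ((hF.contDiffAt (hΩ.mem_nhds hp)).isSymmSndFDerivAt
    (by rw [minSmoothness_of_isRCLikeNormedField]; exact WithTop.coe_le_coe.2 le_top)).eq _ _

theorem iterate_pd_contDiffOn (hΩ : IsOpen Ω) {F : ℝ × ℝ × ℝ → V} (hF : ContDiffOn ℝ ∞ F Ω)
    (i : Fin 3) (n : ℕ) : ContDiffOn ℝ ∞ ((pd i)^[n] F) Ω := by
  induction n with
  | zero => exact hF
  | succ n ih => rw [Function.iterate_succ_apply']; exact pd_contDiffOn hΩ ih i

theorem iterate_pd_congr (hΩ : IsOpen Ω) {F G : ℝ × ℝ × ℝ → V} (h : Set.EqOn F G Ω)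
    (i : Fin 3) (n : ℕ) : Set.EqOn ((pd i)^[n] F) ((pd i)^[n] G) Ω := by
  induction n with
  | zero => exact h
  | succ n ih => simp only [Function.iterate_succ_apply']; exact pd_congr hΩ ih i

theorem pd_iterate_pd (hΩ : IsOpen Ω) {F : ℝ × ℝ × ℝ → V} (hF : ContDiffOn ℝ ∞ F Ω)
    (i k : Fin 3) (n : ℕ) : Set.EqOn (pd i ((pd k)^[n] F)) ((pd k)^[n] (pd i F)) Ω := by
  induction n with
  | zero => exact Set.eqOn_refl _ _
  | succ n ih =>
    simp only [Function.iterate_succ_apply']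
    exact (pd_comm hΩ (iterate_pd_contDiffOn hΩ hF k n) i k).trans (pd_congr hΩ ih k)

theorem d_contDiffOn (hΩ : IsOpen Ω) {F : ℝ × ℝ × ℝ → V} (hF : ContDiffOn ℝ ∞ F Ω) (a b c : ℕ) :
    ContDiffOn ℝ ∞ (d a b c F) Ω :=
  iterate_pd_contDiffOn hΩ (iterate_pd_contDiffOn hΩ (iterate_pd_contDiffOn hΩ hF _ _) _ _) _ _

theorem d_congr (hΩ : IsOpen Ω) {F G : ℝ × ℝ × ℝ → V} (h : Set.EqOn F G Ω) (a b c : ℕ) :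
    Set.EqOn (d a b c F) (d a b c G) Ω :=
  iterate_pd_congr hΩ (iterate_pd_congr hΩ (iterate_pd_congr hΩ h _ _) _ _) _ _

/-- In `d` the `x`-derivatives are outermost and the `t`-derivatives innermost. A further `∂_x` is
absorbed by definition, `∂_y` has to pass the `x`-derivatives, and `∂_t` has to pass both other
groups. -/
theorem pd_d (hΩ : IsOpen Ω) {F : ℝ × ℝ × ℝ → V} (hF : ContDiffOn ℝ ∞ F Ω) (i : Fin 3)
    (K : ℕ × ℕ × ℕ) : Set.EqOn (pd i (d K.1 K.2.1 K.2.2 F))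
      (d (K + e i).1 (K + e i).2.1 (K + e i).2.2 F) Ω := by
  obtain ⟨a, b, c⟩ := K
  have h2 := iterate_pd_contDiffOn hΩ hF 2 c
  have h1 := iterate_pd_contDiffOn hΩ h2 1 b
  fin_cases i
  · simp only [d, e, Prod.mk_add_mk, Fin.zero_eta, Matrix.cons_val_zero, add_zero,
      Function.iterate_succ_apply']
    exact Set.eqOn_refl _ _
  · simp only [d, e, Prod.mk_add_mk, Fin.mk_one, Matrix.cons_val_one, Matrix.cons_val_zero,
      add_zero, Function.iterate_succ_apply']
    exact pd_iterate_pd hΩ h1 1 0 a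
  · simp only [d, e, Prod.mk_add_mk, Fin.reduceFinMk, Matrix.cons_val, add_zero,
      Function.iterate_succ_apply']
    exact (pd_iterate_pd hΩ h1 2 0 a).trans (iterate_pd_congr hΩ (pd_iterate_pd hΩ h2 2 1 b) 0 a)

theorem contDiffOn_comp_jet (hΩ : IsOpen Ω) {u : ℝ × ℝ × ℝ → ℝ} (hu : ContDiffOn ℝ ∞ u Ω)
    {F : Jet → V} (hF : IsDiffFun F) : ContDiffOn ℝ ∞ (fun q => F (jet u q)) Ω := by
  obtain ⟨S, P, hP, rfl⟩ := isDiffFun_iff.1 hF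
  have h : ContDiffOn ℝ ∞ (fun q => proj S (jet u q)) Ω :=
    contDiffOn_id.prodMk (contDiffOn_pi.2 fun K => d_contDiffOn hΩ hu _ _ _)
  exact hP.comp_contDiffOn h

/-- Chain rule: when the base point moves with velocity `ev i`, the jet of `u` moves with velocity
`dir i`, which is the direction that defines `D i`. -/
theorem pd_comp_jet (hΩ : IsOpen Ω) {u : ℝ × ℝ × ℝ → ℝ} (hu : ContDiffOn ℝ ∞ u Ω)
    {F : Jet → V} (hF : IsDiffFun F) (i : Fin 3) :
    Set.EqOn (pd i fun q => F (jet u q)) (fun q => D i F (jet u q)) Ω := by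
  intro p hp
  obtain ⟨S, P, hP, rfl⟩ := isDiffFun_iff.1 hF
  beta_reduce
  rw [D_proj hP]
  have h1 : HasLineDerivAt ℝ (fun q => proj S (jet u q)) (proj S (dir i (jet u p))) p (ev i) := by
    refine HasDerivAt.prodMk ?_ (hasDerivAt_pi.2 fun K => ?_)
    · have h := ((hasDerivAt_id (0 : ℝ)).smul_const (ev i)).const_add p
      rw [one_smul] at h
      exact h
    · have h := (((d_contDiffOn hΩ hu (K : ℕ × ℕ × ℕ).1 (K : ℕ × ℕ × ℕ).2.1
        (K : ℕ × ℕ × ℕ).2.2).contDiffAt (hΩ.mem_nhds hp)).differentiableAt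
        (by simp)).lineDifferentiableAt (v := ev i) |>.hasLineDerivAt
      have h' := pd_d hΩ hu i (K : ℕ × ℕ × ℕ) hp
      simp only [pd] at h'
      rw [h'] at h
      exact h
  have h2 : HasFDerivAt P (fderiv ℝ P (proj S (jet u p))) (proj S (jet u (p + (0 : ℝ) • ev i))) := by
    rw [zero_smul, add_zero]
    exact ((hP.differentiable (by simp)) _).hasFDerivAt
  exact HasLineDerivAt.lineDeriv (HasFDerivAt.comp_hasDerivAt (0 : ℝ) h2 h1)

theorem iterate_pd_comp_jet (hΩ : IsOpen Ω) {u : ℝ × ℝ × ℝ → ℝ} (hu : ContDiffOn ℝ ∞ u Ω)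
    {F : Jet → V} (hF : IsDiffFun F) (i : Fin 3) (n : ℕ) :
    IsDiffFun ((D i)^[n] F) ∧
    Set.EqOn ((pd i)^[n] fun q => F (jet u q)) (fun q => (D i)^[n] F (jet u q)) Ω := by
  induction n with
  | zero => exact ⟨hF, Set.eqOn_refl _ _⟩
  | succ n ih =>
    simp only [Function.iterate_succ_apply']
    exact ⟨ih.1.D i, (pd_congr hΩ ih.2 i).trans (pd_comp_jet hΩ hu ih.1 i)⟩

theorem d_comp_jet (hΩ : IsOpen Ω) {u : ℝ × ℝ × ℝ → ℝ} (hu : ContDiffOn ℝ ∞ u Ω)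
    {F : Jet → V} (hF : IsDiffFun F) (K : ℕ × ℕ × ℕ) :
    Set.EqOn (d K.1 K.2.1 K.2.2 fun q => F (jet u q)) (fun q => DD K F (jet u q)) Ω := by
  have h2 := iterate_pd_comp_jet hΩ hu hF 2 K.2.2
  have h1 := iterate_pd_comp_jet hΩ hu h2.1 1 K.2.1
  have h0 := iterate_pd_comp_jet hΩ hu h1.1 0 K.1
  exact (iterate_pd_congr hΩ ((iterate_pd_congr hΩ h2.2 _ _).trans h1.2) _ _).trans h0.2

theorem pd_const (i : Fin 3) (c : V) : pd i (fun _ => c) = fun _ => 0 := by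
  funext p; simp [pd, lineDeriv]

theorem d_zero (a b c : ℕ) : d a b c (fun _ => (0 : V)) = fun _ => 0 := by
  have h : ∀ (i : Fin 3) (n : ℕ), (pd i)^[n] (fun _ => (0 : V)) = fun _ => 0 := fun i n =>
    Function.iterate_fixed (pd_const i 0) n
  simp only [d, h]

/-- `Δ` vanishes along `u` on an open set, so all its partial derivatives do, and these are the
total derivatives of `Δ` evaluated on the jet. -/
theorem onShell_jet {Δ : Jet → ℝ} (hΔ : IsDiffFun Δ) (hΩ : IsOpen Ω) {u : ℝ × ℝ × ℝ → ℝ}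
    (hu : ContDiffOn ℝ ∞ u Ω) (h : ∀ p ∈ Ω, Δ (jet u p) = 0) {p : ℝ × ℝ × ℝ} (hp : p ∈ Ω) :
    OnShell Δ (jet u p) := by
  intro K
  have h1 : Set.EqOn (fun q => Δ (jet u q)) (fun _ => 0) Ω := h
  have h2 := d_comp_jet hΩ hu hΔ K hp
  rw [d_congr hΩ h1 _ _ _ hp, d_zero] at h2
  exact h2.symm

/-- A single off-shell identity provides both forms of conservation, on formal solutions and on
smooth ones. -/
theorem isConserved_of_div {Δ : Jet → ℝ} (hΔ : IsDiffFun Δ) {C : Fin 3 → Jet → ℂ}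
    (hC : ∀ i, IsDiffFun (C i)) {Q : ℝ × ℝ × ℝ → ℂ} (h : ∀ j, div C j = -(Q j.1 * Δ j)) :
    IsConserved Δ C := by
  have h0 : ∀ j, OnShell Δ j → div C j = 0 := by
    intro j hj
    have : Δ j = 0 := hj (0, 0, 0)
    simp [h, this]
  refine ⟨hC, h0, fun Ω u hΩ hu hs p hp => ?_⟩
  rw [← h0 _ (onShell_jet hΔ hΩ hu hs hp)]
  exact Finset.sum_congr rfl fun i _ => pd_comp_jet hΩ hu (hC i) i hp

end Functions

end KS

namespace KS

/-! ### Formal solutions of the initial value problem -/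

section TimeOrder

variable {V : Type*} [NormedAddCommGroup V] [NormedSpace ℝ V]

/-- `F` depends only on the base point and the derivatives with at most `m` differentiations in
`t`. -/
def TimeOrderLE (m : ℕ) (F : Jet → V) : Prop :=
  ∀ j j' : Jet, j.1 = j'.1 → (∀ K : ℕ × ℕ × ℕ, K.2.2 ≤ m → j.2 K = j'.2 K) → F j = F j'

/-- Along the line `j + s • v` only the components of `j` and `v` of low order in `t` are seen.
Hence `D_x` and `D_y` preserve the order in `t`, and `D_t` raises it by one. -/
theorem TimeOrderLE.lineDeriv_congr {m : ℕ} {F : Jet → V} (hF : TimeOrderLE m F) {j j' v v' : Jet}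
    (h1 : j.1 = j'.1) (h2 : ∀ K : ℕ × ℕ × ℕ, K.2.2 ≤ m → j.2 K = j'.2 K)
    (h3 : v.1 = v'.1) (h4 : ∀ K : ℕ × ℕ × ℕ, K.2.2 ≤ m → v.2 K = v'.2 K) :
    lineDeriv ℝ F j v = lineDeriv ℝ F j' v' := by
  have : (fun s : ℝ => F (j + s • v)) = fun s : ℝ => F (j' + s • v') := by
    funext s
    refine hF _ _ ?_ fun K hK => ?_
    · simp [h1, h3]
    · simp [h2 K hK, h4 K hK]
  simp only [lineDeriv, this]

theorem TimeOrderLE.D_of_ne {m : ℕ} {F : Jet → V} (hF : TimeOrderLE m F) {i : Fin 3} (hi : i ≠ 2) :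
    TimeOrderLE m (D i F) := by
  intro j j' h1 h2
  refine hF.lineDeriv_congr h1 h2 rfl fun K hK => h2 _ ?_
  fin_cases i <;> simp_all [e]

theorem TimeOrderLE.D_time {m : ℕ} {F : Jet → V} (hF : TimeOrderLE m F) :
    TimeOrderLE (m + 1) (D 2 F) := by
  intro j j' h1 h2
  refine hF.lineDeriv_congr h1 (fun K hK => h2 _ (by omega)) rfl fun K hK => h2 _ ?_
  simpa [e] using hK

theorem TimeOrderLE.iterate_D_of_ne {m : ℕ} {F : Jet → V} (hF : TimeOrderLE m F) {i : Fin 3}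
    (hi : i ≠ 2) (n : ℕ) : TimeOrderLE m ((D i)^[n] F) := by
  induction n with
  | zero => exact hF
  | succ n ih => rw [Function.iterate_succ_apply']; exact ih.D_of_ne hi

theorem TimeOrderLE.iterate_D_time {m : ℕ} {F : Jet → V} (hF : TimeOrderLE m F) (n : ℕ) :
    TimeOrderLE (m + n) ((D 2)^[n] F) := by
  induction n with
  | zero => exact hF
  | succ n ih => rw [Function.iterate_succ_apply']; exact ih.D_time

theorem TimeOrderLE.DD {m : ℕ} {F : Jet → V} (hF : TimeOrderLE m F) (K : ℕ × ℕ × ℕ) :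
    TimeOrderLE (m + K.2.2) (DD K F) :=
  ((hF.iterate_D_time _).iterate_D_of_ne (by decide) _).iterate_D_of_ne (by decide) _

theorem IsDiffFun.exists_timeOrderLE {F : Jet → V} (hF : IsDiffFun F) : ∃ m, TimeOrderLE m F := by
  obtain ⟨S, P, -, rfl⟩ := isDiffFun_iff.1 hF
  refine ⟨S.sup fun K => K.2.2, fun j j' h1 h2 => ?_⟩
  have : proj S j = proj S j' := Prod.ext h1 (funext fun K =>
    h2 K (Finset.le_sup (f := fun K : ℕ × ℕ × ℕ => K.2.2) K.2))
  simp only [Function.comp_apply, this]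

end TimeOrder

section Slices

variable {V : Type*} [NormedAddCommGroup V] [NormedSpace ℝ V]

/-- The slice `t = t₀`. -/
def slice (t₀ : ℝ) : Set (ℝ × ℝ × ℝ) := {p | p.2.2 = t₀}

/-- The `x`- and `y`-directions are tangent to the slice, so agreement on the slice alone suffices
and no smoothness is required. -/
theorem pd_eqOn_slice {t₀ : ℝ} {F G : ℝ × ℝ × ℝ → V} (h : Set.EqOn F G (slice t₀)) {i : Fin 3}
    (hi : i ≠ 2) : Set.EqOn (pd i F) (pd i G) (slice t₀) := by
  intro p hp
  have : (fun s : ℝ => F (p + s • ev i)) = fun s : ℝ => G (p + s • ev i) := by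
    funext s
    apply h
    fin_cases i <;> simp_all [ev, slice]
  simp only [pd, lineDeriv, this]

theorem iterate_pd_eqOn_slice {t₀ : ℝ} {F G : ℝ × ℝ × ℝ → V} (h : Set.EqOn F G (slice t₀))
    {i : Fin 3} (hi : i ≠ 2) (n : ℕ) : Set.EqOn ((pd i)^[n] F) ((pd i)^[n] G) (slice t₀) := by
  induction n with
  | zero => exact h
  | succ n ih => simp only [Function.iterate_succ_apply']; exact pd_eqOn_slice ih hi

/-- `(t - t₀)^m / m!` times the restriction of `H` to the slice `t = t₀`. -/
noncomputable def timeMonomial (t₀ : ℝ) (H : ℝ × ℝ × ℝ → ℝ) (m : ℕ) : ℝ × ℝ × ℝ → ℝ :=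
  fun p => (p.2.2 - t₀) ^ m / m.factorial * H (p.1, p.2.1, t₀)

theorem timeMonomial_contDiff (t₀ : ℝ) {H : ℝ × ℝ × ℝ → ℝ} (hH : ContDiff ℝ ∞ H) (m : ℕ) :
    ContDiff ℝ ∞ (timeMonomial t₀ H m) := by
  unfold timeMonomial; fun_prop

theorem pd_timeMonomial (t₀ : ℝ) (H : ℝ × ℝ × ℝ → ℝ) (m : ℕ) :
    pd 2 (timeMonomial t₀ H (m + 1)) = timeMonomial t₀ H m := by
  funext p
  refine HasLineDerivAt.lineDeriv ?_
  have h1 : HasDerivAt (fun s : ℝ => p.2.2 + s * 1 - t₀) 1 0 := by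
    simpa using ((hasDerivAt_id (0 : ℝ)).mul_const (1 : ℝ)).const_add p.2.2 |>.sub_const t₀
  have h2 := ((h1.fun_pow (m + 1)).div_const ((m + 1).factorial : ℝ)).mul_const
    (H (p.1, p.2.1, t₀))
  have h3 : (↑(m + 1) * (p.2.2 + 0 * 1 - t₀) ^ (m + 1 - 1) * 1 / ((m + 1).factorial : ℝ)) *
      H (p.1, p.2.1, t₀) = timeMonomial t₀ H m p := by
    have : (m.factorial : ℝ) ≠ 0 := by exact_mod_cast m.factorial_ne_zero
    simp only [timeMonomial, Nat.factorial_succ, add_zero, Nat.add_sub_cancel, mul_one]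
    push_cast
    field_simp
  rw [h3] at h2
  refine HasDerivAt.congr_of_eventuallyEq h2 (Filter.Eventually.of_forall fun s => ?_)
  simp [timeMonomial, ev]

theorem iterate_pd_timeMonomial (t₀ : ℝ) (H : ℝ × ℝ × ℝ → ℝ) (m c : ℕ) :
    (pd 2)^[c] (timeMonomial t₀ H (m + c)) = timeMonomial t₀ H m := by
  induction c with
  | zero => rfl
  | succ c ih => rw [Function.iterate_succ_apply, ← add_assoc, pd_timeMonomial, ih]

/-- Fewer than `m` differentiations in `t` leave a factor `t - t₀`, and tangential derivatives of a
function that vanishes on the slice vanish there. -/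
theorem d_timeMonomial_of_lt (t₀ : ℝ) (H : ℝ × ℝ × ℝ → ℝ) {m c : ℕ} (h : c < m) (a b : ℕ)
    {p : ℝ × ℝ × ℝ} (hp : p ∈ slice t₀) : d a b c (timeMonomial t₀ H m) p = 0 := by
  obtain ⟨k, rfl⟩ := Nat.exists_eq_add_of_lt h
  have h1 : Set.EqOn ((pd 2)^[c] (timeMonomial t₀ H (c + k + 1))) (fun _ => 0) (slice t₀) := by
    intro q hq
    have hq : q.2.2 = t₀ := hq
    rw [show c + k + 1 = (k + 1) + c by omega, iterate_pd_timeMonomial]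
    simp [timeMonomial, hq]
  have h2 := iterate_pd_eqOn_slice (iterate_pd_eqOn_slice h1 (i := 1) (by decide) b)
    (i := 0) (by decide) a
  exact (h2 hp).trans (congrFun (d_zero a b 0) p)

theorem d_timeMonomial_self (t₀ : ℝ) (H : ℝ × ℝ × ℝ → ℝ) (m : ℕ) {p : ℝ × ℝ × ℝ}
    (hp : p ∈ slice t₀) : d 0 0 m (timeMonomial t₀ H m) p = H p := by
  have hp' : p.2.2 = t₀ := hp
  have h := congrFun (iterate_pd_timeMonomial t₀ H 0 m) p
  rw [zero_add] at h
  refine h.trans ?_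
  simp [timeMonomial, ← hp']

theorem pd_add {F G : ℝ × ℝ × ℝ → V} (hF : ContDiff ℝ ∞ F) (hG : ContDiff ℝ ∞ G) (i : Fin 3) :
    pd i (fun p => F p + G p) = fun p => pd i F p + pd i G p := by
  funext p
  exact HasLineDerivAt.lineDeriv (HasDerivAt.add
    ((hF.differentiable (by simp) p).lineDifferentiableAt (v := ev i)).hasLineDerivAt
    ((hG.differentiable (by simp) p).lineDifferentiableAt (v := ev i)).hasLineDerivAt)

theorem iterate_pd_contDiff {F : ℝ × ℝ × ℝ → V} (hF : ContDiff ℝ ∞ F) (i : Fin 3) (n : ℕ) :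
    ContDiff ℝ ∞ ((pd i)^[n] F) :=
  contDiffOn_univ.1 (iterate_pd_contDiffOn isOpen_univ hF.contDiffOn i n)

theorem iterate_pd_add {F G : ℝ × ℝ × ℝ → V} (hF : ContDiff ℝ ∞ F) (hG : ContDiff ℝ ∞ G)
    (i : Fin 3) (n : ℕ) :
    (pd i)^[n] (fun p => F p + G p) = fun p => (pd i)^[n] F p + (pd i)^[n] G p := by
  induction n with
  | zero => rfl
  | succ n ih =>
    rw [Function.iterate_succ_apply', ih,
      pd_add (iterate_pd_contDiff hF i n) (iterate_pd_contDiff hG i n)]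
    simp only [Function.iterate_succ_apply']

theorem d_add {F G : ℝ × ℝ × ℝ → V} (hF : ContDiff ℝ ∞ F) (hG : ContDiff ℝ ∞ G) (a b c : ℕ) :
    d a b c (fun p => F p + G p) = fun p => d a b c F p + d a b c G p := by
  have hF2 := iterate_pd_contDiff hF 2 c
  have hG2 := iterate_pd_contDiff hG 2 c
  simp only [d]
  rw [iterate_pd_add hF hG, iterate_pd_add hF2 hG2,
    iterate_pd_add (iterate_pd_contDiff hF2 1 b) (iterate_pd_contDiff hG2 1 b)]

end Slices

section FormalSolutions

/-- The Taylor polynomial in `t - t₀` of degree `n` of the formal solution of `Δ = 0` with initial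
value `φ` at `t = t₀`. -/
noncomputable def taylorSol (Δ : Jet → ℝ) (t₀ : ℝ) (φ : ℝ × ℝ × ℝ → ℝ) : ℕ → ℝ × ℝ × ℝ → ℝ
  | 0 => φ
  | n + 1 => fun p => taylorSol Δ t₀ φ n p +
      timeMonomial t₀ (fun q => DD (0, 0, n) Δ (jet (taylorSol Δ t₀ φ n) q)) (n + 1) p

variable {Δ : Jet → ℝ} {t₀ : ℝ} {φ ψ : ℝ × ℝ × ℝ → ℝ}

theorem IsDiffFun.iterate_D {V : Type*} [NormedAddCommGroup V] [NormedSpace ℝ V] {F : Jet → V}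
    (hF : IsDiffFun F) (i : Fin 3) (n : ℕ) : IsDiffFun ((KS.D i)^[n] F) := by
  induction n with
  | zero => exact hF
  | succ n ih => rw [Function.iterate_succ_apply']; exact ih.D i

theorem IsDiffFun.DD {V : Type*} [NormedAddCommGroup V] [NormedSpace ℝ V] {F : Jet → V}
    (hF : IsDiffFun F) (K : ℕ × ℕ × ℕ) : IsDiffFun (KS.DD K F) :=
  ((hF.iterate_D 2 _).iterate_D 1 _).iterate_D 0 _

theorem contDiff_comp_jet {V : Type*} [NormedAddCommGroup V] [NormedSpace ℝ V]
    {u : ℝ × ℝ × ℝ → ℝ} (hu : ContDiff ℝ ∞ u) {F : Jet → V} (hF : IsDiffFun F) :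
    ContDiff ℝ ∞ fun q => F (jet u q) :=
  contDiffOn_univ.1 (contDiffOn_comp_jet isOpen_univ hu.contDiffOn hF)

theorem taylorSol_contDiff (hΔ : IsDiffFun Δ) (hφ : ContDiff ℝ ∞ φ) (n : ℕ) :
    ContDiff ℝ ∞ (taylorSol Δ t₀ φ n) := by
  induction n with
  | zero => exact hφ
  | succ n ih => exact ih.add (timeMonomial_contDiff _ (contDiff_comp_jet ih (hΔ.DD _)) _)

theorem jet_congr {Ω : Set (ℝ × ℝ × ℝ)} (hΩ : IsOpen Ω) {u v : ℝ × ℝ × ℝ → ℝ}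
    (h : Set.EqOn u v Ω) {p : ℝ × ℝ × ℝ} (hp : p ∈ Ω) : jet u p = jet v p :=
  Prod.ext rfl (funext fun _ => d_congr hΩ h _ _ _ hp)

/-- Locality in `(x, y)`: the correction at `p` only uses a jet at the point of the slice with the
same `(x, y)`, so agreement over `U` is inherited at each degree. -/
theorem taylorSol_congr {U : Set (ℝ × ℝ)} (hU : IsOpen U)
    (h : Set.EqOn φ ψ {p | (p.1, p.2.1) ∈ U}) (n : ℕ) :
    Set.EqOn (taylorSol Δ t₀ φ n) (taylorSol Δ t₀ ψ n) {p | (p.1, p.2.1) ∈ U} := by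
  induction n with
  | zero => exact h
  | succ n ih =>
    intro p hp
    have hΩ : IsOpen {p : ℝ × ℝ × ℝ | (p.1, p.2.1) ∈ U} := hU.preimage (by fun_prop)
    simp only [taylorSol, timeMonomial]
    rw [ih hp, jet_congr hΩ ih (p := (p.1, p.2.1, t₀)) hp]

theorem jet_taylorSol_succ (hΔ : IsDiffFun Δ) (hφ : ContDiff ℝ ∞ φ) (n : ℕ) (K : ℕ × ℕ × ℕ)
    {p : ℝ × ℝ × ℝ} (hp : p ∈ slice t₀) (hK : K.2.2 ≤ n) :
    (jet (taylorSol Δ t₀ φ (n + 1)) p).2 K = (jet (taylorSol Δ t₀ φ n) p).2 K := by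
  have ih := taylorSol_contDiff (t₀ := t₀) hΔ hφ n
  change d K.1 K.2.1 K.2.2 (taylorSol Δ t₀ φ (n + 1)) p = d K.1 K.2.1 K.2.2 (taylorSol Δ t₀ φ n) p
  rw [taylorSol, d_add ih (timeMonomial_contDiff _ (contDiff_comp_jet ih (hΔ.DD _)) _)]
  simp only [d_timeMonomial_of_lt t₀ _ (Nat.lt_succ_of_le hK) _ _ hp, add_zero]

theorem jet_taylorSol_of_le (hΔ : IsDiffFun Δ) (hφ : ContDiff ℝ ∞ φ) {n m : ℕ} (hnm : n ≤ m)
    (K : ℕ × ℕ × ℕ) {p : ℝ × ℝ × ℝ} (hp : p ∈ slice t₀) (hK : K.2.2 ≤ n) :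
    (jet (taylorSol Δ t₀ φ m) p).2 K = (jet (taylorSol Δ t₀ φ n) p).2 K := by
  induction m, hnm using Nat.le_induction with
  | base => rfl
  | succ m hm ih => rw [jet_taylorSol_succ hΔ hφ m K hp (hK.trans hm), ih]

/-- `Δ = Φ - u_t`, where `Φ` is free of derivatives with respect to `t`. -/
def IsEvolution (Δ : Jet → ℝ) : Prop :=
  ∃ Φ : Jet → ℝ, IsDiffFun Φ ∧ TimeOrderLE 0 Φ ∧ Δ = fun j => Φ j - j.2 (0, 0, 1)

theorem IsEvolution.isDiffFun (hΔ : IsEvolution Δ) : IsDiffFun Δ := by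
  obtain ⟨Φ, hΦ, -, rfl⟩ := hΔ
  exact hΦ.sub (isDiffFun_coord _)

theorem IsEvolution.timeOrderLE (hΔ : IsEvolution Δ) : TimeOrderLE 1 Δ := by
  obtain ⟨Φ, -, hΦ, rfl⟩ := hΔ
  intro j j' h1 h2
  simp only [hΦ j j' h1 fun K hK => h2 K (by omega), h2 (0, 0, 1) le_rfl]

theorem iterate_D_sub_coord {Φ : Jet → ℝ} (hΦ : IsDiffFun Φ) (n : ℕ) :
    (D 2)^[n] (fun j => Φ j - j.2 (0, 0, 1)) = fun j => (D 2)^[n] Φ j - j.2 (0, 0, n + 1) := by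
  induction n with
  | zero => rfl
  | succ n ih =>
    rw [Function.iterate_succ_apply', ih, D_sub (hΦ.iterate_D 2 n) (isDiffFun_coord _), D_coord]
    simp only [Function.iterate_succ_apply']
    rfl

/-- Since `D_t^k Δ = D_t^k Φ - u_{t^{k+1}}`, the defect at degree `k` is removed by adding it to
`u_{t^{k+1}}`, which is what the new monomial does on the slice. The monomial affects neither `D_t^k
Φ`, of order at most `k` in `t`, nor the lower conditions already achieved. -/
theorem DD_time_taylorSol (hΔ : IsEvolution Δ) (hφ : ContDiff ℝ ∞ φ) {n k : ℕ} (hk : k < n)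
    {p : ℝ × ℝ × ℝ} (hp : p ∈ slice t₀) :
    DD (0, 0, k) Δ (jet (taylorSol Δ t₀ φ n) p) = 0 := by
  induction n with
  | zero => omega
  | succ n ih =>
    rcases Nat.lt_succ_iff_lt_or_eq.1 hk with hk | rfl
    · rw [← ih hk]
      refine (hΔ.timeOrderLE.DD _) _ _ rfl fun K hK =>
        jet_taylorSol_succ hΔ.isDiffFun hφ n K hp ?_
      simp only at hK
      omega
    · have hu := taylorSol_contDiff (t₀ := t₀) hΔ.isDiffFun hφ k
      have hm := timeMonomial_contDiff t₀ (contDiff_comp_jet hu (hΔ.isDiffFun.DD (0, 0, k))) (k + 1)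
      obtain ⟨Φ, hΦ, hΦ0, hΔ'⟩ := id hΔ
      have key : ∀ j, DD (0, 0, k) Δ j = DD (0, 0, k) Φ j - j.2 (0, 0, k + 1) := by
        intro j
        rw [hΔ']
        exact congrFun (iterate_D_sub_coord hΦ k) j
      rw [key]
      have h1 : DD (0, 0, k) Φ (jet (taylorSol Δ t₀ φ (k + 1)) p) =
          DD (0, 0, k) Φ (jet (taylorSol Δ t₀ φ k) p) := by
        refine (hΦ0.DD _) _ _ rfl fun K hK => jet_taylorSol_succ hΔ.isDiffFun hφ k K hp ?_
        simpa using hK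
      have h2 : (jet (taylorSol Δ t₀ φ (k + 1)) p).2 (0, 0, k + 1) =
          (jet (taylorSol Δ t₀ φ k) p).2 (0, 0, k + 1) +
            DD (0, 0, k) Δ (jet (taylorSol Δ t₀ φ k) p) := by
        change d 0 0 (k + 1) (taylorSol Δ t₀ φ (k + 1)) p = d 0 0 (k + 1) (taylorSol Δ t₀ φ k) p + _
        rw [taylorSol, d_add hu hm]
        simp only [d_timeMonomial_self t₀ _ _ hp]
      rw [h1, h2, key]
      ring

/-- `D_t^k Δ` vanishes on the slice, and by the chain rule `D_x` and `D_y` act there as tangential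
derivatives of this zero function. -/
theorem DD_taylorSol (hΔ : IsEvolution Δ) (hφ : ContDiff ℝ ∞ φ) {n : ℕ} {K : ℕ × ℕ × ℕ}
    (hK : K.2.2 < n) {p : ℝ × ℝ × ℝ} (hp : p ∈ slice t₀) :
    DD K Δ (jet (taylorSol Δ t₀ φ n) p) = 0 := by
  have hu := (taylorSol_contDiff (t₀ := t₀) hΔ.isDiffFun hφ n).contDiffOn (s := Set.univ)
  have h2 : Set.EqOn (fun q => (D 2)^[K.2.2] Δ (jet (taylorSol Δ t₀ φ n) q)) (fun _ => 0)
      (slice t₀) := fun q hq => DD_time_taylorSol hΔ hφ hK hq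
  have hd := hΔ.isDiffFun.iterate_D 2 K.2.2
  have h3 := iterate_pd_comp_jet isOpen_univ hu hd 1 K.2.1
  have h4 := iterate_pd_comp_jet isOpen_univ hu h3.1 0 K.1
  have h5 := iterate_pd_eqOn_slice h2 (i := 1) (by decide) K.2.1
  rw [Set.eqOn_univ] at h3 h4
  rw [h3.2] at h5
  have h6 := iterate_pd_eqOn_slice h5 (i := 0) (by decide) K.1
  rw [h4.2] at h6
  exact (h6 hp).trans (congrFun (d_zero K.1 K.2.1 0) p)

/-- The jet at `p` of the formal solution with initial value `φ`. -/
noncomputable def formalJet (Δ : Jet → ℝ) (t₀ : ℝ) (φ : ℝ × ℝ × ℝ → ℝ) (p : ℝ × ℝ × ℝ) : Jet :=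
  (p, fun K => (jet (taylorSol Δ t₀ φ K.2.2) p).2 K)

theorem formalJet_eq (hΔ : IsDiffFun Δ) (hφ : ContDiff ℝ ∞ φ) {n : ℕ} {K : ℕ × ℕ × ℕ}
    (hK : K.2.2 ≤ n) {p : ℝ × ℝ × ℝ} (hp : p ∈ slice t₀) :
    (formalJet Δ t₀ φ p).2 K = (jet (taylorSol Δ t₀ φ n) p).2 K :=
  (jet_taylorSol_of_le hΔ hφ hK K hp le_rfl).symm

/-- Each condition `DD K Δ = 0` involves finitely many `t`-derivatives, so the formal jet may be
replaced by the jet of a truncation of sufficient degree. -/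
theorem onShell_formalJet (hΔ : IsEvolution Δ) (hφ : ContDiff ℝ ∞ φ) {p : ℝ × ℝ × ℝ}
    (hp : p ∈ slice t₀) : OnShell Δ (formalJet Δ t₀ φ p) := by
  intro K
  -- `Δ` has order one in `t` because of `u_t`, so `DD K Δ` has order `1 + K.2.2`; this is the
  -- degree at which the formal solution is truncated.
  rw [← DD_taylorSol hΔ hφ (n := 1 + K.2.2) (K := K) (by omega) hp]
  exact (hΔ.timeOrderLE.DD K) _ _ rfl fun J hJ => formalJet_eq hΔ.isDiffFun hφ hJ hp

/-- A function of order at most `n` in `t` cannot distinguish the jet of the degree `n` truncation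
from the on-shell formal jet. -/
theorem comp_taylorSol_eq_zero {V : Type*} [NormedAddCommGroup V] [NormedSpace ℝ V]
    (hΔ : IsEvolution Δ) {A : Jet → V} {n : ℕ} (hA : TimeOrderLE n A)
    (hA0 : ∀ j, OnShell Δ j → A j = 0) (hφ : ContDiff ℝ ∞ φ) {p : ℝ × ℝ × ℝ}
    (hp : p ∈ slice t₀) : A (jet (taylorSol Δ t₀ φ n) p) = 0 := by
  rw [← hA0 _ (onShell_formalJet hΔ hφ hp)]
  exact hA _ _ rfl fun J hJ => (formalJet_eq hΔ.isDiffFun hφ hJ hp).symm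

theorem taylorSol_slice {n : ℕ} {p : ℝ × ℝ × ℝ} (hp : p ∈ slice t₀) :
    taylorSol Δ t₀ φ n p = φ p := by
  induction n with
  | zero => rfl
  | succ n ih =>
    have hp : p.2.2 = t₀ := hp
    simp [taylorSol, ih, timeMonomial, hp]

end FormalSolutions

end KS

namespace KS

/-! ### Nontriviality -/

section Integral

open MeasureTheory

/-- The divergence theorem on a box for a field which vanishes on all faces but the bottom. -/
theorem integral_bottom_eq_zero {B : Fin 3 → ℝ × ℝ × ℝ → ℂ} (hB : ∀ i, ContDiff ℝ ∞ (B i))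
    (hdiv : ∀ p, ∑ i, pd i (B i) p = 0) {R t₀ t₁ : ℝ} (hR : 0 ≤ R) (ht : t₀ ≤ t₁)
    (hx : ∀ p : ℝ × ℝ × ℝ, |p.1| = R → B 0 p = 0) (hy : ∀ p : ℝ × ℝ × ℝ, |p.2.1| = R → B 1 p = 0)
    (htop : ∀ p : ℝ × ℝ × ℝ, p.2.2 = t₁ → B 2 p = 0) :
    ∫ z in Set.Icc (fun _ : Fin 2 => -R) (fun _ => R), B 2 (z 0, z 1, t₀) = 0 := by
  -- The divergence theorem lives on `Fin 3 → ℝ`; `σ` transports the fields there from the nested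
  -- product.
  let σ : (Fin 3 → ℝ) →L[ℝ] ℝ × ℝ × ℝ :=
    (ContinuousLinearMap.proj 0).prod ((ContinuousLinearMap.proj 1).prod (ContinuousLinearMap.proj 2))
  have hσ : ∀ x, σ x = (x 0, x 1, x 2) := fun x => rfl
  have hder : ∀ i x, HasFDerivAt (fun x => B i (σ x)) ((fderiv ℝ (B i) (σ x)).comp σ) x :=
    fun i x => ((hB i).differentiable (by simp) (σ x)).hasFDerivAt.comp x σ.hasFDerivAt
  have hpd : ∀ i x, ((fderiv ℝ (B i) (σ x)).comp σ) (Pi.single i 1) = pd i (B i) (σ x) := by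
    intro i x
    rw [pd_eqOn_fderiv isOpen_univ (hB i).contDiffOn i (Set.mem_univ _)]
    simp only [ContinuousLinearMap.comp_apply]
    congr 1
    fin_cases i <;> simp [hσ, ev]
  have hle : (![-R, -R, t₀] : Fin 3 → ℝ) ≤ ![R, R, t₁] := by
    intro i
    fin_cases i <;> simp <;> linarith
  have h := (integral_divergence_of_hasFDerivAt_off_countable' ![-R, -R, t₀] ![R, R, t₁] hle
    (fun i x => B i (σ x)) (fun i x => (fderiv ℝ (B i) (σ x)).comp σ) ∅ Set.countable_empty
    (fun i => ((hB i).continuous.comp σ.continuous).continuousOn) (fun x _ i => hder i x)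
    (by simp only [hpd, hdiv]; exact integrableOn_zero)).trans (Fin.sum_univ_three _)
  simp only [hpd, hdiv, integral_zero] at h
  have e0 : ∀ c : ℝ, |c| = R → ∀ z : Fin 2 → ℝ, B 0 (σ (Fin.insertNth 0 c z)) = 0 :=
    fun c hc z => hx _ (by simpa [hσ] using hc)
  have e1 : ∀ c : ℝ, |c| = R → ∀ z : Fin 2 → ℝ, B 1 (σ (Fin.insertNth 1 c z)) = 0 :=
    fun c hc z => hy _ (by simpa [hσ] using hc)
  have e2 : ∀ z : Fin 2 → ℝ, B 2 (σ (Fin.insertNth 2 t₁ z)) = 0 :=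
    fun z => htop _ (by simp [hσ])
  have e3 : ∀ z : Fin 2 → ℝ, B 2 (σ (Fin.insertNth 2 t₀ z)) = B 2 (z 0, z 1, t₀) := by
    intro z
    rw [hσ]
    congr 1
  have a2 : (![-R, -R, t₀] : Fin 3 → ℝ) ∘ Fin.succAbove 2 = fun _ => -R := by
    funext i; fin_cases i <;> rfl
  have b2 : (![R, R, t₁] : Fin 3 → ℝ) ∘ Fin.succAbove 2 = fun _ => R := by
    funext i; fin_cases i <;> rfl
  simp only [Matrix.cons_val_zero, Matrix.cons_val_one, Matrix.cons_val] at h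
  simpa only [e0 R (abs_of_nonneg hR), e0 (-R) (by rw [abs_neg, abs_of_nonneg hR]),
    e1 R (abs_of_nonneg hR), e1 (-R) (by rw [abs_neg, abs_of_nonneg hR]), e2, e3, a2, b2,
    integral_zero, sub_zero, zero_add, zero_sub, zero_eq_neg] using h

variable {Δ : Jet → ℝ}

/-- The charge `∫ φ q` on a slice is the flux of a divergence-free field through the bottom of a box
whose other faces carry no flux. The field is `B` along a glued function minus `B` along the
comparison function with zero initial data. -/
theorem integral_charge_eq_zero (hΔ : IsEvolution Δ) {C : Fin 3 → Jet → ℂ} (hC : IsTrivial Δ C)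
    {a q : ℝ × ℝ × ℝ → ℂ} (hCq : ∀ j, C 2 j = a j.1 + q j.1 * u_0 j) (t₀ : ℝ)
    {φ : (Fin 2 → ℝ) → ℝ} (hφ : ContDiff ℝ ∞ φ) (hφc : HasCompactSupport φ) :
    ∫ z, φ z • q (z 0, z 1, t₀) = 0 := by
  obtain ⟨A, B, hA, hB, hA0, hB0, hAB⟩ := hC
  obtain ⟨n, hn⟩ := (hA 2).exists_timeOrderLE
  let Φ : ℝ × ℝ × ℝ → ℝ := fun p => φ ![p.1, p.2.1]
  have hΦ : ContDiff ℝ ∞ Φ := hφ.comp (contDiff_pi.2 fun i => by fin_cases i <;> simp <;> fun_prop)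
  -- The comparison function `v` has initial value zero but need not be zero, since `Δ` can be
  -- nonzero on the zero jet. Subtracting its contribution also removes the term `a`.
  let w := taylorSol Δ t₀ Φ n
  let v := taylorSol Δ t₀ (fun _ => 0) n
  -- The cutoff is `1` for `t ≤ t₀ + 1/3` and `0` for `t ≥ t₀ + 2/3`, so `W` below has the jets of
  -- `w` on the slice and those of `v` at `t = t₀ + 1`.
  let χ : ℝ → ℝ := fun t => Real.smoothTransition (2 - 3 * (t - t₀))
  have hw : ContDiff ℝ ∞ w := taylorSol_contDiff hΔ.isDiffFun hΦ n
  have hv : ContDiff ℝ ∞ v := taylorSol_contDiff hΔ.isDiffFun contDiff_const n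
  have hχ : ContDiff ℝ ∞ χ := Real.smoothTransition.contDiff.comp (by fun_prop)
  let W : ℝ × ℝ × ℝ → ℝ := fun p => v p + χ p.2.2 * (w p - v p)
  have hW : ContDiff ℝ ∞ W := by fun_prop
  obtain ⟨R, hR⟩ := hφc.isCompact.isBounded.subset_closedBall 0
  have hRφ : ∀ z : Fin 2 → ℝ, z ∈ tsupport φ → ∀ i, |z i| ≤ R := fun z hz i => by
    have := hR hz
    rw [mem_closedBall_zero_iff] at this
    exact (norm_le_pi_norm z i).trans this
  -- Off the support of `φ` both initial data vanish nearby, so the two truncations coincide over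
  -- that open set of `(x, y)` for all times; this kills the flux through the lateral faces.
  have hout : ∀ p : ℝ × ℝ × ℝ, ![p.1, p.2.1] ∉ tsupport φ → jet W p = jet v p := by
    intro p hp
    have hU : IsOpen {s : ℝ × ℝ | ![s.1, s.2] ∈ (tsupport φ)ᶜ} :=
      (isClosed_tsupport φ).isOpen_compl.preimage
        (continuous_pi fun i => by fin_cases i <;> simp <;> fun_prop)
    have h1 := taylorSol_congr (Δ := Δ) (t₀ := t₀) (φ := Φ) (ψ := fun _ => 0) hU
      (fun q hq => image_eq_zero_of_notMem_tsupport (f := φ) hq) n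
    refine jet_congr (hU.preimage (f := fun p : ℝ × ℝ × ℝ => (p.1, p.2.1)) (by fun_prop)) ?_ hp
    intro q hq
    have : w q = v q := h1 hq
    simp [W, this]
  have hlate : ∀ p : ℝ × ℝ × ℝ, p.2.2 = t₀ + 1 → jet W p = jet v p := by
    intro p hp
    refine jet_congr (Ω := {q | t₀ + 2 / 3 < q.2.2})
      (isOpen_lt continuous_const (by fun_prop)) ?_ (show t₀ + 2 / 3 < p.2.2 by linarith)
    intro q hq
    have hq : t₀ + 2 / 3 < q.2.2 := hq
    have : χ q.2.2 = 0 := Real.smoothTransition.zero_of_nonpos (by linarith)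
    simp [W, this]
  have hearly : ∀ p ∈ slice t₀, jet W p = jet w p := by
    intro p hp
    have hp : p.2.2 = t₀ := hp
    refine jet_congr (Ω := {q | q.2.2 < t₀ + 1 / 3})
      (isOpen_lt (by fun_prop) continuous_const) ?_ (show p.2.2 < t₀ + 1 / 3 by linarith)
    intro q hq
    have hq : q.2.2 < t₀ + 1 / 3 := hq
    have : χ q.2.2 = 1 := Real.smoothTransition.one_of_one_le (by linarith)
    simp [W, this]
  -- `W` is in general not a solution. Its use is legitimate because `div B = 0` holds on every jet.
  let Ψ : Fin 3 → ℝ × ℝ × ℝ → ℂ := fun i p => B i (jet W p) - B i (jet v p)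
  have hΨ : ∀ i, ContDiff ℝ ∞ (Ψ i) := fun i =>
    (contDiff_comp_jet hW (hB i)).sub (contDiff_comp_jet hv (hB i))
  have hdiv : ∀ p, ∑ i, pd i (Ψ i) p = 0 := by
    intro p
    have key : ∀ i, pd i (Ψ i) p = D i (B i) (jet W p) - D i (B i) (jet v p) := by
      intro i
      have h1 := pd_comp_jet isOpen_univ hW.contDiffOn (hB i) i (Set.mem_univ p)
      have h2 := pd_comp_jet isOpen_univ hv.contDiffOn (hB i) i (Set.mem_univ p)
      beta_reduce at h1 h2
      rw [← h1, ← h2]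
      exact HasLineDerivAt.lineDeriv (HasDerivAt.sub
        (((contDiff_comp_jet hW (hB i)).differentiable (by simp) p).lineDifferentiableAt
          (v := ev i)).hasLineDerivAt
        (((contDiff_comp_jet hv (hB i)).differentiable (by simp) p).lineDifferentiableAt
          (v := ev i)).hasLineDerivAt)
    have h1 : ∑ i, D i (B i) (jet W p) = 0 := hB0 _
    have h2 : ∑ i, D i (B i) (jet v p) = 0 := hB0 _
    simp only [key, Finset.sum_sub_distrib, h1, h2, sub_zero]
  -- On the slice `B 2 = C 2 - A 2`, the term `A 2` vanishes along both truncations, and `a` cancels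
  -- in the difference; what remains is `q` times `φ - 0`.
  have hbottom : ∀ z : Fin 2 → ℝ, Ψ 2 (z 0, z 1, t₀) = φ z • q (z 0, z 1, t₀) := by
    intro z
    have hz : (z 0, z 1, t₀) ∈ slice t₀ := rfl
    have hBC : ∀ j, B 2 j = C 2 j - A 2 j := fun j => by rw [hAB]; ring
    have hz' : ![z 0, z 1] = z := by funext i; fin_cases i <;> rfl
    simp only [Ψ, hearly _ hz, hBC, hCq]
    rw [comp_taylorSol_eq_zero hΔ hn (hA0 2) hΦ hz,
      comp_taylorSol_eq_zero hΔ hn (hA0 2) contDiff_const hz]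
    have h1 : u_0 (jet w (z 0, z 1, t₀)) = φ z := by
      refine (taylorSol_slice hz).trans ?_
      simp only [Φ, hz']
    have h2 : u_0 (jet v (z 0, z 1, t₀)) = 0 := taylorSol_slice hz
    rw [h1, h2, Complex.real_smul]
    simp only [jet, Complex.ofReal_zero]
    ring
  -- `R` may be negative when `φ = 0`; the half-width `|R| + 1` is nonnegative and keeps the lateral
  -- faces strictly outside the support.
  have hR0 : 0 ≤ |R| + 1 := by positivity
  have hfar : ∀ z : Fin 2 → ℝ, ∀ i, |R| < |z i| → z ∉ tsupport φ := fun z i hi hz =>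
    absurd ((hRφ z hz i).trans (le_abs_self R)) (not_le.2 hi)
  have h := integral_bottom_eq_zero (R := |R| + 1) hΨ hdiv hR0 (by linarith : t₀ ≤ t₀ + 1)
    (fun p hp => by simp [Ψ, hout p (hfar _ 0 (by simp [hp]))])
    (fun p hp => by simp [Ψ, hout p (hfar _ 1 (by simp [hp]))])
    (fun p hp => by simp [Ψ, hlate p hp])
  simp only [hbottom] at h
  rw [← h, setIntegral_eq_integral_of_forall_compl_eq_zero]
  intro z hz
  have hz : ¬ ∀ i, -(|R| + 1) ≤ z i ∧ z i ≤ |R| + 1 := fun H => hz ⟨fun i => (H i).1, fun i => (H i).2⟩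
  push Not at hz
  obtain ⟨i, hi⟩ := hz
  have : |R| < |z i| := by
    by_contra hcon
    have := abs_le.1 (not_lt.1 hcon)
    linarith [hi (by linarith)]
  rw [image_eq_zero_of_notMem_tsupport (hfar z i this), zero_smul]

/-- Fundamental lemma of the calculus of variations on each slice; continuity of `q` upgrades
vanishing almost everywhere to vanishing everywhere. -/
theorem charge_eq_zero_of_isTrivial (hΔ : IsEvolution Δ) {C : Fin 3 → Jet → ℂ}
    (hC : IsTrivial Δ C) {a q : ℝ × ℝ × ℝ → ℂ} (hq : Continuous q)
    (hCq : ∀ j, C 2 j = a j.1 + q j.1 * u_0 j) (p : ℝ × ℝ × ℝ) : q p = 0 := by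
  have hc : Continuous fun z : Fin 2 → ℝ => q (z 0, z 1, p.2.2) := by fun_prop
  have h := ae_eq_zero_of_integral_contDiff_smul_eq_zero (μ := volume) hc.locallyIntegrable
    fun φ hφ hφc => integral_charge_eq_zero hΔ hC hCq p.2.2 hφ hφc
  have h0 := (hc.ae_eq_iff_eq volume (continuous_const (y := (0 : ℂ)))).1 h
  simpa using congrFun h0 ![p.1, p.2.1]

/-- Vectors with characteristic `q` are trivial only if `q = 0`. -/
theorem isTrivial_iff (hΔ : IsEvolution Δ) {C : Fin 3 → Jet → ℂ} (hC : ∀ i, IsDiffFun (C i))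
    {a Q : ℝ × ℝ × ℝ → ℂ} (hQ : Continuous Q) {M N : Jet → ℂ} (hM : IsDiffFun M) (hN : IsDiffFun N)
    (hCQ : ∀ j, C 2 j = a j.1 + Q j.1 * u_0 j + (D 0 M j + D 1 N j))
    (hdiv : ∀ j, div C j = -(Q j.1 * Δ j)) : IsTrivial Δ C ↔ ∀ p, Q p = 0 := by
  constructor
  · rintro ⟨A, B, hA, hB, hA0, hB0, hAB⟩
    -- Adding `(D_t M, D_t N, -(D_x M + D_y N))`, whose divergence vanishes because total
    -- derivatives commute, preserves triviality and brings the third component to the form `a + Q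
    -- u`.
    refine charge_eq_zero_of_isTrivial hΔ
      (C := ![fun j => C 0 j + D 2 M j, fun j => C 1 j + D 2 N j,
        fun j => C 2 j - (D 0 M j + D 1 N j)])
      ⟨A, ![fun j => B 0 j + D 2 M j, fun j => B 1 j + D 2 N j,
        fun j => B 2 j - (D 0 M j + D 1 N j)], hA, ?_, hA0, ?_, ?_⟩ (a := a) hQ ?_
    · intro i
      fin_cases i
      · exact (hB 0).add (hM.D 2)
      · exact (hB 1).add (hN.D 2)
      · exact (hB 2).sub ((hM.D 0).add (hN.D 1))
    · intro j
      have h0 := hB0 j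
      simp only [div, Fin.sum_univ_three, Matrix.cons_val_zero, Matrix.cons_val_one,
        Matrix.cons_val] at h0 ⊢
      rw [D_add (hB 0) (hM.D 2), D_add (hB 1) (hN.D 2), D_sub (hB 2) ((hM.D 0).add (hN.D 1)),
        D_add (hM.D 0) (hN.D 1), D_comm hM 0 2, D_comm hN 1 2]
      linear_combination h0
    · intro i j
      fin_cases i
      · simp [hAB]; ring
      · simp [hAB]; ring
      · simp [hAB]; ring
    · intro j
      simp [hCQ]
  · intro h
    refine ⟨fun _ _ => 0, C, fun _ => isDiffFun_const 0, hC, fun _ _ _ => rfl, fun j => ?_,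
      fun i j => by simp⟩
    rw [hdiv, h, zero_mul, neg_zero]

end Integral

end KS

namespace KS

/-! ### Rules of computation -/

theorem isDiffFun_d {F : ℝ × ℝ × ℝ → ℂ} (hF : ContDiff ℝ ∞ F) (a b c : ℕ) :
    IsDiffFun fun j : Jet => d a b c F j.1 :=
  isDiffFun_base (contDiffOn_univ.1 (d_contDiffOn isOpen_univ hF.contDiffOn a b c))

theorem pd_d_eq {F : ℝ × ℝ × ℝ → ℂ} (hF : ContDiff ℝ ∞ F) (i : Fin 3) (K : ℕ × ℕ × ℕ) :
    pd i (d K.1 K.2.1 K.2.2 F) = d (K + e i).1 (K + e i).2.1 (K + e i).2.2 F :=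
  funext fun p => pd_d isOpen_univ hF.contDiffOn i K (Set.mem_univ p)

theorem D_d_x {F : ℝ × ℝ × ℝ → ℂ} (hF : ContDiff ℝ ∞ F) (a b c : ℕ) :
    D 0 (fun j : Jet => d a b c F j.1) = fun j => d (a + 1) b c F j.1 := by
  rw [D_base, pd_d_eq hF 0 (a, b, c)]; rfl

theorem D_d_y {F : ℝ × ℝ × ℝ → ℂ} (hF : ContDiff ℝ ∞ F) (a b c : ℕ) :
    D 1 (fun j : Jet => d a b c F j.1) = fun j => d a (b + 1) c F j.1 := by
  rw [D_base, pd_d_eq hF 1 (a, b, c)]; rfl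

theorem D_d_t {F : ℝ × ℝ × ℝ → ℂ} (hF : ContDiff ℝ ∞ F) (a b c : ℕ) :
    D 2 (fun j : Jet => d a b c F j.1) = fun j => d a b (c + 1) F j.1 := by
  rw [D_base, pd_d_eq hF 2 (a, b, c)]; rfl

theorem D_d_zero_x {F : ℝ × ℝ × ℝ → ℂ} : D 0 (fun j : Jet => F j.1) = fun j => d 1 0 0 F j.1 := rfl

theorem D_d_zero_y {F : ℝ × ℝ × ℝ → ℂ} : D 1 (fun j : Jet => F j.1) = fun j => d 0 1 0 F j.1 := rfl

theorem D_d_zero_t {F : ℝ × ℝ × ℝ → ℂ} : D 2 (fun j : Jet => F j.1) = fun j => d 0 0 1 F j.1 := rfl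

theorem d_zero_order (F : ℝ × ℝ × ℝ → ℂ) : d 0 0 0 F = F := rfl

theorem D_coord_x (a b c : ℕ) : D 0 (fun j => j.2 (a, b, c)) = fun j => j.2 (a + 1, b, c) :=
  D_coord 0 _

theorem D_coord_y (a b c : ℕ) : D 1 (fun j => j.2 (a, b, c)) = fun j => j.2 (a, b + 1, c) :=
  D_coord 1 _

theorem D_coord_t (a b c : ℕ) : D 2 (fun j => j.2 (a, b, c)) = fun j => j.2 (a, b, c + 1) :=
  D_coord 2 _

theorem D_x (i : Fin 3) : D i (fun j => j.1.1) = fun _ => (ev i).1 := by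
  funext j
  have : HasDerivAt (fun s : ℝ => j.1.1 + s * (ev i).1) (1 * (ev i).1) 0 :=
    ((hasDerivAt_id 0).mul_const _).const_add _
  rw [one_mul] at this
  exact HasLineDerivAt.lineDeriv (f := fun j : Jet => j.1.1) (v := dir i j) this

theorem D_y (i : Fin 3) : D i (fun j => j.1.2.1) = fun _ => (ev i).2.1 := by
  funext j
  have : HasDerivAt (fun s : ℝ => j.1.2.1 + s * (ev i).2.1) (1 * (ev i).2.1) 0 :=
    ((hasDerivAt_id 0).mul_const _).const_add _
  rw [one_mul] at this
  exact HasLineDerivAt.lineDeriv (f := fun j : Jet => j.1.2.1) (v := dir i j) this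

/-- The named coordinates on the jet space. -/
theorem coords (j : Jet) :
    (u_0 j = j.2 (0, 0, 0) ∧ u_x j = j.2 (1, 0, 0) ∧ u_y j = j.2 (0, 1, 0) ∧ u_t j = j.2 (0, 0, 1)) ∧
    (u_xx j = j.2 (2, 0, 0) ∧ u_xy j = j.2 (1, 1, 0) ∧ u_yy j = j.2 (0, 2, 0)) ∧
    (u_xxx j = j.2 (3, 0, 0) ∧ u_xxy j = j.2 (2, 1, 0) ∧ u_xyy j = j.2 (1, 2, 0) ∧
      u_yyy j = j.2 (0, 3, 0)) ∧
    (u_xxxx j = j.2 (4, 0, 0) ∧ u_xxyy j = j.2 (2, 2, 0) ∧ u_xyyy j = j.2 (1, 3, 0) ∧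
      u_yyyy j = j.2 (0, 4, 0)) :=
  ⟨⟨rfl, rfl, rfl, rfl⟩, ⟨rfl, rfl, rfl⟩, ⟨rfl, rfl, rfl, rfl⟩, ⟨rfl, rfl, rfl, rfl⟩⟩

/-- Closure properties of the differential functions with complex values. -/
theorem isDiffFun_rules :
    (∀ F G : Jet → ℂ, IsDiffFun F → IsDiffFun G → IsDiffFun fun j => F j + G j) ∧
    (∀ F G : Jet → ℂ, IsDiffFun F → IsDiffFun G → IsDiffFun fun j => F j - G j) ∧
    (∀ F G : Jet → ℂ, IsDiffFun F → IsDiffFun G → IsDiffFun fun j => F j * G j) ∧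
    (∀ F : Jet → ℂ, IsDiffFun F → IsDiffFun fun j => -F j) ∧
    (∀ (F : Jet → ℂ) (n : ℕ), IsDiffFun F → IsDiffFun fun j => F j ^ n) ∧
    (∀ (F : Jet → ℂ) (c : ℂ), IsDiffFun F → IsDiffFun fun j => F j / c) ∧
    (∀ F : Jet → ℝ, IsDiffFun F → IsDiffFun fun j => (F j : ℂ)) ∧
    (∀ K : ℕ × ℕ × ℕ, IsDiffFun fun j => j.2 K) ∧ (∀ c : ℂ, IsDiffFun fun _ : Jet => c) ∧
    (IsDiffFun fun j : Jet => j.1.1) ∧ IsDiffFun fun j : Jet => j.1.2.1 :=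
  ⟨fun _ _ h h' => h.add h', fun _ _ h h' => h.sub h', fun _ _ h h' => h.mul h', fun _ h => h.neg,
    fun _ n h => h.pow n, fun _ c h => h.div_const c, fun _ h => h.ofReal, isDiffFun_coord,
    isDiffFun_const, isDiffFun_x, isDiffFun_y⟩

/-- Rules for the total derivatives of differential functions with complex values. -/
theorem D_rules (i : Fin 3) :
    (∀ F G : Jet → ℂ, IsDiffFun F → IsDiffFun G →
      D i (fun j => F j + G j) = fun j => D i F j + D i G j) ∧
    (∀ F G : Jet → ℂ, IsDiffFun F → IsDiffFun G →
      D i (fun j => F j - G j) = fun j => D i F j - D i G j) ∧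
    (∀ F G : Jet → ℂ, IsDiffFun F → IsDiffFun G →
      D i (fun j => F j * G j) = fun j => D i F j * G j + F j * D i G j) ∧
    (∀ F : Jet → ℂ, D i (fun j => -F j) = fun j => -D i F j) ∧
    (∀ (F : Jet → ℂ) (n : ℕ), IsDiffFun F →
      D i (fun j => F j ^ n) = fun j => n * F j ^ (n - 1) * D i F j) ∧
    (∀ (F : Jet → ℂ) (c : ℂ), IsDiffFun F → D i (fun j => F j / c) = fun j => D i F j / c) ∧
    (∀ F : Jet → ℝ, IsDiffFun F → D i (fun j => (F j : ℂ)) = fun j => ((D i F j : ℝ) : ℂ)) ∧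
    (∀ c : ℂ, D i (fun _ => c) = fun _ => 0) :=
  ⟨fun _ _ h h' => D_add h h' i, fun _ _ h h' => D_sub h h' i, fun _ _ h h' => D_mul h h' i,
    fun F => D_neg F i, fun _ n h => D_pow h n i, fun _ c h => D_div_const h c i,
    fun _ h => D_ofReal h i, D_const i⟩

/-- Total derivatives of the coordinates. -/
theorem D_coords :
    (∀ a b c : ℕ, (D 0 (fun j => j.2 (a, b, c)) = fun j => j.2 (a + 1, b, c)) ∧
      (D 1 (fun j => j.2 (a, b, c)) = fun j => j.2 (a, b + 1, c)) ∧
      (D 2 (fun j => j.2 (a, b, c)) = fun j => j.2 (a, b, c + 1))) ∧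
    ((D 0 (fun j => j.1.1) = fun _ => 1) ∧ (D 1 (fun j => j.1.1) = fun _ => 0) ∧
      (D 2 (fun j => j.1.1) = fun _ => 0)) ∧
    ((D 0 (fun j => j.1.2.1) = fun _ => 0) ∧ (D 1 (fun j => j.1.2.1) = fun _ => 1) ∧
      (D 2 (fun j => j.1.2.1) = fun _ => 0)) :=
  ⟨fun a b c => ⟨D_coord_x a b c, D_coord_y a b c, D_coord_t a b c⟩, ⟨D_x 0, D_x 1, D_x 2⟩,
    ⟨D_y 0, D_y 1, D_y 2⟩⟩

/-! ### The equation -/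

section Equation

variable {f g h r : ℝ → ℝ}

theorem hasLineDerivAt_fun_u {φ : ℝ → ℝ} (hφ : ContDiff ℝ ∞ φ) (j v : Jet) :
    HasLineDerivAt ℝ (fun j => φ (u_0 j)) (deriv φ (u_0 j) * v.2 (0, 0, 0)) j v := by
  have h1 : HasDerivAt φ (deriv φ (u_0 j)) (u_0 j + 0 * v.2 (0, 0, 0)) := by
    rw [zero_mul, add_zero]
    exact (hφ.differentiable (by simp) _).hasDerivAt
  have h2 : HasDerivAt (fun s : ℝ => u_0 j + s * v.2 (0, 0, 0)) (1 * v.2 (0, 0, 0)) 0 :=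
    ((hasDerivAt_id 0).mul_const _).const_add _
  have h := HasDerivAt.comp (0 : ℝ) h1 h2
  rw [one_mul] at h
  exact h

theorem hasLineDerivAt_coord (K : ℕ × ℕ × ℕ) (j v : Jet) :
    HasLineDerivAt ℝ (fun j => j.2 K) (v.2 K) j v := by
  have : HasDerivAt (fun s : ℝ => j.2 K + s * v.2 K) (1 * v.2 K) 0 :=
    ((hasDerivAt_id 0).mul_const _).const_add _
  rw [one_mul] at this
  exact this

/-- One linearization serves three purposes: `v` is a coordinate vector for `∂/∂u_K`, `dir i` for `D
i`, and the prolonged generator for symmetries. The base component `v.1` is absent because `Δ` does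
not depend explicitly on `x, y, t`. -/
theorem lineDeriv_Delta (hf : ContDiff ℝ ∞ f) (hg : ContDiff ℝ ∞ g) (hh : ContDiff ℝ ∞ h)
    (hr : ContDiff ℝ ∞ r) (j v : Jet) :
    lineDeriv ℝ (Delta f g h r) j v =
      (deriv h (u_0 j) * u_y j ^ 2 + deriv r (u_0 j) * u_xx j + deriv g (u_0 j) * u_yy j
        + deriv f (u_0 j)) * v.2 (0, 0, 0) + u_x j * v.2 (1, 0, 0)
        + 2 * h (u_0 j) * u_y j * v.2 (0, 1, 0) - v.2 (0, 0, 1) + r (u_0 j) * v.2 (2, 0, 0)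
        + g (u_0 j) * v.2 (0, 2, 0) - v.2 (4, 0, 0) - 2 * v.2 (2, 2, 0) - v.2 (0, 4, 0) := by
  have hu := fun K => hasLineDerivAt_coord K j v
  have hx2 := HasDerivAt.const_mul (1 / 2 : ℝ) (HasDerivAt.fun_pow (hu (1, 0, 0)) 2)
  have hy2 := HasDerivAt.mul (hasLineDerivAt_fun_u hh j v) (HasDerivAt.fun_pow (hu (0, 1, 0)) 2)
  have hxx := HasDerivAt.mul (hasLineDerivAt_fun_u hr j v) (hu (2, 0, 0))
  have hyy := HasDerivAt.mul (hasLineDerivAt_fun_u hg j v) (hu (0, 2, 0))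
  have hsum := (((((((hx2.add hy2).add hxx).add hyy).sub (hu (4, 0, 0))).sub
    (HasDerivAt.const_mul (2 : ℝ) (hu (2, 2, 0)))).sub (hu (0, 4, 0))).sub (hu (0, 0, 1))).add
      (hasLineDerivAt_fun_u hf j v)
  have hline : HasLineDerivAt ℝ (Delta f g h r) _ j v := hsum
  rw [hline.lineDeriv]
  simp only [zero_smul, add_zero, coords]
  ring

theorem isEvolution_Delta (hf : ContDiff ℝ ∞ f) (hg : ContDiff ℝ ∞ g) (hh : ContDiff ℝ ∞ h)
    (hr : ContDiff ℝ ∞ r) : IsEvolution (Delta f g h r) := by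
  have hφ : ∀ {φ : ℝ → ℝ}, ContDiff ℝ ∞ φ → IsDiffFun fun j => φ (u_0 j) :=
    fun hφ => isDiffFun_u_0.comp hφ
  have hu := isDiffFun_coord
  refine ⟨fun j => 1 / 2 * u_x j ^ 2 + h (u_0 j) * u_y j ^ 2 + r (u_0 j) * u_xx j
    + g (u_0 j) * u_yy j - u_xxxx j - 2 * u_xxyy j - u_yyyy j + f (u_0 j), ?_, ?_, ?_⟩
  · exact ((((((((isDiffFun_const _).mul ((hu _).pow 2)).add ((hφ hh).mul ((hu _).pow 2))).add
      ((hφ hr).mul (hu _))).add ((hφ hg).mul (hu _))).sub (hu _)).sub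
        ((isDiffFun_const _).mul (hu _))).sub (hu _)).add (hφ hf)
  · intro j j' _ h2
    have h2' : ∀ a b, j.2 (a, b, 0) = j'.2 (a, b, 0) := fun a b => h2 _ le_rfl
    simp only [coords, h2']
  · funext j
    simp only [Delta, coords]
    ring

theorem isDiffFun_Delta (hf : ContDiff ℝ ∞ f) (hg : ContDiff ℝ ∞ g) (hh : ContDiff ℝ ∞ h)
    (hr : ContDiff ℝ ∞ r) : IsDiffFun (Delta f g h r) :=
  (isEvolution_Delta hf hg hh hr).isDiffFun

/-- Constant coefficients make every prolongation coefficient zero, and `Δ` is autonomous, so the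
action vanishes on all jets. -/
theorem isSymmetry_translation (hf : ContDiff ℝ ∞ f) (hg : ContDiff ℝ ∞ g) (hh : ContDiff ℝ ∞ h)
    (hr : ContDiff ℝ ∞ r) (i : Fin 3) : (Generator.translation i).IsSymmetry (Delta f g h r) := by
  have hξ : ∀ l k, D k ((Generator.translation i).xi l) = fun _ => 0 := fun l k => D_const k _
  have hT : ∀ c, (Generator.translation i).prolT c = fun _ => 0 := by
    intro c
    induction c with
    | zero => rfl
    | succ c ih => funext j; simp [Generator.prolT, ih, hξ, D_const]
  have hY : ∀ b c, (Generator.translation i).prolY b c = fun _ => 0 := by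
    intro b c
    induction b with
    | zero => exact hT c
    | succ b ih => funext j; simp [Generator.prolY, ih, hξ, D_const]
  have hX : ∀ a b c, (Generator.translation i).prol a b c = fun _ => 0 := by
    intro a b c
    induction a with
    | zero => exact hY b c
    | succ a ih => funext j; simp [Generator.prol, ih, hξ, D_const]
  intro j _
  simp only [Generator.act, lineDeriv_Delta hf hg hh hr, hX]
  ring

theorem prol_rotation_aux (j : Jet) :
    (D 0 (Generator.rotation.xi 0) j = 0 ∧ D 0 (Generator.rotation.xi 1) j = 1 ∧
      D 0 (Generator.rotation.xi 2) j = 0) ∧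
    (D 1 (Generator.rotation.xi 0) j = -1 ∧ D 1 (Generator.rotation.xi 1) j = 0 ∧
      D 1 (Generator.rotation.xi 2) j = 0) ∧
    (D 2 (Generator.rotation.xi 0) j = 0 ∧ D 2 (Generator.rotation.xi 1) j = 0 ∧
      D 2 (Generator.rotation.xi 2) j = 0) := by
  have h0 : Generator.rotation.xi 0 = fun j => -j.1.2.1 := rfl
  have h1 : Generator.rotation.xi 1 = fun j => j.1.1 := rfl
  have h2 : Generator.rotation.xi 2 = fun _ => 0 := rfl
  simp [h0, h1, h2, D_neg, D_coords, D_const]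

theorem prolT_rotation (c : ℕ) : Generator.rotation.prolT c = fun _ => 0 := by
  induction c with
  | zero => rfl
  | succ c ih =>
    funext j
    simp [Generator.prolT, ih, D_const, Fin.sum_univ_three, prol_rotation_aux]

/-- For `b = 0` the truncated index `b - 1` is harmless, because its coefficient is zero. -/
theorem prolY_rotation (b c : ℕ) :
    Generator.rotation.prolY b c = fun j : Jet => b * j.2 (1, b - 1, c) := by
  induction b with
  | zero => rw [Generator.prolY, prolT_rotation]; simp
  | succ b ih =>
    funext j
    rw [Generator.prolY, ih, D_mul (isDiffFun_const _) (isDiffFun_coord _), D_const]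
    rcases b with _ | b
    · simp [Fin.sum_univ_three, prol_rotation_aux, e]
    · simp [Fin.sum_univ_three, prol_rotation_aux, e, D_coords]
      ring

/-- The rotation acts on derivatives by exchanging one `y` for an `x`, in `b` ways, and one `x` for
a `y`, in `a` ways with a minus sign. Truncated indices again carry the coefficient zero. -/
theorem prol_rotation (a b c : ℕ) : Generator.rotation.prol a b c =
    fun j : Jet => b * j.2 (a + 1, b - 1, c) - a * j.2 (a - 1, b + 1, c) := by
  induction a with
  | zero => rw [Generator.prol, prolY_rotation]; simp
  | succ a ih =>
    funext j
    rw [Generator.prol, ih, D_sub ((isDiffFun_const _).mul (isDiffFun_coord _))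
      ((isDiffFun_const _).mul (isDiffFun_coord _)), D_mul (isDiffFun_const _) (isDiffFun_coord _),
      D_mul (isDiffFun_const _) (isDiffFun_coord _), D_const, D_const]
    rcases a with _ | a
    · simp [Fin.sum_univ_three, prol_rotation_aux, e, D_coords]
    · simp [Fin.sum_univ_three, prol_rotation_aux, e, D_coords]
      ring

/-- With `g = r` and `h = 1/2` the equation is written through `|∇u|²`, the Laplacian and the
bilaplacian, all rotation invariant. The action vanishes on all jets, not only where `Δ = 0`. -/
theorem isSymmetry_rotation (hf : ContDiff ℝ ∞ f) (hr : ContDiff ℝ ∞ r) :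
    Generator.rotation.IsSymmetry (Delta f r (fun _ => 1 / 2) r) := by
  intro j _
  simp only [Generator.act, lineDeriv_Delta hf hr contDiff_const hr, prol_rotation, coords]
  simp
  ring

end Equation

end KS

namespace KS

/-! ### The Noether operator -/

section Noether

variable {f g h r : ℝ → ℝ} {υ : ℝ × ℝ × ℝ → ℂ}

theorem isDiffFun_lagr {Δ : Jet → ℝ} (hυ : ContDiff ℝ ∞ υ) (hΔ : IsDiffFun Δ) :
    IsDiffFun (lagr υ Δ) :=
  (isDiffFun_base hυ).mul hΔ.ofReal

theorem lineDeriv_lagr {Δ : Jet → ℝ} (hυ : ContDiff ℝ ∞ υ) (hΔ : IsDiffFun Δ) (j v : Jet) :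
    lineDeriv ℝ (lagr υ Δ) j v = fderiv ℝ υ j.1 v.1 * Δ j + υ j.1 * (lineDeriv ℝ Δ j v : ℝ) := by
  have h1 : HasLineDerivAt ℝ υ (fderiv ℝ υ j.1 v.1) j.1 v.1 :=
    (hυ.differentiable (by simp) j.1).hasFDerivAt.hasLineDerivAt v.1
  have h := HasDerivAt.mul h1 (HasDerivAt.ofReal_comp (hΔ.hasLineDerivAt j v))
  simp only [zero_smul, add_zero] at h
  exact HasLineDerivAt.lineDeriv (f := lagr υ Δ) h

theorem dU_lagr {Δ : Jet → ℝ} (hυ : ContDiff ℝ ∞ υ) (hΔ : IsDiffFun Δ) (K : ℕ × ℕ × ℕ) :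
    dU K (lagr υ Δ) = fun j => υ j.1 * (lineDeriv ℝ Δ j (0, Pi.single K 1) : ℝ) := by
  funext j
  rw [dU, lineDeriv_lagr hυ hΔ]
  simp

/-- The derivatives of the formal Lagrangian with respect to the jet coordinates. -/
theorem dU_lagr_Delta (hυ : ContDiff ℝ ∞ υ) (hf : ContDiff ℝ ∞ f) (hg : ContDiff ℝ ∞ g)
    (hh : ContDiff ℝ ∞ h) (hr : ContDiff ℝ ∞ r) :
    (dU (0, 0, 0) (lagr υ (Delta f g h r)) = fun j => υ j.1 * (deriv h (u_0 j) * u_y j ^ 2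
      + deriv r (u_0 j) * u_xx j + deriv g (u_0 j) * u_yy j + deriv f (u_0 j) : ℝ)) ∧
    (dU (1, 0, 0) (lagr υ (Delta f g h r)) = fun j => υ j.1 * (u_x j : ℝ)) ∧
    (dU (0, 1, 0) (lagr υ (Delta f g h r)) = fun j => υ j.1 * (2 * h (u_0 j) * u_y j : ℝ)) ∧
    (dU (0, 0, 1) (lagr υ (Delta f g h r)) = fun j => υ j.1 * (-1 : ℝ)) ∧
    (dU (2, 0, 0) (lagr υ (Delta f g h r)) = fun j => υ j.1 * (r (u_0 j) : ℝ)) ∧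
    (dU (0, 2, 0) (lagr υ (Delta f g h r)) = fun j => υ j.1 * (g (u_0 j) : ℝ)) ∧
    (dU (4, 0, 0) (lagr υ (Delta f g h r)) = fun j => υ j.1 * (-1 : ℝ)) ∧
    (dU (2, 2, 0) (lagr υ (Delta f g h r)) = fun j => υ j.1 * (-2 : ℝ)) ∧
    (dU (0, 4, 0) (lagr υ (Delta f g h r)) = fun j => υ j.1 * (-1 : ℝ)) := by
  simp only [dU_lagr hυ (isDiffFun_Delta hf hg hh hr), lineDeriv_Delta hf hg hh hr]
  refine ⟨?_, ?_, ?_, ?_, ?_, ?_, ?_, ?_, ?_⟩ <;> funext j <;> simp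

theorem dU_lagr_Delta_eq_zero (hυ : ContDiff ℝ ∞ υ) (hf : ContDiff ℝ ∞ f) (hg : ContDiff ℝ ∞ g)
    (hh : ContDiff ℝ ∞ h) (hr : ContDiff ℝ ∞ r) {K : ℕ × ℕ × ℕ}
    (hK : K ∉ ({(0, 0, 0), (1, 0, 0), (0, 1, 0), (0, 0, 1), (2, 0, 0), (0, 2, 0), (4, 0, 0),
      (2, 2, 0), (0, 4, 0)} : Finset (ℕ × ℕ × ℕ))) :
    dU K (lagr υ (Delta f g h r)) = fun _ => 0 := by
  simp only [Finset.mem_insert, Finset.mem_singleton, not_or] at hK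
  simp only [dU_lagr hυ (isDiffFun_Delta hf hg hh hr), lineDeriv_Delta hf hg hh hr]
  funext j
  have hs : ∀ J : ℕ × ℕ × ℕ, ¬ K = J → (Pi.single K 1 : ℕ × ℕ × ℕ → ℝ) J = 0 :=
    fun J hJ => Pi.single_eq_of_ne (Ne.symm hJ) 1
  simp only [hs _ hK.1, hs _ hK.2.1, hs _ hK.2.2.1, hs _ hK.2.2.2.1, hs _ hK.2.2.2.2.1,
    hs _ hK.2.2.2.2.2.1, hs _ hK.2.2.2.2.2.2.1, hs _ hK.2.2.2.2.2.2.2.1,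
    hs _ hK.2.2.2.2.2.2.2.2]
  simp

theorem sum_idx {M : Type*} [AddCommMonoid M] (n : ℕ) (F : ℕ × ℕ × ℕ → M) :
    ∑ K ∈ idx n, F K = ∑ a ∈ Finset.range (n + 1), ∑ b ∈ Finset.range (n + 1),
      ∑ c ∈ Finset.range (n + 1), if a + b + c ≤ n then F (a, b, c) else 0 := by
  rw [idx, Finset.sum_filter, Finset.sum_product]
  simp only [Finset.sum_product]
  rfl

theorem sum_idx_zero {M : Type*} [AddCommMonoid M] (F : ℕ × ℕ × ℕ → M) :
    ∑ K ∈ idx 0, F K =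
      F (0, 0, 0) := by
  simp [sum_idx, add_assoc]

theorem sum_idx_one {M : Type*} [AddCommMonoid M] (F : ℕ × ℕ × ℕ → M) :
    ∑ K ∈ idx 1, F K =
      F (0, 0, 0) + F (0, 0, 1) + F (0, 1, 0) + F (1, 0, 0) := by
  simp [sum_idx, Finset.sum_range_succ, add_assoc]

theorem sum_idx_two {M : Type*} [AddCommMonoid M] (F : ℕ × ℕ × ℕ → M) :
    ∑ K ∈ idx 2, F K =
      F (0, 0, 0) + F (0, 0, 1) + F (0, 0, 2) + F (0, 1, 0) + F (0, 1, 1) + F (0, 2, 0)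
      + F (1, 0, 0) + F (1, 0, 1) + F (1, 1, 0) + F (2, 0, 0) := by
  simp [sum_idx, Finset.sum_range_succ, add_assoc]

theorem sum_idx_three {M : Type*} [AddCommMonoid M] (F : ℕ × ℕ × ℕ → M) :
    ∑ K ∈ idx 3, F K =
      F (0, 0, 0) + F (0, 0, 1) + F (0, 0, 2) + F (0, 0, 3) + F (0, 1, 0) + F (0, 1, 1)
      + F (0, 1, 2) + F (0, 2, 0) + F (0, 2, 1) + F (0, 3, 0) + F (1, 0, 0) + F (1, 0, 1)
      + F (1, 0, 2) + F (1, 1, 0) + F (1, 1, 1) + F (1, 2, 0) + F (2, 0, 0) + F (2, 0, 1)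
      + F (2, 1, 0) + F (3, 0, 0) := by
  simp [sum_idx, Finset.sum_range_succ, add_assoc]

theorem sum_idx_four {M : Type*} [AddCommMonoid M] (F : ℕ × ℕ × ℕ → M) :
    ∑ K ∈ idx 4, F K =
      F (0, 0, 0) + F (0, 0, 1) + F (0, 0, 2) + F (0, 0, 3) + F (0, 0, 4) + F (0, 1, 0)
      + F (0, 1, 1) + F (0, 1, 2) + F (0, 1, 3) + F (0, 2, 0) + F (0, 2, 1) + F (0, 2, 2)
      + F (0, 3, 0) + F (0, 3, 1) + F (0, 4, 0) + F (1, 0, 0) + F (1, 0, 1) + F (1, 0, 2)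
      + F (1, 0, 3) + F (1, 1, 0) + F (1, 1, 1) + F (1, 1, 2) + F (1, 2, 0) + F (1, 2, 1)
      + F (1, 3, 0) + F (2, 0, 0) + F (2, 0, 1) + F (2, 0, 2) + F (2, 1, 0) + F (2, 1, 1)
      + F (2, 2, 0) + F (3, 0, 0) + F (3, 0, 1) + F (3, 1, 0) + F (4, 0, 0) := by
  simp [sum_idx, Finset.sum_range_succ, add_assoc]

theorem DD_zero {V : Type*} [NormedAddCommGroup V] [NormedSpace ℝ V] (K : ℕ × ℕ × ℕ) :
    DD K (fun _ => (0 : V)) = fun _ => 0 := by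
  have h : ∀ (i : Fin 3) (n : ℕ), (D i)^[n] (fun _ => (0 : V)) = fun _ => 0 := fun i n =>
    Function.iterate_fixed (D_const i 0) n
  simp only [DD, h]

/-- Only the nine derivatives occurring in `Δ` contribute. The factors `1/2`, `1/3`, `1/6` come from
distributing `u_xxyy`, whose multinomial coefficient is `6`, over its symmetric partial derivatives.
-/
theorem noether_x (X : Generator) (hυ : ContDiff ℝ ∞ υ) (hf : ContDiff ℝ ∞ f) (hg : ContDiff ℝ ∞ g)
    (hh : ContDiff ℝ ∞ h) (hr : ContDiff ℝ ∞ r) :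
    noether X (lagr υ (Delta f g h r)) 0 = fun j =>
      (X.xi 0 j : ℂ) * lagr υ (Delta f g h r) j
      + (DD (0, 0, 0) X.W j : ℝ) * (DD (0, 0, 0) (dU (1, 0, 0) (lagr υ (Delta f g h r))) j - DD (1, 0, 0) (dU (2, 0, 0) (lagr υ (Delta f g h r))) j
        - 1 / 2 * DD (1, 2, 0) (dU (2, 2, 0) (lagr υ (Delta f g h r))) j - DD (3, 0, 0) (dU (4, 0, 0) (lagr υ (Delta f g h r))) j)
      + (DD (0, 1, 0) X.W j : ℝ) * (1 / 3 * DD (1, 1, 0) (dU (2, 2, 0) (lagr υ (Delta f g h r))) j)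
      - (DD (0, 2, 0) X.W j : ℝ) * (1 / 6 * DD (1, 0, 0) (dU (2, 2, 0) (lagr υ (Delta f g h r))) j)
      + (DD (1, 0, 0) X.W j : ℝ) * (DD (0, 0, 0) (dU (2, 0, 0) (lagr υ (Delta f g h r))) j + 1 / 6 * DD (0, 2, 0) (dU (2, 2, 0) (lagr υ (Delta f g h r))) j
        + DD (2, 0, 0) (dU (4, 0, 0) (lagr υ (Delta f g h r))) j)
      - (DD (1, 1, 0) X.W j : ℝ) * (1 / 3 * DD (0, 1, 0) (dU (2, 2, 0) (lagr υ (Delta f g h r))) j)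
      + (DD (1, 2, 0) X.W j : ℝ) * (1 / 2 * DD (0, 0, 0) (dU (2, 2, 0) (lagr υ (Delta f g h r))) j)
      - (DD (2, 0, 0) X.W j : ℝ) * DD (1, 0, 0) (dU (4, 0, 0) (lagr υ (Delta f g h r))) j
      + (DD (3, 0, 0) X.W j : ℝ) * DD (0, 0, 0) (dU (4, 0, 0) (lagr υ (Delta f g h r))) j := by
  funext j
  simp only [noether, sum_idx_three, ord, Nat.reduceAdd, Nat.reduceSub, sum_idx_zero, sum_idx_one,
    sum_idx_two, Prod.mk_add_mk, e, Matrix.cons_val_zero]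
  simp (disch := decide) only [dU_lagr_Delta_eq_zero hυ hf hg hh hr, DD_zero, mul_zero, zero_add,
    add_zero]
  simp [mult, ord, Nat.factorial]
  ring

theorem noether_y (X : Generator) (hυ : ContDiff ℝ ∞ υ) (hf : ContDiff ℝ ∞ f) (hg : ContDiff ℝ ∞ g)
    (hh : ContDiff ℝ ∞ h) (hr : ContDiff ℝ ∞ r) :
    noether X (lagr υ (Delta f g h r)) 1 = fun j =>
      (X.xi 1 j : ℂ) * lagr υ (Delta f g h r) j
      + (DD (0, 0, 0) X.W j : ℝ) * (DD (0, 0, 0) (dU (0, 1, 0) (lagr υ (Delta f g h r))) j - DD (0, 1, 0) (dU (0, 2, 0) (lagr υ (Delta f g h r))) j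
        - 1 / 2 * DD (2, 1, 0) (dU (2, 2, 0) (lagr υ (Delta f g h r))) j - DD (0, 3, 0) (dU (0, 4, 0) (lagr υ (Delta f g h r))) j)
      + (DD (1, 0, 0) X.W j : ℝ) * (1 / 3 * DD (1, 1, 0) (dU (2, 2, 0) (lagr υ (Delta f g h r))) j)
      - (DD (2, 0, 0) X.W j : ℝ) * (1 / 6 * DD (0, 1, 0) (dU (2, 2, 0) (lagr υ (Delta f g h r))) j)
      + (DD (0, 1, 0) X.W j : ℝ) * (DD (0, 0, 0) (dU (0, 2, 0) (lagr υ (Delta f g h r))) j + 1 / 6 * DD (2, 0, 0) (dU (2, 2, 0) (lagr υ (Delta f g h r))) j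
        + DD (0, 2, 0) (dU (0, 4, 0) (lagr υ (Delta f g h r))) j)
      - (DD (1, 1, 0) X.W j : ℝ) * (1 / 3 * DD (1, 0, 0) (dU (2, 2, 0) (lagr υ (Delta f g h r))) j)
      + (DD (2, 1, 0) X.W j : ℝ) * (1 / 2 * DD (0, 0, 0) (dU (2, 2, 0) (lagr υ (Delta f g h r))) j)
      - (DD (0, 2, 0) X.W j : ℝ) * DD (0, 1, 0) (dU (0, 4, 0) (lagr υ (Delta f g h r))) j
      + (DD (0, 3, 0) X.W j : ℝ) * DD (0, 0, 0) (dU (0, 4, 0) (lagr υ (Delta f g h r))) j := by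
  funext j
  simp only [noether, sum_idx_three, ord, Nat.reduceAdd, Nat.reduceSub, sum_idx_zero, sum_idx_one,
    sum_idx_two, Prod.mk_add_mk, e, Matrix.cons_val_zero, Matrix.cons_val_one]
  simp (disch := decide) only [dU_lagr_Delta_eq_zero hυ hf hg hh hr, DD_zero, mul_zero, zero_add,
    add_zero]
  simp [mult, ord, Nat.factorial]
  ring

theorem noether_t (X : Generator) (hυ : ContDiff ℝ ∞ υ) (hf : ContDiff ℝ ∞ f) (hg : ContDiff ℝ ∞ g)
    (hh : ContDiff ℝ ∞ h) (hr : ContDiff ℝ ∞ r) :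
    noether X (lagr υ (Delta f g h r)) 2 = fun j =>
      (X.xi 2 j : ℂ) * lagr υ (Delta f g h r) j
      + (DD (0, 0, 0) X.W j : ℝ) * DD (0, 0, 0) (dU (0, 0, 1) (lagr υ (Delta f g h r))) j := by
  funext j
  simp only [noether, sum_idx_three, ord, Nat.reduceAdd, Nat.reduceSub, sum_idx_zero, sum_idx_one,
    sum_idx_two, Prod.mk_add_mk, e, Matrix.cons_val]
  simp (disch := decide) only [dU_lagr_Delta_eq_zero hυ hf hg hh hr, DD_zero, mul_zero,
    add_zero]
  simp [mult, ord, Nat.factorial]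

theorem euler_lagr_Delta (hυ : ContDiff ℝ ∞ υ) (hf : ContDiff ℝ ∞ f) (hg : ContDiff ℝ ∞ g)
    (hh : ContDiff ℝ ∞ h) (hr : ContDiff ℝ ∞ r) (j : Jet) :
    euler (lagr υ (Delta f g h r)) j =
      DD (0, 0, 0) (dU (0, 0, 0) (lagr υ (Delta f g h r))) j
      - DD (1, 0, 0) (dU (1, 0, 0) (lagr υ (Delta f g h r))) j
      - DD (0, 1, 0) (dU (0, 1, 0) (lagr υ (Delta f g h r))) j
      - DD (0, 0, 1) (dU (0, 0, 1) (lagr υ (Delta f g h r))) j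
      + DD (2, 0, 0) (dU (2, 0, 0) (lagr υ (Delta f g h r))) j
      + DD (0, 2, 0) (dU (0, 2, 0) (lagr υ (Delta f g h r))) j
      + DD (4, 0, 0) (dU (4, 0, 0) (lagr υ (Delta f g h r))) j
      + DD (2, 2, 0) (dU (2, 2, 0) (lagr υ (Delta f g h r))) j
      + DD (0, 4, 0) (dU (0, 4, 0) (lagr υ (Delta f g h r))) j := by
  rw [euler, sum_idx_four]
  simp (disch := decide) only [dU_lagr_Delta_eq_zero hυ hf hg hh hr, DD_zero, mul_zero,
    add_zero]
  simp [ord]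
  ring

theorem iterate_D_comm {V : Type*} [NormedAddCommGroup V] [NormedSpace ℝ V] {F : Jet → V}
    (hF : IsDiffFun F) (i k : Fin 3) (n : ℕ) : D i ((D k)^[n] F) = (D k)^[n] (D i F) := by
  induction n with
  | zero => rfl
  | succ n ih => simp only [Function.iterate_succ_apply', D_comm (hF.iterate_D k n) i k, ih]

theorem D_DD {V : Type*} [NormedAddCommGroup V] [NormedSpace ℝ V] {F : Jet → V}
    (hF : IsDiffFun F) (a b c : ℕ) : D 0 (DD (a, b, c) F) = DD (a + 1, b, c) F ∧
      D 1 (DD (a, b, c) F) = DD (a, b + 1, c) F ∧ D 2 (DD (a, b, c) F) = DD (a, b, c + 1) F := by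
  have h2 := hF.iterate_D 2 c
  simp only [DD, Function.iterate_succ_apply']
  exact ⟨trivial, iterate_D_comm (h2.iterate_D 1 b) 1 0 a, by
    rw [iterate_D_comm (h2.iterate_D 1 b), iterate_D_comm h2]⟩

theorem IsDiffFun.dU {V : Type*} [NormedAddCommGroup V] [NormedSpace ℝ V] {F : Jet → V}
    (hF : IsDiffFun F) (K : ℕ × ℕ × ℕ) : IsDiffFun (dU K F) := by
  obtain ⟨S, P, hP, rfl⟩ := isDiffFun_iff.1 hF
  have h : KS.dU K (P ∘ proj S) = fun j => fderiv ℝ P (proj S j) (proj S (0, Pi.single K 1)) :=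
    funext fun j => (hasLineDerivAt_proj hP j _).lineDeriv
  rw [h]
  exact (isDiffFun_proj S).comp (Φ := fun q => fderiv ℝ P q (proj S (0, Pi.single K 1)))
    ((hP.fderiv_right (by simp)).clm_apply contDiff_const)

/-- The Noether identity for the formal Lagrangian. -/
theorem div_noether (X : Generator) (hυ : ContDiff ℝ ∞ υ) (hf : ContDiff ℝ ∞ f) (hg : ContDiff ℝ ∞ g)
    (hh : ContDiff ℝ ∞ h) (hr : ContDiff ℝ ∞ r)
    (hξ : ∀ i, IsDiffFun (X.xi i)) (hW : IsDiffFun X.W) (j : Jet) :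
    div (noether X (lagr υ (Delta f g h r))) j =
      D 0 (fun j => (X.xi 0 j : ℂ) * lagr υ (Delta f g h r) j) j
      + D 1 (fun j => (X.xi 1 j : ℂ) * lagr υ (Delta f g h r) j) j
      + D 2 (fun j => (X.xi 2 j : ℂ) * lagr υ (Delta f g h r) j) j
      + ((DD (0, 0, 0) X.W j : ℝ) * dU (0, 0, 0) (lagr υ (Delta f g h r)) j
      + (DD (1, 0, 0) X.W j : ℝ) * dU (1, 0, 0) (lagr υ (Delta f g h r)) j
      + (DD (0, 1, 0) X.W j : ℝ) * dU (0, 1, 0) (lagr υ (Delta f g h r)) j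
      + (DD (0, 0, 1) X.W j : ℝ) * dU (0, 0, 1) (lagr υ (Delta f g h r)) j
      + (DD (2, 0, 0) X.W j : ℝ) * dU (2, 0, 0) (lagr υ (Delta f g h r)) j
      + (DD (0, 2, 0) X.W j : ℝ) * dU (0, 2, 0) (lagr υ (Delta f g h r)) j
      + (DD (4, 0, 0) X.W j : ℝ) * dU (4, 0, 0) (lagr υ (Delta f g h r)) j
      + (DD (2, 2, 0) X.W j : ℝ) * dU (2, 2, 0) (lagr υ (Delta f g h r)) j
      + (DD (0, 4, 0) X.W j : ℝ) * dU (0, 4, 0) (lagr υ (Delta f g h r)) j)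
      - X.W j * euler (lagr υ (Delta f g h r)) j := by
  have hL := isDiffFun_lagr hυ (isDiffFun_Delta hf hg hh hr)
  have hl := fun K => hL.dU K
  have hξ' : ∀ i, IsDiffFun fun j => X.xi i j := hξ
  have hL' : IsDiffFun fun j => lagr υ (Delta f g h r) j := hL
  have hDl : ∀ K J, IsDiffFun fun j => DD J (dU K (lagr υ (Delta f g h r))) j :=
    fun K J => (hl K).DD J
  have hDW : ∀ K, IsDiffFun fun j => DD K X.W j := hW.DD
  rw [euler_lagr_Delta hυ hf hg hh hr]
  simp only [div, Fin.sum_univ_three, noether_x X hυ hf hg hh hr, noether_y X hυ hf hg hh hr,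
    noether_t X hυ hf hg hh hr]
  -- By the product rule each summand of the Noether vector gives two terms, one with a further
  -- derivative on `W` and one with it on `∂L/∂u_K`. The intermediate terms cancel and leave the two
  -- ends of the integration by parts. The differentiability side conditions nest as deeply as the
  -- products, whence the discharge depth.
  simp (maxDischargeDepth := 200) only [D_rules, isDiffFun_rules, hξ', hL', hDl, hDW, D_DD hW,
    D_DD (hl _), Nat.reduceAdd]
  simp only [DD, Function.iterate_zero_apply]
  ring

end Noether

end KS

namespace KS

/-! ### Divergence of the Noether vectors of translations and rotation, and the adjoint equation -/

section Noether

variable {f g h r : ℝ → ℝ} {υ : ℝ × ℝ × ℝ → ℂ}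

theorem isDiffFun_noether (X : Generator) {L : Jet → ℂ} (hL : IsDiffFun L)
    (hξ : ∀ i, IsDiffFun (X.xi i)) (hW : IsDiffFun X.W) (i : Fin 3) :
    IsDiffFun (noether X L i) := by
  refine ((hξ i).ofReal.mul hL).add (IsDiffFun.sum fun K _ => (hW.DD K).ofReal.mul
    (IsDiffFun.sum fun J _ => ?_))
  exact (isDiffFun_const (((-1) ^ ord J * ((mult K * mult J / mult (K + J + e i) : ℝ) : ℂ) :
    ℂ))).mul ((hL.dU _).DD J)

theorem iterate_D_coord (i : Fin 3) (M : ℕ × ℕ × ℕ) (n : ℕ) :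
    (D i)^[n] (fun j => j.2 M) = fun j => j.2 (M + n • e i) := by
  induction n with
  | zero => simp
  | succ n ih => rw [Function.iterate_succ_apply', ih, D_coord, succ_nsmul, add_assoc]

theorem iterate_D_neg (i : Fin 3) (F : Jet → ℝ) (n : ℕ) :
    (D i)^[n] (fun j => -F j) = fun j => -(D i)^[n] F j := by
  induction n with
  | zero => rfl
  | succ n ih => rw [Function.iterate_succ_apply', ih, D_neg, Function.iterate_succ_apply']

theorem DD_neg_coord (K M : ℕ × ℕ × ℕ) : DD K (fun j => -j.2 M) = fun j => -j.2 (M + K) := by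
  obtain ⟨a, b, c⟩ := K
  obtain ⟨l, m, n⟩ := M
  simp [DD, iterate_D_neg, iterate_D_coord, e]

theorem D_lagr_Delta (hυ : ContDiff ℝ ∞ υ) (hf : ContDiff ℝ ∞ f) (hg : ContDiff ℝ ∞ g)
    (hh : ContDiff ℝ ∞ h) (hr : ContDiff ℝ ∞ r) (i : Fin 3) (j : Jet) :
    D i (lagr υ (Delta f g h r)) j = pd i υ j.1 * Delta f g h r j
      + υ j.1 * (lineDeriv ℝ (Delta f g h r) j (dir i j) : ℝ) := by
  rw [pd_eqOn_fderiv isOpen_univ hυ.contDiffOn i (Set.mem_univ j.1)]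
  exact lineDeriv_lagr hυ (isDiffFun_Delta hf hg hh hr) j (dir i j)

theorem W_translation (i : Fin 3) : (Generator.translation i).W = fun j => -j.2 (e i) := by
  funext j
  simp [Generator.W, Generator.eta, Generator.xi, Generator.translation]

theorem isDiffFun_xi_translation (i l : Fin 3) : IsDiffFun ((Generator.translation i).xi l) :=
  isDiffFun_const _

theorem isDiffFun_W_translation (i : Fin 3) : IsDiffFun (Generator.translation i).W := by
  rw [W_translation]; exact (isDiffFun_coord _).neg

/-- Here `D_K W = -u_{K + e i}`, so the sum over `K` removes from `D_i (υ Δ)` everything except the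
derivative with respect to the explicit base variable. As `Δ` is autonomous, that derivative is
`(∂_i υ) Δ`. -/
theorem div_noether_translation (i : Fin 3) (hυ : ContDiff ℝ ∞ υ) (hf : ContDiff ℝ ∞ f)
    (hg : ContDiff ℝ ∞ g) (hh : ContDiff ℝ ∞ h) (hr : ContDiff ℝ ∞ r)
    (hE : SolvesAdjoint (Delta f g h r) υ) (j : Jet) :
    div (noether (Generator.translation i) (lagr υ (Delta f g h r))) j =
      pd i υ j.1 * Delta f g h r j := by
  rw [div_noether _ hυ hf hg hh hr (isDiffFun_xi_translation i) (isDiffFun_W_translation i), hE j,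
    mul_zero, sub_zero, W_translation]
  have hD : ∀ l, D l (fun j => ((Generator.translation i).xi l j : ℂ) *
      lagr υ (Delta f g h r) j) j = if l = i then D l (lagr υ (Delta f g h r)) j else 0 := by
    intro l
    by_cases hl : l = i
    · simp [Generator.xi, Generator.translation, hl]
    · simp [Generator.xi, Generator.translation, hl, D_const]
  have hs : D 0 (fun j => ((Generator.translation i).xi 0 j : ℂ) * lagr υ (Delta f g h r) j) j
      + D 1 (fun j => ((Generator.translation i).xi 1 j : ℂ) * lagr υ (Delta f g h r) j) j
      + D 2 (fun j => ((Generator.translation i).xi 2 j : ℂ) * lagr υ (Delta f g h r) j) j =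
      D i (lagr υ (Delta f g h r)) j := by
    rw [hD, hD, hD]
    fin_cases i <;> simp
  rw [hs, D_lagr_Delta hυ hf hg hh hr, lineDeriv_Delta hf hg hh hr]
  simp only [DD_neg_coord, dU_lagr_Delta hυ hf hg hh hr, dir, add_comm _ (e i)]
  push_cast
  ring

theorem W_rotation : Generator.rotation.W =
    fun j => j.1.2.1 * j.2 (1, 0, 0) - j.1.1 * j.2 (0, 1, 0) := by
  funext j
  simp [Generator.W, Generator.eta, Generator.xi, Generator.rotation, Fin.sum_univ_three, e]
  ring

theorem isDiffFun_xi_rotation (i : Fin 3) : IsDiffFun (Generator.rotation.xi i) := by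
  fin_cases i
  · exact isDiffFun_y.neg
  · exact isDiffFun_x
  · exact isDiffFun_const 0

theorem isDiffFun_W_rotation : IsDiffFun Generator.rotation.W := by
  rw [W_rotation]
  exact (isDiffFun_y.mul (isDiffFun_coord _)).sub (isDiffFun_x.mul (isDiffFun_coord _))

/-- The coefficients `(-y, x, 0)` are divergence-free and the prolonged rotation annihilates `Δ`
identically, so only its action on `υ` is left. -/
theorem div_noether_rotation (hυ : ContDiff ℝ ∞ υ) (hf : ContDiff ℝ ∞ f) (hr : ContDiff ℝ ∞ r)
    (hE : SolvesAdjoint (Delta f r (fun _ => 1 / 2) r) υ) (j : Jet) :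
    div (noether Generator.rotation (lagr υ (Delta f r (fun _ => 1 / 2) r))) j =
      (j.1.1 * pd 1 υ j.1 - j.1.2.1 * pd 0 υ j.1) * Delta f r (fun _ => 1 / 2) r j := by
  have hh : ContDiff ℝ ∞ (fun _ : ℝ => (1 / 2 : ℝ)) := contDiff_const
  have hL := isDiffFun_lagr hυ (isDiffFun_Delta hf hr hh hr)
  have hL' : IsDiffFun fun j => lagr υ (Delta f r (fun _ => 1 / 2) r) j := hL
  have hx0 : Generator.rotation.xi 0 = fun j => -j.1.2.1 := rfl
  have hx1 : Generator.rotation.xi 1 = fun j => j.1.1 := rfl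
  have hx2 : Generator.rotation.xi 2 = fun _ => 0 := rfl
  rw [div_noether _ hυ hf hr hh hr isDiffFun_xi_rotation isDiffFun_W_rotation, hE j,
    mul_zero, sub_zero, hx0, hx1, hx2]
  simp only [Complex.ofReal_neg, Complex.ofReal_zero, zero_mul, D_const]
  simp (maxDischargeDepth := 200) only [D_rules, isDiffFun_rules, D_coords, hL']
  -- These are the derivatives of `W` paired with the nine jet variables of the Lagrangian; the
  -- terms beyond `y u_x - x u_y`, differentiated with `x` and `y` frozen, come from the explicit
  -- factors.
  have hDW : (DD (0, 0, 0) Generator.rotation.W j = j.1.2.1 * j.2 (1, 0, 0) - j.1.1 * j.2 (0, 1, 0)) ∧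
      (DD (1, 0, 0) Generator.rotation.W j = j.1.2.1 * j.2 (2, 0, 0) - j.1.1 * j.2 (1, 1, 0)
        - j.2 (0, 1, 0)) ∧
      (DD (0, 1, 0) Generator.rotation.W j = j.1.2.1 * j.2 (1, 1, 0) - j.1.1 * j.2 (0, 2, 0)
        + j.2 (1, 0, 0)) ∧
      (DD (0, 0, 1) Generator.rotation.W j = j.1.2.1 * j.2 (1, 0, 1) - j.1.1 * j.2 (0, 1, 1)) ∧
      (DD (2, 0, 0) Generator.rotation.W j = j.1.2.1 * j.2 (3, 0, 0) - j.1.1 * j.2 (2, 1, 0)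
        - 2 * j.2 (1, 1, 0)) ∧
      (DD (0, 2, 0) Generator.rotation.W j = j.1.2.1 * j.2 (1, 2, 0) - j.1.1 * j.2 (0, 3, 0)
        + 2 * j.2 (1, 1, 0)) ∧
      (DD (4, 0, 0) Generator.rotation.W j = j.1.2.1 * j.2 (5, 0, 0) - j.1.1 * j.2 (4, 1, 0)
        - 4 * j.2 (3, 1, 0)) ∧
      (DD (2, 2, 0) Generator.rotation.W j = j.1.2.1 * j.2 (3, 2, 0) - j.1.1 * j.2 (2, 3, 0)
        + 2 * j.2 (3, 1, 0) - 2 * j.2 (1, 3, 0)) ∧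
      (DD (0, 4, 0) Generator.rotation.W j = j.1.2.1 * j.2 (1, 4, 0) - j.1.1 * j.2 (0, 5, 0)
        + 4 * j.2 (1, 3, 0)) := by
    rw [W_rotation]
    refine ⟨?_, ?_, ?_, ?_, ?_, ?_, ?_, ?_, ?_⟩ <;>
    · simp (maxDischargeDepth := 200) only [DD, Function.iterate_succ_apply',
        Function.iterate_zero_apply, D_coords, Nat.reduceAdd, D_mul, D_sub, D_add, D_const,
        IsDiffFun.mul, IsDiffFun.add, isDiffFun_const, isDiffFun_rules]
      try ring
  simp only [D_lagr_Delta hυ hf hr hh hr, lineDeriv_Delta hf hr hh hr, hDW,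
    dU_lagr_Delta hυ hf hr hh hr, dir, coords, e, Matrix.cons_val_zero, Matrix.cons_val_one,
    Prod.mk_add_mk, Nat.reduceAdd, zero_add, add_zero]
  push_cast
  ring

/-- The two divergences cancel on every jet, so `C + N` is trivial with no part vanishing merely on
shell. -/
theorem builtFrom_of_div {X : Generator} (hυ : ContDiff ℝ ∞ υ) {Δ : Jet → ℝ} (hΔ : IsDiffFun Δ)
    (hX : X.IsSymmetry Δ) (hξ : ∀ i, IsDiffFun (X.xi i)) (hW : IsDiffFun X.W)
    {Q : ℝ × ℝ × ℝ → ℂ} (hN : ∀ j, div (noether X (lagr υ Δ)) j = Q j.1 * Δ j)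
    {C : Fin 3 → Jet → ℂ} (hC : ∀ i, IsDiffFun (C i)) (hdiv : ∀ j, div C j = -(Q j.1 * Δ j)) :
    BuiltFrom Δ υ X C := by
  have hNi := isDiffFun_noether X (isDiffFun_lagr hυ hΔ) hξ hW
  refine ⟨hX, isConserved_of_div hΔ hC hdiv, fun _ _ => 0,
    fun i j => C i j + noether X (lagr υ Δ) i j, fun _ => isDiffFun_const 0,
    fun i => (hC i).add (hNi i), fun _ _ _ => rfl, fun j => ?_, fun i j => by simp⟩
  have h1 := hN j
  have h2 := hdiv j
  simp only [div] at h1 h2 ⊢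
  rw [Finset.sum_congr rfl fun i _ => congrFun (D_add (hC i) (hNi i) i) j, Finset.sum_add_distrib,
    h1, h2, neg_add_cancel]

/-- The multiplier condition for the equations with `r = u / 2 + ρ` and `h = g'`. -/
theorem euler_lagr_of_half (hυ : ContDiff ℝ ∞ υ) (hf : ContDiff ℝ ∞ f) (hg : ContDiff ℝ ∞ g)
    (ρ : ℝ) (j : Jet) :
    euler (lagr υ (Delta f g (deriv g) fun w => w / 2 + ρ)) j =
      υ j.1 * deriv f (u_0 j) + d 0 0 1 υ j.1 + d 2 0 0 υ j.1 * (u_0 j / 2 + ρ)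
      + d 0 2 0 υ j.1 * g (u_0 j) - d 4 0 0 υ j.1 - 2 * d 2 2 0 υ j.1 - d 0 4 0 υ j.1 := by
  have hr : ContDiff ℝ ∞ fun w : ℝ => w / 2 + ρ := by fun_prop
  have hg' : ContDiff ℝ ∞ (deriv g) := ContDiff.deriv' (by simpa using hg)
  have hr' : deriv (fun w : ℝ => w / 2 + ρ) = fun _ => 1 / 2 := by
    funext w; simp
  have hb := isDiffFun_d hυ
  have hυ' := isDiffFun_base hυ
  have hfu := fun {φ : ℝ → ℝ} (hφ : ContDiff ℝ ∞ φ) => isDiffFun_fun_u hφ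
  rw [euler_lagr_Delta hυ hf hg hg' hr]
  simp only [dU_lagr_Delta hυ hf hg hg' hr, coords, hr']
  push_cast
  -- All terms with derivatives of `u` cancel: `u_xx` has the coefficient `2 r' - 1`, `u_yy` has `2
  -- g' - 2 h` and `u_y²` has `g'' - h'`, each times `υ`, while `υ_x u_x` has `2 r' - 1` and `υ_y
  -- u_y` has `2 g' - 2 h`.
  simp (maxDischargeDepth := 200) only [DD, Function.iterate_succ_apply',
    Function.iterate_zero_apply, D_rules, isDiffFun_rules, D_coords, D_fun_u hg, D_fun_u hg',
    Complex.ofReal_mul, hfu hg, hfu hg', hb, hυ', D_d_zero_x (F := υ), D_d_zero_y (F := υ),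
    D_d_zero_t (F := υ), D_d_x hυ, D_d_y hυ, Nat.reduceAdd, e, Matrix.cons_val_zero,
    Matrix.cons_val_one]
  ring

end Noether

end KS

namespace KS

/-! ### Criteria for vectors built from translations -/

section Criteria

variable {f g h r : ℝ → ℝ} {υ : ℝ × ℝ × ℝ → ℂ}

theorem pd_contDiff {F : ℝ × ℝ × ℝ → ℂ} (hF : ContDiff ℝ ∞ F) (i : Fin 3) :
    ContDiff ℝ ∞ (pd i F) :=
  iterate_pd_contDiff hF i 1

theorem contDiff_deriv {g : ℝ → ℝ} (hg : ContDiff ℝ ∞ g) : ContDiff ℝ ∞ (deriv g) :=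
  ContDiff.deriv' (by simpa using hg)

/-- Vectors with the divergence prescribed by a translation. -/
theorem builtFrom_translation (i : Fin 3) (hυ : ContDiff ℝ ∞ υ) (hf : ContDiff ℝ ∞ f)
    (hg : ContDiff ℝ ∞ g) (hh : ContDiff ℝ ∞ h) (hr : ContDiff ℝ ∞ r)
    (hE : SolvesAdjoint (Delta f g h r) υ) {C : Fin 3 → Jet → ℂ} (hC : ∀ i, IsDiffFun (C i))
    (hdiv : ∀ j, div C j = -(pd i υ j.1 * Delta f g h r j)) {a : ℝ × ℝ × ℝ → ℂ} {M N : Jet → ℂ}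
    (hM : IsDiffFun M) (hN : IsDiffFun N)
    (hCQ : ∀ j, C 2 j = a j.1 + pd i υ j.1 * u_0 j + (D 0 M j + D 1 N j)) :
    BuiltFrom (Delta f g h r) υ (Generator.translation i) C ∧
      (¬ IsTrivial (Delta f g h r) C ↔ ∃ p, pd i υ p ≠ 0) := by
  refine ⟨builtFrom_of_div hυ (isDiffFun_Delta hf hg hh hr) (isSymmetry_translation hf hg hh hr i)
    (isDiffFun_xi_translation i) (isDiffFun_W_translation i)
    (div_noether_translation i hυ hf hg hh hr hE) hC hdiv, ?_⟩
  rw [isTrivial_iff (isEvolution_Delta hf hg hh hr) hC (pd_contDiff hυ i).continuous hM hN hCQ hdiv,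
    not_forall]

/-- The vectors of `∂_x`, `∂_y`, `∂_t` for a constant multiplier. -/
theorem isTrivial_noether_const (c : ℂ) (i : Fin 3) (hf : ContDiff ℝ ∞ f) (hg : ContDiff ℝ ∞ g)
    (hh : ContDiff ℝ ∞ h) (hr : ContDiff ℝ ∞ r) (hE : SolvesAdjoint (Delta f g h r) fun _ => c) :
    IsTrivial (Delta f g h r)
      (noether (Generator.translation i) (lagr (fun _ => c) (Delta f g h r))) := by
  refine ⟨fun _ _ => 0, _, fun _ => isDiffFun_const 0, isDiffFun_noether _
    (isDiffFun_lagr contDiff_const (isDiffFun_Delta hf hg hh hr)) (isDiffFun_xi_translation i)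
    (isDiffFun_W_translation i), fun _ _ _ => rfl, fun j => ?_, fun _ _ => (zero_add _).symm⟩
  rw [div_noether_translation i contDiff_const hf hg hh hr hE, pd_const, zero_mul]

end Criteria

/-! ### Iterated partial derivatives of functions of the base point -/

section Derivatives

variable {F G : ℝ × ℝ × ℝ → ℂ}

theorem d_contDiff (hF : ContDiff ℝ ∞ F) (a b c : ℕ) : ContDiff ℝ ∞ (d a b c F) :=
  contDiffOn_univ.1 (d_contDiffOn isOpen_univ hF.contDiffOn a b c)

theorem iterate_pd_d (hF : ContDiff ℝ ∞ F) (i : Fin 3) (n : ℕ) (K : ℕ × ℕ × ℕ) :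
    (pd i)^[n] (d K.1 K.2.1 K.2.2 F) =
      d (K + n • e i).1 (K + n • e i).2.1 (K + n • e i).2.2 F := by
  induction n with
  | zero => simp
  | succ n ih => rw [Function.iterate_succ_apply', ih, pd_d_eq hF, succ_nsmul, add_assoc]

theorem d_d (hF : ContDiff ℝ ∞ F) (a b c k l m : ℕ) :
    d a b c (d k l m F) = d (k + a) (l + b) (m + c) F := by
  rw [d, iterate_pd_d hF 2 c (k, l, m), iterate_pd_d hF, iterate_pd_d hF]
  simp [e]

theorem iterate_pd_const_mul (hF : ContDiff ℝ ∞ F) (k : ℂ) (i : Fin 3) (n : ℕ) :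
    (pd i)^[n] (fun p => k * F p) = fun p => k * (pd i)^[n] F p := by
  induction n with
  | zero => rfl
  | succ n ih =>
    funext p
    rw [Function.iterate_succ_apply', ih, Function.iterate_succ_apply']
    exact HasLineDerivAt.lineDeriv (HasDerivAt.const_mul k
      (((iterate_pd_contDiff hF i n).differentiable (by simp) p).lineDifferentiableAt
        (v := ev i)).hasLineDerivAt)

theorem d_const_mul (hF : ContDiff ℝ ∞ F) (k : ℂ) (a b c : ℕ) :
    d a b c (fun p => k * F p) = fun p => k * d a b c F p := by
  have h2 := iterate_pd_contDiff hF 2 c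
  rw [d, iterate_pd_const_mul hF, iterate_pd_const_mul h2,
    iterate_pd_const_mul (iterate_pd_contDiff h2 1 b)]
  rfl

end Derivatives

/-! ### Quadratic source and affine `g`: reduction by the linear system and the divergences -/

namespace Case1

variable {α β γ δ ε ζ : ℝ} {F : ℝ × ℝ × ℝ → ℂ}

/-- The differentiated first equation of the system, used as a rewriting rule that lowers the
`x`-order by two until it is at most one. -/
theorem System.d_xx (hF : ContDiff ℝ ∞ F) (h : System α β γ δ ε F) (a b c : ℕ) (p : ℝ × ℝ × ℝ) :
    d (a + 2) b c F p = -4 * δ * d a b c F p - 2 * β * d a (b + 2) c F p := by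
  have h1 : d 2 0 0 F = fun p => (-4 * δ : ℂ) * F p + (-2 * β : ℂ) * d 0 2 0 F p := by
    funext p
    linear_combination 2 * (h p).1
  have h2 := d_d hF a b c 2 0 0
  rw [h1, d_add (contDiff_const.mul hF) (contDiff_const.mul (d_contDiff hF 0 2 0)),
    d_const_mul hF, d_const_mul (d_contDiff hF 0 2 0), d_d hF] at h2
  simp only [zero_add] at h2
  rw [add_comm a, ← h2, add_comm b]
  ring

/-- The differentiated second equation, used as a rewriting rule that removes `t`-derivatives. -/
theorem System.d_t (hF : ContDiff ℝ ∞ F) (h : System α β γ δ ε F) (a b c : ℕ) (p : ℝ × ℝ × ℝ) :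
    d a b (c + 1) F p = -ε * d a b c F p - γ * d a (b + 2) c F p + d a (b + 4) c F p
      - α * d (a + 2) b c F p + 2 * d (a + 2) (b + 2) c F p + d (a + 4) b c F p := by
  have hd := fun k l => d_contDiff hF k l 0
  have hm := fun (k : ℂ) {G : ℝ × ℝ × ℝ → ℂ} (hG : ContDiff ℝ ∞ G) =>
    (contDiff_const (c := k)).mul hG
  have h1 : d 0 0 1 F = fun p => (-ε : ℂ) * F p + ((-γ : ℂ) * d 0 2 0 F p + (d 0 4 0 F p
      + ((-α : ℂ) * d 2 0 0 F p + ((2 : ℂ) * d 2 2 0 F p + d 4 0 0 F p)))) := by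
    funext p
    linear_combination (h p).2
  have h2 := d_d hF a b c 0 0 1
  rw [h1, d_add (hm _ hF) ((hm _ (hd 0 2)).add ((hd 0 4).add ((hm _ (hd 2 0)).add
      ((hm _ (hd 2 2)).add (hd 4 0))))),
    d_add (hm _ (hd 0 2)) ((hd 0 4).add ((hm _ (hd 2 0)).add ((hm _ (hd 2 2)).add (hd 4 0)))),
    d_add (hd 0 4) ((hm _ (hd 2 0)).add ((hm _ (hd 2 2)).add (hd 4 0))),
    d_add (hm _ (hd 2 0)) ((hm _ (hd 2 2)).add (hd 4 0)), d_add (hm _ (hd 2 2)) (hd 4 0),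
    d_const_mul hF, d_const_mul (hd 0 2), d_const_mul (hd 2 0), d_const_mul (hd 2 2)] at h2
  simp only [d_d hF, zero_add] at h2
  rw [add_comm c, ← h2, add_comm a, add_comm a, add_comm b, add_comm b]
  ring

/-- Here `h = β` is the derivative of `g`, so the general formula for the adjoint equation applies.
-/
theorem eqn_eq : eqn α β γ δ ε ζ = Delta (fun w => δ * w ^ 2 + ε * w + ζ) (fun w => β * w + γ)
    (deriv fun w => β * w + γ) fun w => w / 2 + α := by
  have : (deriv fun w : ℝ => β * w + γ) = fun _ => β := by
    funext w
    simp
  rw [this, eqn]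

theorem solvesAdjoint (hF : ContDiff ℝ ∞ F) (hS : System α β γ δ ε F) :
    SolvesAdjoint (eqn α β γ δ ε ζ) F := by
  intro j
  have hf : (deriv fun w : ℝ => δ * w ^ 2 + ε * w + ζ) = fun w => 2 * δ * w + ε := by
    funext w
    have h := ((((hasDerivAt_id w).fun_pow 2).const_mul δ).add
      ((hasDerivAt_id w).const_mul ε)).add_const ζ
    refine h.deriv.trans ?_
    simp
    ring
  rw [eqn_eq, euler_lagr_of_half hF (by fun_prop) (by fun_prop), hf]
  push_cast
  -- The adjoint expression is affine in `u`: the first equation of the system is the coefficient of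
  -- `u`, the second is the constant term.
  linear_combination (u_0 j : ℂ) * (hS j.1).1 + (hS j.1).2

section Divergence

theorem div_Ct (hF : ContDiff ℝ ∞ F) (hS : System α β γ δ ε F) (j : Jet) :
    div (Ct α β γ δ ζ F) j = -(d 0 0 1 F j.1 * eqn α β γ δ ε ζ j) := by
  simp only [div, Fin.sum_univ_three, Ct, eqn, Delta, Matrix.cons_val_zero, Matrix.cons_val_one,
    Matrix.cons_val, coords]
  simp (maxDischargeDepth := 200) only [D_rules, isDiffFun_rules, D_coords, D_d_x hF, D_d_y hF,
    D_d_t hF, D_d_zero_t (F := F), isDiffFun_d hF, isDiffFun_base hF, Nat.reduceAdd]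
  -- After both reductions only `y`-derivatives of `F` and of `F_x` remain. They enter as
  -- independent symbols, and the identity is polynomial in them and in the jet coordinates.
  simp only [hS.d_t hF, hS.d_xx hF, d_zero_order, Nat.reduceAdd]
  push_cast
  ring

theorem div_Cx (hF : ContDiff ℝ ∞ F) (hS : System α β γ δ ε F) (j : Jet) :
    div (Cx α β γ δ ε ζ F) j = -(d 1 0 0 F j.1 * eqn α β γ δ ε ζ j) := by
  simp only [div, Fin.sum_univ_three, Cx, eqn, Delta, Matrix.cons_val_zero, Matrix.cons_val_one,
    Matrix.cons_val, coords]
  simp (maxDischargeDepth := 200) only [D_rules, isDiffFun_rules, D_coords, D_d_x hF, D_d_y hF,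
    D_d_zero_x (F := F), D_d_zero_y (F := F), D_d_zero_t (F := F), isDiffFun_d hF,
    isDiffFun_base hF, Nat.reduceAdd]
  simp only [hS.d_t hF, hS.d_xx hF, d_zero_order, Nat.reduceAdd]
  push_cast
  ring

theorem div_Cy (hF : ContDiff ℝ ∞ F) (hS : System α β γ δ ε F) (j : Jet) :
    div (Cy α β γ δ ε ζ F) j = -(d 0 1 0 F j.1 * eqn α β γ δ ε ζ j) := by
  simp only [div, Fin.sum_univ_three, Cy, eqn, Delta, Matrix.cons_val_zero, Matrix.cons_val_one,
    Matrix.cons_val, coords]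
  simp (maxDischargeDepth := 200) only [D_rules, isDiffFun_rules, D_coords, D_d_x hF, D_d_y hF,
    D_d_zero_x (F := F), D_d_zero_y (F := F), D_d_zero_t (F := F), isDiffFun_d hF,
    isDiffFun_base hF, Nat.reduceAdd]
  simp only [hS.d_t hF, hS.d_xx hF, d_zero_order, Nat.reduceAdd]
  push_cast
  ring

theorem div_Crot (hF : ContDiff ℝ ∞ F) (hS : System α (1 / 2) α δ ε F) (j : Jet) :
    div (Crot α δ ε ζ F) j = -((j.1.1 * d 0 1 0 F j.1 - j.1.2.1 * d 1 0 0 F j.1) *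
      eqn α (1 / 2) α δ ε ζ j) := by
  simp only [div, Fin.sum_univ_three, Crot, eqn, Delta, Matrix.cons_val_zero, Matrix.cons_val_one,
    Matrix.cons_val, coords]
  simp (maxDischargeDepth := 200) only [D_rules, isDiffFun_rules, D_coords, D_d_x hF, D_d_y hF,
    D_d_zero_x (F := F), D_d_zero_y (F := F), D_d_zero_t (F := F), isDiffFun_d hF,
    isDiffFun_base hF, Nat.reduceAdd]
  simp only [hS.d_t hF, hS.d_xx hF, d_zero_order, Nat.reduceAdd]
  push_cast
  ring

end Divergence

end Case1

end KS

namespace KS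

/-! ### Quadratic source and affine `g`: conserved vectors and their nontriviality -/

namespace Case1

variable {α β γ δ ε ζ : ℝ} {F : ℝ × ℝ × ℝ → ℂ}

section Vectors

theorem isDiffFun_Ct (hF : ContDiff ℝ ∞ F) (i : Fin 3) : IsDiffFun (Ct α β γ δ ζ F i) := by
  fin_cases i <;> simp (maxDischargeDepth := 200) only [Ct, Fin.zero_eta, Fin.mk_one,
    Fin.reduceFinMk, Matrix.cons_val, coords, isDiffFun_rules, isDiffFun_d hF, isDiffFun_base hF]

theorem isDiffFun_Cx (hF : ContDiff ℝ ∞ F) (i : Fin 3) : IsDiffFun (Cx α β γ δ ε ζ F i) := by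
  fin_cases i <;> simp (maxDischargeDepth := 200) only [Cx, Fin.zero_eta, Fin.mk_one,
    Fin.reduceFinMk, Matrix.cons_val, coords, isDiffFun_rules, isDiffFun_d hF, isDiffFun_base hF]

theorem isDiffFun_Cy (hF : ContDiff ℝ ∞ F) (i : Fin 3) : IsDiffFun (Cy α β γ δ ε ζ F i) := by
  fin_cases i <;> simp (maxDischargeDepth := 200) only [Cy, Fin.zero_eta, Fin.mk_one,
    Fin.reduceFinMk, Matrix.cons_val, coords, isDiffFun_rules, isDiffFun_d hF, isDiffFun_base hF]

theorem isDiffFun_Crot (hF : ContDiff ℝ ∞ F) (i : Fin 3) : IsDiffFun (Crot α δ ε ζ F i) := by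
  fin_cases i <;> simp (maxDischargeDepth := 200) only [Crot, Fin.zero_eta, Fin.mk_one,
    Fin.reduceFinMk, Matrix.cons_val, coords, isDiffFun_rules, isDiffFun_d hF, isDiffFun_base hF]

theorem builtFrom_Ct (hF : ContDiff ℝ ∞ F) (hS : System α β γ δ ε F) :
    BuiltFrom (eqn α β γ δ ε ζ) F (Generator.translation 2) (Ct α β γ δ ζ F) ∧
      (¬ IsTrivial (eqn α β γ δ ε ζ) (Ct α β γ δ ζ F) ↔ ∃ p, d 0 0 1 F p ≠ 0) := by
  -- The third component already has the form `a + F_t u`, with no spatial divergence to split off.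
  refine builtFrom_translation (a := fun p => -ζ * F p) 2 hF (by fun_prop) (by fun_prop)
    (by fun_prop) (by fun_prop) (solvesAdjoint hF hS) (isDiffFun_Ct hF) (div_Ct hF hS)
    (isDiffFun_const 0) (isDiffFun_const 0) fun j => ?_
  simp only [D_const, Ct, Matrix.cons_val]
  change _ = _ + d 0 0 1 F j.1 * _ + _
  ring

theorem builtFrom_Cx (hF : ContDiff ℝ ∞ F) (hS : System α β γ δ ε F) :
    BuiltFrom (eqn α β γ δ ε ζ) F (Generator.translation 0) (Cx α β γ δ ε ζ F) ∧
      (¬ IsTrivial (eqn α β γ δ ε ζ) (Cx α β γ δ ε ζ F) ↔ ∃ p, d 1 0 0 F p ≠ 0) := by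
  -- The density is rewritten by `-F u_x = F_x u + D_x (-F u)`, which exposes the characteristic
  -- `F_x`.
  refine builtFrom_translation (a := fun _ => 0) 0 hF (by fun_prop) (by fun_prop)
    (by fun_prop) (by fun_prop) (solvesAdjoint hF hS) (isDiffFun_Cx hF) (div_Cx hF hS)
    (((isDiffFun_base hF).mul (isDiffFun_coord (0, 0, 0)).ofReal).neg) (isDiffFun_const 0)
    fun j => ?_
  simp (maxDischargeDepth := 200) only [D_rules, isDiffFun_rules, D_coords, isDiffFun_base hF,
    D_d_zero_x (F := F), Cx, Matrix.cons_val, coords, Nat.reduceAdd]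
  change _ = _ + d 1 0 0 F j.1 * _ + _
  ring

theorem builtFrom_Cy (hF : ContDiff ℝ ∞ F) (hS : System α β γ δ ε F) :
    BuiltFrom (eqn α β γ δ ε ζ) F (Generator.translation 1) (Cy α β γ δ ε ζ F) ∧
      (¬ IsTrivial (eqn α β γ δ ε ζ) (Cy α β γ δ ε ζ F) ↔ ∃ p, d 0 1 0 F p ≠ 0) := by
  -- Likewise `-F u_y = F_y u + D_y (-F u)`.
  refine builtFrom_translation (a := fun _ => 0) 1 hF (by fun_prop) (by fun_prop)
    (by fun_prop) (by fun_prop) (solvesAdjoint hF hS) (isDiffFun_Cy hF) (div_Cy hF hS)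
    (isDiffFun_const 0) (((isDiffFun_base hF).mul (isDiffFun_coord (0, 0, 0)).ofReal).neg)
    fun j => ?_
  simp (maxDischargeDepth := 200) only [D_rules, isDiffFun_rules, D_coords, isDiffFun_base hF,
    D_d_zero_y (F := F), Cy, Matrix.cons_val, coords, Nat.reduceAdd]
  change _ = _ + d 0 1 0 F j.1 * _ + _
  ring

end Vectors

section Rotation

theorem fderiv_rotation_eq (hF : ContDiff ℝ ∞ F) (p : ℝ × ℝ × ℝ) (v : ℝ × ℝ × ℝ) :
    fderiv ℝ F p v = v.1 * d 1 0 0 F p + v.2.1 * d 0 1 0 F p + v.2.2 * d 0 0 1 F p := by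
  have hd : DifferentiableAt ℝ F p := hF.differentiable (by simp) p
  have hv : v = v.1 • ev 0 + v.2.1 • ev 1 + v.2.2 • ev 2 := by simp [ev]
  have h (i : Fin 3) : fderiv ℝ F p (ev i) = pd i F p := hd.lineDeriv_eq_fderiv.symm
  conv_lhs => rw [hv]
  simp only [map_add, map_smul, h, Complex.real_smul]
  rfl

/-- Along an orbit of the rotation group the derivative of `F` is the field `x ∂_y - y ∂_x` applied
to `F`. -/
theorem hasDerivAt_comp_rotation (hF : ContDiff ℝ ∞ F) (x y t θ : ℝ) :
    HasDerivAt (fun θ : ℝ => F (x * Real.cos θ - y * Real.sin θ, x * Real.sin θ + y * Real.cos θ, t))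
      (((x * Real.cos θ - y * Real.sin θ : ℝ) : ℂ) *
          d 0 1 0 F (x * Real.cos θ - y * Real.sin θ, x * Real.sin θ + y * Real.cos θ, t) -
        ((x * Real.sin θ + y * Real.cos θ : ℝ) : ℂ) *
          d 1 0 0 F (x * Real.cos θ - y * Real.sin θ, x * Real.sin θ + y * Real.cos θ, t)) θ := by
  have hc := Real.hasDerivAt_cos θ
  have hs := Real.hasDerivAt_sin θ
  have h1 := ((hc.const_mul x).sub (hs.const_mul y)).prodMk
    (((hs.const_mul x).add (hc.const_mul y)).prodMk (hasDerivAt_const θ t))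
  have hd : DifferentiableAt ℝ F
    (x * Real.cos θ - y * Real.sin θ, x * Real.sin θ + y * Real.cos θ, t) :=
      hF.differentiable (by simp) _
  refine (hd.hasFDerivAt.comp_hasDerivAt θ h1).congr_deriv ?_
  rw [fderiv_rotation_eq hF]
  push_cast
  ring

/-- The functions annihilated by `x ∂_y - y ∂_x`. -/
theorem rotation_eq_zero_iff (hF : ContDiff ℝ ∞ F) :
    (∀ p : ℝ × ℝ × ℝ, p.1 * d 0 1 0 F p - p.2.1 * d 1 0 0 F p = 0) ↔
      ∃ H : ℝ → ℝ → ℂ, ∀ x y t : ℝ, F (x, y, t) = H (x ^ 2 + y ^ 2) t := by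
  constructor
  · intro h
    -- `F` is constant on each circle, so its value can be read off on the half-axis `x ≥ 0`, `y =
    -- 0`. The complex argument supplies the angle, and the origin needs no separate treatment.
    refine ⟨fun s t => F (√s, 0, t), fun x y t => ?_⟩
    set ρ := √(x ^ 2 + y ^ 2) with hρ
    have hz : ‖(⟨x, y⟩ : ℂ)‖ = ρ := by rw [Complex.norm_def, Complex.normSq_mk, hρ]; ring_nf
    have hx : ρ * Real.cos (Complex.arg ⟨x, y⟩) = x := by rw [← hz, Complex.norm_mul_cos_arg]
    have hy : ρ * Real.sin (Complex.arg ⟨x, y⟩) = y := by rw [← hz, Complex.norm_mul_sin_arg]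
    have hconst := is_const_of_deriv_eq_zero
      (f := fun θ : ℝ => F (ρ * Real.cos θ - 0 * Real.sin θ, ρ * Real.sin θ + 0 * Real.cos θ, t))
      (fun θ => (hasDerivAt_comp_rotation hF ρ 0 t θ).differentiableAt)
      (fun θ => by
        rw [(hasDerivAt_comp_rotation hF ρ 0 t θ).deriv]
        exact h (_, _, t)) (Complex.arg ⟨x, y⟩) 0
    simpa [hx, hy] using hconst
  · rintro ⟨H, hH⟩ ⟨x, y, t⟩
    -- Conversely, a radial function is constant along the orbit, and at angle zero the orbit
    -- derivative is the required expression.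
    have h := hasDerivAt_comp_rotation hF x y t 0
    have hc : (fun θ : ℝ =>
        F (x * Real.cos θ - y * Real.sin θ, x * Real.sin θ + y * Real.cos θ, t)) =
          fun _ => H (x ^ 2 + y ^ 2) t := by
      funext θ
      rw [hH]
      congr 1
      linear_combination (x ^ 2 + y ^ 2) * Real.sin_sq_add_cos_sq θ
    rw [hc] at h
    simpa using (h.unique (hasDerivAt_const _ _))

theorem builtFrom_Crot (hF : ContDiff ℝ ∞ F) (hS : System α (1 / 2) α δ ε F) :
    BuiltFrom (eqn α (1 / 2) α δ ε ζ) F Generator.rotation (Crot α δ ε ζ F) ∧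
      (¬ IsTrivial (eqn α (1 / 2) α δ ε ζ) (Crot α δ ε ζ F) ↔
        ¬ ∃ H : ℝ → ℝ → ℂ, ∀ x y t : ℝ, F (x, y, t) = H (x ^ 2 + y ^ 2) t) := by
  have heq : eqn α (1 / 2) α δ ε ζ = Delta (fun w => δ * w ^ 2 + ε * w + ζ) (fun w => w / 2 + α)
      (fun _ => 1 / 2) fun w => w / 2 + α := by
    have : (fun w : ℝ => 1 / 2 * w + α) = fun w => w / 2 + α := by
      funext w
      ring
    rw [eqn, this]
  have hE := solvesAdjoint (ζ := ζ) hF hS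
  have hdiv := div_Crot (ζ := ζ) hF hS
  have hf : ContDiff ℝ ∞ fun w : ℝ => δ * w ^ 2 + ε * w + ζ := by fun_prop
  have hr : ContDiff ℝ ∞ fun w : ℝ => w / 2 + α := by fun_prop
  have hh : ContDiff ℝ ∞ fun _ : ℝ => (1 / 2 : ℝ) := contDiff_const
  have hFc := isDiffFun_base hF
  rw [heq] at hE ⊢
  simp only [heq] at hdiv
  refine ⟨builtFrom_of_div (Q := fun p => p.1 * d 0 1 0 F p - p.2.1 * d 1 0 0 F p) hF
    (isDiffFun_Delta hf hr hh hr) (isSymmetry_rotation hf hr) isDiffFun_xi_rotation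
    isDiffFun_W_rotation (div_noether_rotation hF hf hr hE) (isDiffFun_Crot hF) hdiv, ?_⟩
  rw [← rotation_eq_zero_iff hF]
  -- The density satisfies `F (y u_x - x u_y) = (x F_y - y F_x) u + D_x (y F u) + D_y (-x F u)`.
  refine not_congr (isTrivial_iff (a := fun _ => 0)
    (M := fun j => j.1.2.1 * (F j.1 * j.2 (0, 0, 0))) (N := fun j => -(j.1.1 * (F j.1 * j.2 (0, 0, 0))))
    (isEvolution_Delta hf hr hh hr)
    (isDiffFun_Crot hF) ?_ ?_ ?_ (fun j => ?_) hdiv)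
  · have h1 := (d_contDiff hF 0 1 0).continuous
    have h2 := (d_contDiff hF 1 0 0).continuous
    fun_prop
  · simp (maxDischargeDepth := 200) only [isDiffFun_rules, hFc]
  · simp (maxDischargeDepth := 200) only [isDiffFun_rules, hFc]
  · simp (maxDischargeDepth := 200) only [D_rules, isDiffFun_rules, D_coords, hFc,
      D_d_zero_x (F := F), D_d_zero_y (F := F), Crot, Matrix.cons_val, coords, Nat.reduceAdd]
    push_cast
    ring

end Rotation

end Case1

/-! ### Constant multipliers -/

section QuasiSelfAdjoint

/-- With a constant source and a constant multiplier every term of the reduced adjoint expression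
contains `f'` or a derivative of the multiplier. -/
theorem solvesAdjoint_const (α β : ℝ) {g : ℝ → ℝ} (hg : ContDiff ℝ ∞ g) (c : ℂ) :
    SolvesAdjoint (Delta (fun _ => α) g (deriv g) (fun w => w / 2 + β)) (fun _ => c) := by
  intro j
  rw [euler_lagr_of_half contDiff_const contDiff_const hg]
  have h (i : Fin 3) (n : ℕ) : (pd i)^[n] (fun _ : ℝ × ℝ × ℝ => (0 : ℂ)) = fun _ => 0 :=
    Function.iterate_fixed (pd_const i (0 : ℂ)) n
  simp [d, pd_const, h]

end QuasiSelfAdjoint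

end KS

namespace KS

/-! ### Exponential, trigonometric and affine functions: partial derivatives and independence -/

section BaseFunctions

/-- `F` is smooth with the partial derivatives `Fx`, `Fy`, `Ft`. -/
structure HasPartials (F Fx Fy Ft : ℝ × ℝ × ℝ → ℂ) : Prop where
  contDiff : ContDiff ℝ ∞ F
  x : pd 0 F = Fx
  y : pd 1 F = Fy
  t : pd 2 F = Ft

variable {F Fx Fy Ft : ℝ × ℝ × ℝ → ℂ}

/-- A line derivative along a coordinate direction is a one-variable derivative, so the partials can
be computed one variable at a time. -/
theorem hasPartials_of_hasDerivAt (hF : ContDiff ℝ ∞ F)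
    (hx : ∀ x y t, HasDerivAt (fun s : ℝ => F (s, y, t)) (Fx (x, y, t)) x)
    (hy : ∀ x y t, HasDerivAt (fun s : ℝ => F (x, s, t)) (Fy (x, y, t)) y)
    (ht : ∀ x y t, HasDerivAt (fun s : ℝ => F (x, y, s)) (Ft (x, y, t)) t) :
    HasPartials F Fx Fy Ft := by
  refine ⟨hF, ?_, ?_, ?_⟩ <;> funext ⟨x, y, t⟩ <;> refine HasLineDerivAt.lineDeriv ?_ <;>
    simp only [HasLineDerivAt, ev, Matrix.cons_val, Prod.smul_mk, smul_eq_mul, mul_one, mul_zero,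
      Prod.mk_add_mk, add_zero]
  · exact HasDerivAt.comp_const_add (f := fun s => F (s, y, t)) x 0 (by simpa using hx x y t)
  · exact HasDerivAt.comp_const_add (f := fun s => F (x, s, t)) y 0 (by simpa using hy x y t)
  · exact HasDerivAt.comp_const_add (f := fun s => F (x, y, s)) t 0 (by simpa using ht x y t)

theorem HasPartials.isDiffFun (h : HasPartials F Fx Fy Ft) : IsDiffFun fun j : Jet => F j.1 :=
  isDiffFun_base h.contDiff

theorem HasPartials.D (h : HasPartials F Fx Fy Ft) :
    (D 0 (fun j : Jet => F j.1) = fun j => Fx j.1) ∧ (D 1 (fun j : Jet => F j.1) = fun j => Fy j.1) ∧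
      D 2 (fun j : Jet => F j.1) = fun j => Ft j.1 :=
  ⟨congrArg (fun G (j : Jet) => G j.1) h.x, congrArg (fun G (j : Jet) => G j.1) h.y,
    congrArg (fun G (j : Jet) => G j.1) h.t⟩

theorem pd_const_mul (i : Fin 3) (k : ℂ) (F : ℝ × ℝ × ℝ → ℂ) :
    pd i (fun p => k * F p) = fun p => k * pd i F p := by
  funext p
  exact deriv_const_mul_field k

theorem pd_neg (i : Fin 3) (F : ℝ × ℝ × ℝ → ℂ) : pd i (fun p => -F p) = fun p => -pd i F p := by
  funext p
  exact deriv.fun_neg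

theorem pd_mul (i : Fin 3) {F G : ℝ × ℝ × ℝ → ℂ} (hF : ContDiff ℝ ∞ F) (hG : ContDiff ℝ ∞ G) :
    pd i (fun p => F p * G p) = fun p => pd i F p * G p + F p * pd i G p := by
  funext p
  have h {H : ℝ × ℝ × ℝ → ℂ} (hH : ContDiff ℝ ∞ H) : HasLineDerivAt ℝ H (pd i H p) p (ev i) :=
    (((hH.differentiable (by simp)) p).lineDifferentiableAt).hasLineDerivAt
  refine HasLineDerivAt.lineDeriv ((HasDerivAt.mul (h hF) (h hG)).congr_deriv ?_)
  simp

/-- Products with an exponential function of `t`. -/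
theorem HasPartials.exp_mul {ex : ℝ × ℝ × ℝ → ℂ} {ρ : ℂ}
    (hex : HasPartials ex (fun _ => 0) (fun _ => 0) fun p => ρ * ex p)
    (h : HasPartials F Fx Fy fun _ => 0) :
    HasPartials (fun p => ex p * F p) (fun p => ex p * Fx p) (fun p => ex p * Fy p)
      fun p => ρ * (ex p * F p) := by
  refine ⟨hex.contDiff.mul h.contDiff, ?_, ?_, ?_⟩ <;>
    simp only [pd_mul _ hex.contDiff h.contDiff, hex.x, hex.y, hex.t, h.x, h.y, h.t] <;>
    funext p <;> ring

@[fun_prop]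
theorem contDiff_ofReal_comp {E : Type*} [NormedAddCommGroup E] [NormedSpace ℝ E] {f : E → ℝ}
    (hf : ContDiff ℝ ∞ f) : ContDiff ℝ ∞ fun p => (f p : ℂ) :=
  Complex.ofRealCLM.contDiff.comp hf

@[fun_prop]
theorem contDiff_cos_comp {E : Type*} [NormedAddCommGroup E] [NormedSpace ℝ E] {f : E → ℂ}
    (hf : ContDiff ℝ ∞ f) : ContDiff ℝ ∞ fun p => Complex.cos (f p) :=
  (Complex.contDiff_cos.restrict_scalars ℝ).comp hf

@[fun_prop]
theorem contDiff_sin_comp {E : Type*} [NormedAddCommGroup E] [NormedSpace ℝ E] {f : E → ℂ}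
    (hf : ContDiff ℝ ∞ f) : ContDiff ℝ ∞ fun p => Complex.sin (f p) :=
  (Complex.contDiff_sin.restrict_scalars ℝ).comp hf

theorem hasDerivAt_exp_mul (k : ℂ) (x : ℝ) :
    HasDerivAt (fun s : ℝ => Complex.exp (k * s)) (k * Complex.exp (k * x)) x :=
  (((hasDerivAt_id (x : ℂ)).const_mul k).cexp.congr_deriv (by simp [mul_comm])).comp_ofReal

theorem hasDerivAt_cos_mul (k : ℂ) (x : ℝ) :
    HasDerivAt (fun s : ℝ => Complex.cos (k * s)) (-(k * Complex.sin (k * x))) x :=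
  (((hasDerivAt_id (x : ℂ)).const_mul k).ccos.congr_deriv (by simp [mul_comm])).comp_ofReal

theorem hasDerivAt_sin_mul (k : ℂ) (x : ℝ) :
    HasDerivAt (fun s : ℝ => Complex.sin (k * s)) (k * Complex.cos (k * x)) x :=
  (((hasDerivAt_id (x : ℂ)).const_mul k).csin.congr_deriv (by simp [mul_comm])).comp_ofReal

theorem hasPartials_exp (ρ : ℂ) :
    HasPartials (fun p => Complex.exp (ρ * p.2.2)) (fun _ => 0) (fun _ => 0)
      fun p => ρ * Complex.exp (ρ * p.2.2) :=
  hasPartials_of_hasDerivAt (ContDiff.cexp (by fun_prop)) (fun x _ t => hasDerivAt_const x (Complex.exp (ρ * t)))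
    (fun _ y t => hasDerivAt_const y (Complex.exp (ρ * t))) fun _ _ t => hasDerivAt_exp_mul ρ t

theorem hasDerivAt_affine (k l : ℂ) (x : ℝ) : HasDerivAt (fun s : ℝ => k + l * s) l x :=
  (((Complex.ofRealCLM.hasDerivAt (x := x)).const_mul l).const_add k).congr_deriv (by simp)

theorem hasDerivAt_linear_add (k l : ℂ) (x : ℝ) : HasDerivAt (fun s : ℝ => k * s + l) k x :=
  (((Complex.ofRealCLM.hasDerivAt (x := x)).const_mul k).add_const l).congr_deriv (by simp)

/-- The value and the derivative at the origin determine both coefficients; this needs `k ≠ 0` but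
no reality of `k`. -/
theorem eq_zero_of_cos_add_sin {k l m : ℂ} (hk : k ≠ 0)
    (h : ∀ x : ℝ, l * Complex.cos (k * x) + m * Complex.sin (k * x) = 0) : l = 0 ∧ m = 0 := by
  refine ⟨by simpa using h 0, ?_⟩
  have h1 := ((hasDerivAt_cos_mul k 0).const_mul l).add ((hasDerivAt_sin_mul k 0).const_mul m)
  have h2 : (fun s : ℝ => l * Complex.cos (k * s)) + (fun s : ℝ => m * Complex.sin (k * s)) =
    fun _ => 0 := funext h
  rw [h2] at h1
  simpa [hk] using h1.unique (hasDerivAt_const _ _)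

/-- Independence in `x` for each fixed `y` makes both inner combinations vanish, and independence in
`y` then gives the constants. -/
theorem eq_zero_of_trig {a b k₁ k₂ k₃ k₄ : ℂ} (ha : a ≠ 0) (hb : b ≠ 0)
    (h : ∀ x y : ℝ, Complex.cos (a * x) * (k₁ * Complex.cos (b * y) + k₃ * Complex.sin (b * y)) +
      Complex.sin (a * x) * (k₂ * Complex.cos (b * y) + k₄ * Complex.sin (b * y)) = 0) :
    k₁ = 0 ∧ k₂ = 0 ∧ k₃ = 0 ∧ k₄ = 0 := by
  have h1 := fun y : ℝ => eq_zero_of_cos_add_sin ha fun x => by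
    rw [← h x y, mul_comm, add_right_inj, mul_comm]
  have h2 := eq_zero_of_cos_add_sin hb fun y => (h1 y).1
  have h3 := eq_zero_of_cos_add_sin hb fun y => (h1 y).2
  exact ⟨h2.1, h3.1, h2.2, h3.2⟩

theorem eq_zero_of_affine {k l : ℂ} (h : ∀ x : ℝ, k + l * x = 0) : k = 0 ∧ l = 0 := by
  have h0 : k = 0 := by simpa using h 0
  exact ⟨h0, by simpa [h0] using h 1⟩

theorem contDiff_of_hasDerivAt {G g : ℝ → ℝ} (hg : ContDiff ℝ ∞ g) (h : ∀ w, HasDerivAt G (g w) w) :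
    ContDiff ℝ ∞ G := by
  have hd : deriv G = g := funext fun w => (h w).deriv
  exact contDiff_infty_iff_deriv.2 ⟨fun w => (h w).differentiableAt, hd ▸ hg⟩

/-- For the equations whose source does not involve `∫ g du`, an antiderivative is still needed to
write `g(u) u_y` as a total `y`-derivative. -/
theorem exists_antideriv {g : ℝ → ℝ} (hg : ContDiff ℝ ∞ g) :
    ∃ G : ℝ → ℝ, ∀ w, HasDerivAt G (g w) w :=
  ⟨fun w => ∫ s in (0 : ℝ)..w, g s, fun w => intervalIntegral.integral_hasDerivAt_right
    (hg.continuous.intervalIntegrable 0 w) (hg.continuous.stronglyMeasurableAtFilter _ _)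
    hg.continuous.continuousAt⟩

end BaseFunctions

end KS

namespace KS

/-! ### Multipliers trigonometric in both `x` and `y` -/

namespace Case2

variable {P : Params}

theorem hasPartials_ex (P : Params) :
    HasPartials (ex P) (fun _ => 0) (fun _ => 0) fun p => rate P * ex P p :=
  hasPartials_exp _

/-- The functions `A`, `B`, `C`, `E` are permuted up to constants by `∂_x` and `∂_y`: the pairs `A,
B` and `C, E` rotate into each other under `∂_x`, the pairs `A, E` and `B, C` under `∂_y`. The
divergence computations need only these rules, not the trigonometric formulas. -/
theorem hasPartials_A (P : Params) :
    HasPartials (A P) (fun p => -(P.a * B P p)) (fun p => P.b * E P p) fun _ => 0 := by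
  refine hasPartials_of_hasDerivAt ?_ (fun x y t => ?_) (fun x y t => ?_) fun x y t =>
    hasDerivAt_const t (A P (x, y, 0))
  · unfold A
    fun_prop
  · simp only [A, B]
    refine (((hasDerivAt_cos_mul P.a x).mul_const _).fun_sub
      ((hasDerivAt_sin_mul P.a x).mul_const _)).congr_deriv ?_
    ring
  · simp only [A, E]
    have hc := hasDerivAt_cos_mul P.b y
    have hs := hasDerivAt_sin_mul P.b y
    refine ((((hc.const_mul _).fun_add (hs.const_mul _)).const_mul _).fun_sub
      (((hc.const_mul _).fun_add (hs.const_mul _)).const_mul _)).congr_deriv ?_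
    ring

theorem hasPartials_B (P : Params) :
    HasPartials (B P) (fun p => P.a * A P p) (fun p => P.b * C P p) fun _ => 0 := by
  refine hasPartials_of_hasDerivAt ?_ (fun x y t => ?_) (fun x y t => ?_) fun x y t =>
    hasDerivAt_const t (B P (x, y, 0))
  · unfold B
    fun_prop
  · simp only [B, A]
    refine (((hasDerivAt_cos_mul P.a x).mul_const _).fun_add
      ((hasDerivAt_sin_mul P.a x).mul_const _)).congr_deriv ?_
    ring
  · simp only [B, C]
    have hc := hasDerivAt_cos_mul P.b y
    have hs := hasDerivAt_sin_mul P.b y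
    refine ((((hc.const_mul _).fun_add (hs.const_mul _)).const_mul _).fun_add
      (((hc.const_mul _).fun_add (hs.const_mul _)).const_mul _)).congr_deriv ?_
    ring

theorem hasPartials_C (P : Params) :
    HasPartials (C P) (fun p => P.a * E P p) (fun p => -(P.b * B P p)) fun _ => 0 := by
  refine hasPartials_of_hasDerivAt ?_ (fun x y t => ?_) (fun x y t => ?_) fun x y t =>
    hasDerivAt_const t (C P (x, y, 0))
  · unfold C
    fun_prop
  · simp only [C, E]
    refine (((hasDerivAt_cos_mul P.a x).mul_const _).fun_add
      ((hasDerivAt_sin_mul P.a x).mul_const _)).congr_deriv ?_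
    ring
  · simp only [C, B]
    have hc := hasDerivAt_cos_mul P.b y
    have hs := hasDerivAt_sin_mul P.b y
    refine ((((hc.const_mul _).fun_sub (hs.const_mul _)).const_mul _).fun_add
      (((hc.const_mul _).fun_sub (hs.const_mul _)).const_mul _)).congr_deriv ?_
    ring

theorem hasPartials_E (P : Params) :
    HasPartials (E P) (fun p => -(P.a * C P p)) (fun p => -(P.b * A P p)) fun _ => 0 := by
  refine hasPartials_of_hasDerivAt ?_ (fun x y t => ?_) (fun x y t => ?_) fun x y t =>
    hasDerivAt_const t (E P (x, y, 0))
  · unfold E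
    fun_prop
  · simp only [E, C]
    refine (((hasDerivAt_sin_mul P.a x).mul_const _).fun_add
      ((hasDerivAt_cos_mul P.a x).mul_const _)).congr_deriv ?_
    ring
  · simp only [E, A]
    have hc := hasDerivAt_cos_mul P.b y
    have hs := hasDerivAt_sin_mul P.b y
    refine ((((hs.const_mul _).fun_sub (hc.const_mul _)).const_mul _).fun_add
      (((hc.const_mul _).fun_sub (hs.const_mul _)).const_mul _)).congr_deriv ?_
    ring

theorem hasPartials_υ (P : Params) :
    HasPartials (υ P) (fun p => ex P p * (P.a * A P p)) (fun p => ex P p * (P.b * C P p))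
      fun p => rate P * (ex P p * B P p) :=
  (hasPartials_ex P).exp_mul (hasPartials_B P)

/-- The multiplier satisfies `υ_xx = -2 α υ` and `υ_yy = -c υ`, which cancel the coefficients of `u`
and of `g(u)`. The terms that remain fix the exponential rate. -/
theorem solvesAdjoint (hg : ContDiff ℝ ∞ P.g) (hG : P.Antideriv) (ha : P.a ^ 2 = 2 * P.α)
    (hb : P.b ^ 2 = P.c) : SolvesAdjoint (eqn P) (υ P) := by
  intro j
  have hGc := contDiff_of_hasDerivAt hg hG
  have hf : (deriv fun w => P.α * w ^ 2 / 2 + P.β * w + P.γ + P.c * P.G w) =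
      fun w => P.α * w + P.β + P.c * P.g w := by
    funext w
    have h := (((((hasDerivAt_id w).fun_pow 2).const_mul P.α).div_const 2).add
      ((hasDerivAt_id w).const_mul P.β)).add_const P.γ |>.add ((hG w).const_mul P.c)
    refine h.deriv.trans ?_
    simp
    ring
  rw [eqn, euler_lagr_of_half (hasPartials_υ P).contDiff (by fun_prop) hg, hf]
  have hA := (hasPartials_ex P).exp_mul (hasPartials_A P)
  have hB := (hasPartials_ex P).exp_mul (hasPartials_B P)
  have hC := (hasPartials_ex P).exp_mul (hasPartials_C P)
  have hE := (hasPartials_ex P).exp_mul (hasPartials_E P)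
  have hυ : υ P = fun p => ex P p * B P p := rfl
  -- Eliminating `α` and `c` in favour of the roots `a` and `b` turns the claim into a polynomial
  -- identity without side relations.
  have hα : (P.α : ℂ) = P.a ^ 2 / 2 := by rw [ha]; ring
  simp only [hυ, d, Function.iterate_succ_apply', Function.iterate_zero_apply, hA.x, hB.x, hB.y,
    hB.t, hC.y, mul_left_comm (ex P _), mul_neg, pd_const_mul, pd_neg]
  simp only [rate]
  push_cast
  rw [hα, ← hb]
  ring

section Vectors

theorem div_Ct (hg : ContDiff ℝ ∞ P.g) (hG : P.Antideriv) (ha : P.a ^ 2 = 2 * P.α)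
    (hb : P.b ^ 2 = P.c) (j : Jet) : div (Ct P) j = -(pd 2 (υ P) j.1 * eqn P j) := by
  have hGc := contDiff_of_hasDerivAt hg hG
  have hα : (P.α : ℂ) = P.a ^ 2 / 2 := by rw [ha]; ring
  have hGd : deriv P.G = P.g := funext fun w => (hG w).deriv
  have hx := hasPartials_ex P
  have hA := hasPartials_A P
  have hB := hasPartials_B P
  have hC := hasPartials_C P
  simp only [(hasPartials_υ P).t, div, Fin.sum_univ_three, Ct, eqn, Delta, Matrix.cons_val_zero,
    Matrix.cons_val_one, Matrix.cons_val, coords]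
  simp (maxDischargeDepth := 200) only [D_rules, isDiffFun_rules, D_coords, hx.D, hA.D, hB.D, hC.D,
    hx.isDiffFun, hA.isDiffFun, hB.isDiffFun, hC.isDiffFun, D_fun_u hg, D_fun_u hGc,
    isDiffFun_fun_u hg, isDiffFun_fun_u hGc, hGd, e, Matrix.cons_val, Nat.reduceAdd]
  simp only [rate]
  push_cast
  rw [hα, ← hb]
  ring

theorem div_Cx (hg : ContDiff ℝ ∞ P.g) (hG : P.Antideriv) (ha : P.a ^ 2 = 2 * P.α)
    (hb : P.b ^ 2 = P.c) (j : Jet) : div (Cx P) j = -(pd 0 (υ P) j.1 * eqn P j) := by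
  have hGc := contDiff_of_hasDerivAt hg hG
  have hα : (P.α : ℂ) = P.a ^ 2 / 2 := by rw [ha]; ring
  have hGd : deriv P.G = P.g := funext fun w => (hG w).deriv
  have hx := hasPartials_ex P
  have hA := hasPartials_A P
  have hB := hasPartials_B P
  have hE := hasPartials_E P
  simp only [(hasPartials_υ P).x, div, Fin.sum_univ_three, Cx, eqn, Delta, Matrix.cons_val_zero,
    Matrix.cons_val_one, Matrix.cons_val, coords]
  simp (maxDischargeDepth := 200) only [D_rules, isDiffFun_rules, D_coords, hx.D, hA.D, hB.D, hE.D,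
    hx.isDiffFun, hA.isDiffFun, hB.isDiffFun, hE.isDiffFun, D_fun_u hg, D_fun_u hGc,
    isDiffFun_fun_u hg, isDiffFun_fun_u hGc, hGd, e, Matrix.cons_val, Nat.reduceAdd]
  simp only [rate]
  push_cast
  rw [hα, ← hb]
  ring

theorem div_Cy (hg : ContDiff ℝ ∞ P.g) (hG : P.Antideriv) (ha : P.a ^ 2 = 2 * P.α)
    (hb : P.b ^ 2 = P.c) (j : Jet) : div (Cy P) j = -(pd 1 (υ P) j.1 * eqn P j) := by
  have hGc := contDiff_of_hasDerivAt hg hG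
  have hα : (P.α : ℂ) = P.a ^ 2 / 2 := by rw [ha]; ring
  have hGd : deriv P.G = P.g := funext fun w => (hG w).deriv
  have hx := hasPartials_ex P
  have hB := hasPartials_B P
  have hC := hasPartials_C P
  have hE := hasPartials_E P
  simp only [(hasPartials_υ P).y, div, Fin.sum_univ_three, Cy, eqn, Delta, Matrix.cons_val_zero,
    Matrix.cons_val_one, Matrix.cons_val, coords]
  simp (maxDischargeDepth := 200) only [D_rules, isDiffFun_rules, D_coords, hx.D, hB.D, hC.D, hE.D,
    hx.isDiffFun, hB.isDiffFun, hC.isDiffFun, hE.isDiffFun, D_fun_u hg, D_fun_u hGc,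
    isDiffFun_fun_u hg, isDiffFun_fun_u hGc, hGd, e, Matrix.cons_val, Nat.reduceAdd]
  simp only [rate]
  push_cast
  rw [hα, ← hb]
  ring

theorem isDiffFun_Ct (hg : ContDiff ℝ ∞ P.g) (hG : P.Antideriv) (i : Fin 3) :
    IsDiffFun (Ct P i) := by
  have hGc := contDiff_of_hasDerivAt hg hG
  fin_cases i <;> simp (maxDischargeDepth := 200) only [Ct, Fin.zero_eta, Fin.mk_one,
    Fin.reduceFinMk, Matrix.cons_val, coords, isDiffFun_rules, isDiffFun_fun_u hg,
    isDiffFun_fun_u hGc, (hasPartials_ex P).isDiffFun, (hasPartials_A P).isDiffFun, (hasPartials_B P).isDiffFun, (hasPartials_C P).isDiffFun]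

theorem isDiffFun_Cx (hg : ContDiff ℝ ∞ P.g) (hG : P.Antideriv) (i : Fin 3) :
    IsDiffFun (Cx P i) := by
  have hGc := contDiff_of_hasDerivAt hg hG
  fin_cases i <;> simp (maxDischargeDepth := 200) only [Cx, Fin.zero_eta, Fin.mk_one,
    Fin.reduceFinMk, Matrix.cons_val, coords, isDiffFun_rules, isDiffFun_fun_u hg,
    isDiffFun_fun_u hGc, (hasPartials_ex P).isDiffFun, (hasPartials_A P).isDiffFun, (hasPartials_B P).isDiffFun, (hasPartials_E P).isDiffFun]

theorem isDiffFun_Cy (hg : ContDiff ℝ ∞ P.g) (hG : P.Antideriv) (i : Fin 3) :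
    IsDiffFun (Cy P i) := by
  have hGc := contDiff_of_hasDerivAt hg hG
  fin_cases i <;> simp (maxDischargeDepth := 200) only [Cy, Fin.zero_eta, Fin.mk_one,
    Fin.reduceFinMk, Matrix.cons_val, coords, isDiffFun_rules, isDiffFun_fun_u hg,
    isDiffFun_fun_u hGc, (hasPartials_ex P).isDiffFun, (hasPartials_B P).isDiffFun, (hasPartials_C P).isDiffFun, (hasPartials_E P).isDiffFun]

theorem builtFrom_Ct (hg : ContDiff ℝ ∞ P.g) (hG : P.Antideriv) (ha : P.a ^ 2 = 2 * P.α)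
    (hb : P.b ^ 2 = P.c) :
    BuiltFrom (eqn P) (υ P) (Generator.translation 2) (Ct P) ∧
      (¬ IsTrivial (eqn P) (Ct P) ↔ ∃ p, pd 2 (υ P) p ≠ 0) := by
  have hGc := contDiff_of_hasDerivAt hg hG
  refine builtFrom_translation (a := fun p => -ex P p * B P p * P.γ) 2 (hasPartials_υ P).contDiff (by fun_prop) hg
    (contDiff_deriv hg) (by fun_prop) (solvesAdjoint hg hG ha hb) (isDiffFun_Ct hg hG)
    (div_Ct hg hG ha hb) (isDiffFun_const 0) (isDiffFun_const 0) fun j => ?_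
  simp only [D_const, Ct, Matrix.cons_val, (hasPartials_υ P).t]
  ring

theorem builtFrom_Cx (hg : ContDiff ℝ ∞ P.g) (hG : P.Antideriv) (ha : P.a ^ 2 = 2 * P.α)
    (hb : P.b ^ 2 = P.c) :
    BuiltFrom (eqn P) (υ P) (Generator.translation 0) (Cx P) ∧
      (¬ IsTrivial (eqn P) (Cx P) ↔ ∃ p, pd 0 (υ P) p ≠ 0) := by
  have hGc := contDiff_of_hasDerivAt hg hG
  refine builtFrom_translation (a := fun _ => 0) 0 (hasPartials_υ P).contDiff (by fun_prop) hg
    (contDiff_deriv hg) (by fun_prop) (solvesAdjoint hg hG ha hb) (isDiffFun_Cx hg hG)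
    (div_Cx hg hG ha hb) (isDiffFun_const 0) (isDiffFun_const 0) fun j => ?_
  simp only [D_const, Cx, Matrix.cons_val, (hasPartials_υ P).x]
  ring

theorem builtFrom_Cy (hg : ContDiff ℝ ∞ P.g) (hG : P.Antideriv) (ha : P.a ^ 2 = 2 * P.α)
    (hb : P.b ^ 2 = P.c) :
    BuiltFrom (eqn P) (υ P) (Generator.translation 1) (Cy P) ∧
      (¬ IsTrivial (eqn P) (Cy P) ↔ ∃ p, pd 1 (υ P) p ≠ 0) := by
  have hGc := contDiff_of_hasDerivAt hg hG
  refine builtFrom_translation (a := fun _ => 0) 1 (hasPartials_υ P).contDiff (by fun_prop) hg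
    (contDiff_deriv hg) (by fun_prop) (solvesAdjoint hg hG ha hb) (isDiffFun_Cy hg hG)
    (div_Cy hg hG ha hb) (isDiffFun_const 0) (isDiffFun_const 0) fun j => ?_
  simp only [D_const, Cy, Matrix.cons_val, (hasPartials_υ P).y]
  ring

end Vectors

section Nontriviality

theorem exists_A_ne_zero (hP : P.NonzeroConsts) (ha : P.a ≠ 0) (hb : P.b ≠ 0) : ∃ p, A P p ≠ 0 := by
  by_contra! h
  -- `A` has the shape of `B` with the constants `(c₁, c₂, c₃, c₄)` replaced by `(c₂, -c₁, c₄,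
  -- -c₃)`.
  obtain ⟨h1, h2, h3, h4⟩ := eq_zero_of_trig (k₁ := P.c₂) (k₂ := -P.c₁) (k₃ := P.c₄) (k₄ := -P.c₃)
    ha hb fun x y => (by simp only [A]; ring : _ = A P (x, y, 0)).trans (h _)
  exact hP ⟨neg_eq_zero.1 h2, h1, neg_eq_zero.1 h4, h3⟩

theorem exists_B_ne_zero (hP : P.NonzeroConsts) (ha : P.a ≠ 0) (hb : P.b ≠ 0) : ∃ p, B P p ≠ 0 := by
  by_contra! h
  exact hP (eq_zero_of_trig ha hb fun x y => h (x, y, 0))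

theorem exists_C_ne_zero (hP : P.NonzeroConsts) (ha : P.a ≠ 0) (hb : P.b ≠ 0) : ∃ p, C P p ≠ 0 := by
  by_contra! h
  obtain ⟨h1, h2, h3, h4⟩ := eq_zero_of_trig (k₁ := P.c₃) (k₂ := P.c₄) (k₃ := -P.c₁) (k₄ := -P.c₂)
    ha hb fun x y => (by simp only [C]; ring : _ = C P (x, y, 0)).trans (h _)
  exact hP ⟨neg_eq_zero.1 h3, neg_eq_zero.1 h4, h1, h2⟩

theorem ex_ne_zero (P : Params) (p : ℝ × ℝ × ℝ) : ex P p ≠ 0 := Complex.exp_ne_zero _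

/-- Up to the nowhere zero exponential, the characteristics are `rate * B`, `a * A` and `b * C`.
None of `A`, `B`, `C` vanishes identically, so only the rate can make a vector trivial. -/
theorem main (hP : P.Admissible) (hG : P.Antideriv) (hα : P.α ≠ 0) (hc : P.c ≠ 0)
    (ha : P.a ^ 2 = 2 * P.α) (hb : P.b ^ 2 = P.c) (hn : P.NonzeroConsts) :
    SolvesAdjoint (eqn P) (υ P) ∧
      (BuiltFrom (eqn P) (υ P) (Generator.translation 2) (Ct P) ∧
        (¬ IsTrivial (eqn P) (Ct P) ↔ rate P ≠ 0)) ∧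
      (BuiltFrom (eqn P) (υ P) (Generator.translation 0) (Cx P) ∧ ¬ IsTrivial (eqn P) (Cx P)) ∧
      (BuiltFrom (eqn P) (υ P) (Generator.translation 1) (Cy P) ∧ ¬ IsTrivial (eqn P) (Cy P)) := by
  have hg := hP.1
  have ha0 : P.a ≠ 0 := by
    rintro h
    simp [h, hα] at ha
  have hb0 : P.b ≠ 0 := by
    rintro h
    exact hc (by simpa [h] using hb.symm)
  obtain ⟨hCt, hCt'⟩ := builtFrom_Ct hg hG ha hb
  obtain ⟨hCx, hCx'⟩ := builtFrom_Cx hg hG ha hb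
  obtain ⟨hCy, hCy'⟩ := builtFrom_Cy hg hG ha hb
  refine ⟨solvesAdjoint hg hG ha hb, ⟨hCt, hCt'.trans ?_⟩, ⟨hCx, hCx'.2 ?_⟩, hCy, hCy'.2 ?_⟩
  · obtain ⟨p, hp⟩ := exists_B_ne_zero hn ha0 hb0
    simp only [(hasPartials_υ P).t, mul_ne_zero_iff, Complex.ofReal_ne_zero]
    exact ⟨fun ⟨_, h⟩ => h.1, fun h => ⟨p, h, ex_ne_zero P p, hp⟩⟩
  · obtain ⟨p, hp⟩ := exists_A_ne_zero hn ha0 hb0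
    exact ⟨p, by rw [(hasPartials_υ P).x]; exact mul_ne_zero (ex_ne_zero P p) (mul_ne_zero ha0 hp)⟩
  · obtain ⟨p, hp⟩ := exists_C_ne_zero hn ha0 hb0
    exact ⟨p, by rw [(hasPartials_υ P).y]; exact mul_ne_zero (ex_ne_zero P p) (mul_ne_zero hb0 hp)⟩

end Nontriviality

end Case2

end KS

namespace KS

/-! ### Multipliers affine in `x` and trigonometric in `y` -/

namespace Case3

variable {P : Params}

theorem hasPartials_ex (P : Params) :
    HasPartials (ex P) (fun _ => 0) (fun _ => 0) fun p => rate P * ex P p :=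
  hasPartials_exp _

/-- The closed family is now `A_x = B`, `C_x = E` with `B` and `E` free of `x`, while `∂_y` rotates
the pairs `A, C` and `B, E` with factor `b`. -/
theorem hasPartials_A (P : Params) :
    HasPartials (A P) (B P) (fun p => P.b * C P p) fun _ => 0 := by
  refine hasPartials_of_hasDerivAt ?_ (fun x y t => ?_) (fun x y t => ?_) fun x y t =>
    hasDerivAt_const t (A P (x, y, 0))
  · unfold A
    fun_prop
  · simp only [A, B]
    have h₁ := hasDerivAt_affine P.c₁ P.c₂ x
    have h₂ := hasDerivAt_affine P.c₃ P.c₄ x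
    refine ((h₁.mul_const _).fun_add (h₂.mul_const _)).congr_deriv ?_
    ring
  · simp only [A, C]
    have hc := hasDerivAt_cos_mul P.b y
    have hs := hasDerivAt_sin_mul P.b y
    refine ((hc.const_mul _).fun_add (hs.const_mul _)).congr_deriv ?_
    ring

theorem hasPartials_B (P : Params) :
    HasPartials (B P) (fun _ => 0) (fun p => P.b * E P p) fun _ => 0 := by
  refine hasPartials_of_hasDerivAt ?_ (fun x y t => ?_) (fun x y t => ?_) fun x y t =>
    hasDerivAt_const t (B P (x, y, 0))
  · unfold B
    fun_prop
  · exact hasDerivAt_const x (B P (0, y, t))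
  · simp only [B, E]
    have hc := hasDerivAt_cos_mul P.b y
    have hs := hasDerivAt_sin_mul P.b y
    refine ((hc.const_mul _).fun_add (hs.const_mul _)).congr_deriv ?_
    ring

theorem hasPartials_C (P : Params) :
    HasPartials (C P) (E P) (fun p => -(P.b * A P p)) fun _ => 0 := by
  refine hasPartials_of_hasDerivAt ?_ (fun x y t => ?_) (fun x y t => ?_) fun x y t =>
    hasDerivAt_const t (C P (x, y, 0))
  · unfold C
    fun_prop
  · simp only [C, E]
    have h₁ := hasDerivAt_affine P.c₁ P.c₂ x
    have h₂ := hasDerivAt_affine P.c₃ P.c₄ x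
    refine ((h₂.mul_const _).fun_sub (h₁.mul_const _)).congr_deriv ?_
    ring
  · simp only [C, A]
    have hc := hasDerivAt_cos_mul P.b y
    have hs := hasDerivAt_sin_mul P.b y
    refine ((hc.const_mul _).fun_sub (hs.const_mul _)).congr_deriv ?_
    ring

theorem hasPartials_E (P : Params) :
    HasPartials (E P) (fun _ => 0) (fun p => -(P.b * B P p)) fun _ => 0 := by
  refine hasPartials_of_hasDerivAt ?_ (fun x y t => ?_) (fun x y t => ?_) fun x y t =>
    hasDerivAt_const t (E P (x, y, 0))
  · unfold E
    fun_prop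
  · exact hasDerivAt_const x (E P (0, y, t))
  · simp only [E, B]
    have hc := hasDerivAt_cos_mul P.b y
    have hs := hasDerivAt_sin_mul P.b y
    refine ((hc.const_mul _).fun_sub (hs.const_mul _)).congr_deriv ?_
    ring

theorem hasPartials_υ (P : Params) :
    HasPartials (υ P) (fun p => ex P p * B P p) (fun p => ex P p * (P.b * C P p))
      fun p => rate P * (ex P p * A P p) :=
  (hasPartials_ex P).exp_mul (hasPartials_A P)

/-- Here `υ_xx = 0` and `υ_yy = -c υ`: the coefficients of `u` and `g(u)` cancel, and `υ_yyyy = c²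
υ` gives the rate `c² - α`. -/
theorem solvesAdjoint (hg : ContDiff ℝ ∞ P.g) (hG : P.Antideriv) (hb : P.b ^ 2 = P.c) :
    SolvesAdjoint (eqn P) (υ P) := by
  intro j
  have hGc := contDiff_of_hasDerivAt hg hG
  have hf : (deriv fun w => P.α * w + P.β + P.c * P.G w) = fun w => P.α + P.c * P.g w := by
    funext w
    have h := (((hasDerivAt_id w).const_mul P.α).add_const P.β).add ((hG w).const_mul P.c)
    refine h.deriv.trans ?_
    simp
  rw [eqn, euler_lagr_of_half (hasPartials_υ P).contDiff (by fun_prop) hg, hf]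
  have hA := (hasPartials_ex P).exp_mul (hasPartials_A P)
  have hB := (hasPartials_ex P).exp_mul (hasPartials_B P)
  have hC := (hasPartials_ex P).exp_mul (hasPartials_C P)
  have hυ : υ P = fun p => ex P p * A P p := rfl
  simp only [hυ, d, Function.iterate_succ_apply', Function.iterate_zero_apply, hA.x, hA.y, hA.t,
    hB.x, hC.y, mul_left_comm (ex P _), mul_neg, mul_zero, pd_const_mul, pd_neg, pd_const]
  simp only [rate]
  push_cast
  rw [← hb]
  ring

section Vectors

theorem div_Ct (hg : ContDiff ℝ ∞ P.g) (hG : P.Antideriv) (hb : P.b ^ 2 = P.c) (j : Jet) :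
    div (Ct P) j = -(pd 2 (υ P) j.1 * eqn P j) := by
  have hGc := contDiff_of_hasDerivAt hg hG
  have hGd : deriv P.G = P.g := funext fun w => (hG w).deriv
  have hx := hasPartials_ex P
  have hA := hasPartials_A P
  have hB := hasPartials_B P
  have hC := hasPartials_C P
  simp only [(hasPartials_υ P).t, div, Fin.sum_univ_three, Ct, eqn, Delta, Matrix.cons_val_zero,
    Matrix.cons_val_one, Matrix.cons_val, coords]
  simp (maxDischargeDepth := 200) only [D_rules, isDiffFun_rules, D_coords, hx.D, hx.isDiffFun, hA.D, hA.isDiffFun, hB.D, hB.isDiffFun, hC.D, hC.isDiffFun,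
    D_fun_u hg, isDiffFun_fun_u hg, D_fun_u hGc, isDiffFun_fun_u hGc, hGd, e, Matrix.cons_val, Nat.reduceAdd]
  simp only [rate, A, B, C]
  push_cast
  rw [← hb]
  ring

theorem div_Cx (hg : ContDiff ℝ ∞ P.g) (hG : P.Antideriv) (hb : P.b ^ 2 = P.c) (j : Jet) :
    div (Cx P) j = -(pd 0 (υ P) j.1 * eqn P j) := by
  have hGc := contDiff_of_hasDerivAt hg hG
  have hGd : deriv P.G = P.g := funext fun w => (hG w).deriv
  have hx := hasPartials_ex P
  have hB := hasPartials_B P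
  have hE := hasPartials_E P
  simp only [(hasPartials_υ P).x, div, Fin.sum_univ_three, Cx, eqn, Delta, Matrix.cons_val_zero,
    Matrix.cons_val_one, Matrix.cons_val, coords]
  simp (maxDischargeDepth := 200) only [D_rules, isDiffFun_rules, D_coords, hx.D, hx.isDiffFun, hB.D, hB.isDiffFun, hE.D, hE.isDiffFun,
    D_fun_u hg, isDiffFun_fun_u hg, D_fun_u hGc, isDiffFun_fun_u hGc, hGd, e, Matrix.cons_val, Nat.reduceAdd]
  simp only [rate, B, E]
  push_cast
  rw [← hb]
  ring

theorem div_Cy (hg : ContDiff ℝ ∞ P.g) (hG : P.Antideriv) (hb : P.b ^ 2 = P.c) (j : Jet) :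
    div (Cy P) j = -(pd 1 (υ P) j.1 * eqn P j) := by
  have hGc := contDiff_of_hasDerivAt hg hG
  have hGd : deriv P.G = P.g := funext fun w => (hG w).deriv
  have hx := hasPartials_ex P
  have hA := hasPartials_A P
  have hC := hasPartials_C P
  have hE := hasPartials_E P
  -- The bare cosine and sine accompany the `β`-terms. There `x (2 c₁ + c₂ x)` is twice an
  -- antiderivative in `x` of `c₁ + c₂ x`, so these terms are not expressed through `A`, `C`, `E`.
  have hu : HasPartials (fun p => Complex.cos (P.b * p.2.1)) (fun _ => 0)
      (fun p => -(P.b * Complex.sin (P.b * p.2.1))) fun _ => 0 :=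
    hasPartials_of_hasDerivAt (by fun_prop) (fun x y _ => hasDerivAt_const x (Complex.cos (P.b * y)))
      (fun _ y _ => hasDerivAt_cos_mul P.b y) fun _ y t => hasDerivAt_const t (Complex.cos (P.b * y))
  have hv : HasPartials (fun p => Complex.sin (P.b * p.2.1)) (fun _ => 0)
      (fun p => P.b * Complex.cos (P.b * p.2.1)) fun _ => 0 :=
    hasPartials_of_hasDerivAt (by fun_prop) (fun x y _ => hasDerivAt_const x (Complex.sin (P.b * y)))
      (fun _ y _ => hasDerivAt_sin_mul P.b y) fun _ y t => hasDerivAt_const t (Complex.sin (P.b * y))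
  simp only [(hasPartials_υ P).y, div, Fin.sum_univ_three, Cy, eqn, Delta, Matrix.cons_val_zero,
    Matrix.cons_val_one, Matrix.cons_val, coords]
  simp (maxDischargeDepth := 200) only [D_rules, isDiffFun_rules, D_coords, hx.D, hx.isDiffFun, hA.D, hA.isDiffFun, hC.D, hC.isDiffFun, hE.D, hE.isDiffFun, hu.D, hu.isDiffFun, hv.D, hv.isDiffFun,
    D_fun_u hg, isDiffFun_fun_u hg, D_fun_u hGc, isDiffFun_fun_u hGc, hGd, e, Matrix.cons_val, Nat.reduceAdd]
  simp only [rate, A, C, E]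
  push_cast
  rw [← hb]
  ring

theorem isDiffFun_Ct (hg : ContDiff ℝ ∞ P.g) (hG : P.Antideriv) (i : Fin 3) : IsDiffFun (Ct P i) := by
  have hGc := contDiff_of_hasDerivAt hg hG
  have hx := hasPartials_ex P
  have hA := hasPartials_A P
  have hB := hasPartials_B P
  have hC := hasPartials_C P
  fin_cases i <;> simp (maxDischargeDepth := 200) only [Ct, Fin.zero_eta, Fin.mk_one,
    Fin.reduceFinMk, Matrix.cons_val, coords, isDiffFun_rules, isDiffFun_fun_u hg, isDiffFun_fun_u hGc, hx.isDiffFun, hA.isDiffFun, hB.isDiffFun, hC.isDiffFun]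

theorem isDiffFun_Cx (hg : ContDiff ℝ ∞ P.g) (hG : P.Antideriv) (i : Fin 3) : IsDiffFun (Cx P i) := by
  have hGc := contDiff_of_hasDerivAt hg hG
  have hx := hasPartials_ex P
  have hB := hasPartials_B P
  have hE := hasPartials_E P
  fin_cases i <;> simp (maxDischargeDepth := 200) only [Cx, Fin.zero_eta, Fin.mk_one,
    Fin.reduceFinMk, Matrix.cons_val, coords, isDiffFun_rules, isDiffFun_fun_u hg, isDiffFun_fun_u hGc, hx.isDiffFun, hB.isDiffFun, hE.isDiffFun]

theorem isDiffFun_Cy (hg : ContDiff ℝ ∞ P.g) (hG : P.Antideriv) (i : Fin 3) : IsDiffFun (Cy P i) := by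
  have hGc := contDiff_of_hasDerivAt hg hG
  have hx := hasPartials_ex P
  have hA := hasPartials_A P
  have hC := hasPartials_C P
  have hE := hasPartials_E P
  have hu : HasPartials (fun p => Complex.cos (P.b * p.2.1)) (fun _ => 0)
      (fun p => -(P.b * Complex.sin (P.b * p.2.1))) fun _ => 0 :=
    hasPartials_of_hasDerivAt (by fun_prop) (fun x y _ => hasDerivAt_const x (Complex.cos (P.b * y)))
      (fun _ y _ => hasDerivAt_cos_mul P.b y) fun _ y t => hasDerivAt_const t (Complex.cos (P.b * y))
  have hv : HasPartials (fun p => Complex.sin (P.b * p.2.1)) (fun _ => 0)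
      (fun p => P.b * Complex.cos (P.b * p.2.1)) fun _ => 0 :=
    hasPartials_of_hasDerivAt (by fun_prop) (fun x y _ => hasDerivAt_const x (Complex.sin (P.b * y)))
      (fun _ y _ => hasDerivAt_sin_mul P.b y) fun _ y t => hasDerivAt_const t (Complex.sin (P.b * y))
  fin_cases i <;> simp (maxDischargeDepth := 200) only [Cy, Fin.zero_eta, Fin.mk_one,
    Fin.reduceFinMk, Matrix.cons_val, coords, isDiffFun_rules, isDiffFun_fun_u hg, isDiffFun_fun_u hGc, hx.isDiffFun, hA.isDiffFun, hC.isDiffFun, hE.isDiffFun, hu.isDiffFun, hv.isDiffFun]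

theorem builtFrom_Ct (hg : ContDiff ℝ ∞ P.g) (hG : P.Antideriv) (hb : P.b ^ 2 = P.c) :
    BuiltFrom (eqn P) (υ P) (Generator.translation 2) (Ct P) ∧
      (¬ IsTrivial (eqn P) (Ct P) ↔ ∃ p, pd 2 (υ P) p ≠ 0) := by
  have hGc := contDiff_of_hasDerivAt hg hG
  refine builtFrom_translation (a := fun p => -ex P p * A P p * P.β) 2 (hasPartials_υ P).contDiff (by fun_prop) hg
    (contDiff_deriv hg) (by fun_prop) (solvesAdjoint hg hG hb) (isDiffFun_Ct hg hG)
    (div_Ct hg hG hb) (isDiffFun_const 0) (isDiffFun_const 0) fun j => ?_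
  simp only [D_const, Ct, Matrix.cons_val, (hasPartials_υ P).t]
  ring

theorem builtFrom_Cx (hg : ContDiff ℝ ∞ P.g) (hG : P.Antideriv) (hb : P.b ^ 2 = P.c) :
    BuiltFrom (eqn P) (υ P) (Generator.translation 0) (Cx P) ∧
      (¬ IsTrivial (eqn P) (Cx P) ↔ ∃ p, pd 0 (υ P) p ≠ 0) := by
  have hGc := contDiff_of_hasDerivAt hg hG
  have hx := hasPartials_ex P
  have hB := hasPartials_B P
  -- With `M = -(ex B x u)` the density `-ex B x u_x` equals `ex B u + D_x M`, since `ex` and `B` do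
  -- not depend on `x`.
  have hM : IsDiffFun fun j => -(ex P j.1 * B P j.1 * j.1.1 * j.2 (0, 0, 0)) := by
    simp (maxDischargeDepth := 200) only [isDiffFun_rules, hx.isDiffFun, hB.isDiffFun]
  refine builtFrom_translation (a := fun _ => 0) 0 (hasPartials_υ P).contDiff (by fun_prop) hg
    (contDiff_deriv hg) (by fun_prop) (solvesAdjoint hg hG hb) (isDiffFun_Cx hg hG)
    (div_Cx hg hG hb) hM (isDiffFun_const 0) fun j => ?_
  simp (maxDischargeDepth := 200) only [D_rules, isDiffFun_rules, D_coords, hx.D, hB.D,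
    hx.isDiffFun, hB.isDiffFun, (hasPartials_υ P).x, Cx, Matrix.cons_val, coords, Nat.reduceAdd]
  push_cast
  ring

theorem builtFrom_Cy (hg : ContDiff ℝ ∞ P.g) (hG : P.Antideriv) (hb : P.b ^ 2 = P.c) :
    BuiltFrom (eqn P) (υ P) (Generator.translation 1) (Cy P) ∧
      (¬ IsTrivial (eqn P) (Cy P) ↔ ∃ p, pd 1 (υ P) p ≠ 0) := by
  have hGc := contDiff_of_hasDerivAt hg hG
  refine builtFrom_translation (a := fun _ => 0) 1 (hasPartials_υ P).contDiff (by fun_prop) hg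
    (contDiff_deriv hg) (by fun_prop) (solvesAdjoint hg hG hb) (isDiffFun_Cy hg hG)
    (div_Cy hg hG hb) (isDiffFun_const 0) (isDiffFun_const 0) fun j => ?_
  simp only [D_const, Cy, Matrix.cons_val, (hasPartials_υ P).y]
  ring

end Vectors

section Nontriviality

theorem exists_A_ne_zero (hP : P.NonzeroConsts) (hb : P.b ≠ 0) : ∃ p, A P p ≠ 0 := by
  by_contra! h
  have h1 := fun x : ℝ => eq_zero_of_cos_add_sin (l := P.c₁ + P.c₂ * x)
    (m := P.c₃ + P.c₄ * x) hb fun y => h (x, y, 0)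
  have h2 := eq_zero_of_affine fun x => (h1 x).1
  have h3 := eq_zero_of_affine fun x => (h1 x).2
  exact hP ⟨h2.1, h2.2, h3.1, h3.2⟩

theorem exists_B_ne_zero (hb : P.b ≠ 0) : (∃ p, B P p ≠ 0) ↔ P.c₂ ≠ 0 ∨ P.c₄ ≠ 0 := by
  constructor
  · contrapose!
    rintro ⟨h2, h4⟩ p
    simp [B, h2, h4]
  · contrapose!
    exact fun h => eq_zero_of_cos_add_sin hb fun y => h (0, y, 0)

theorem exists_C_ne_zero (hP : P.NonzeroConsts) (hb : P.b ≠ 0) : ∃ p, C P p ≠ 0 := by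
  by_contra! h
  have h1 := fun x : ℝ => eq_zero_of_cos_add_sin (l := P.c₃ + P.c₄ * x)
    (m := -(P.c₁ + P.c₂ * x)) hb fun y =>
    (by simp only [C]; ring : _ = C P (x, y, 0)).trans (h _)
  have h2 := eq_zero_of_affine fun x => (h1 x).1
  have h3 := eq_zero_of_affine fun x => neg_eq_zero.1 (h1 x).2
  exact hP ⟨h3.1, h3.2, h2.1, h2.2⟩

theorem ex_ne_zero (P : Params) (p : ℝ × ℝ × ℝ) : ex P p ≠ 0 := Complex.exp_ne_zero _

/-- The characteristics are `rate * A`, `B` and `b * C` up to the exponential. The constants `c₁`,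
`c₃` do not enter `B`, which explains the condition for `∂_x`. -/
theorem main (hP : P.Admissible) (hG : P.Antideriv) (hc : P.c ≠ 0) (hb : P.b ^ 2 = P.c)
    (hn : P.NonzeroConsts) :
    SolvesAdjoint (eqn P) (υ P) ∧
      (BuiltFrom (eqn P) (υ P) (Generator.translation 2) (Ct P) ∧
        (¬ IsTrivial (eqn P) (Ct P) ↔ rate P ≠ 0)) ∧
      (BuiltFrom (eqn P) (υ P) (Generator.translation 0) (Cx P) ∧
        (¬ IsTrivial (eqn P) (Cx P) ↔ P.c₂ ≠ 0 ∨ P.c₄ ≠ 0)) ∧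
      (BuiltFrom (eqn P) (υ P) (Generator.translation 1) (Cy P) ∧ ¬ IsTrivial (eqn P) (Cy P)) := by
  have hg := hP.1
  have hb0 : P.b ≠ 0 := by
    rintro h
    exact hc (by simpa [h] using hb.symm)
  obtain ⟨hCt, hCt'⟩ := builtFrom_Ct hg hG hb
  obtain ⟨hCx, hCx'⟩ := builtFrom_Cx hg hG hb
  obtain ⟨hCy, hCy'⟩ := builtFrom_Cy hg hG hb
  refine ⟨solvesAdjoint hg hG hb, ⟨hCt, hCt'.trans ?_⟩, ⟨hCx, hCx'.trans ?_⟩, hCy, hCy'.2 ?_⟩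
  · obtain ⟨p, hp⟩ := exists_A_ne_zero hn hb0
    simp only [(hasPartials_υ P).t, mul_ne_zero_iff, Complex.ofReal_ne_zero]
    exact ⟨fun ⟨_, h⟩ => h.1, fun h => ⟨p, h, ex_ne_zero P p, hp⟩⟩
  · rw [← exists_B_ne_zero hb0]
    simp only [(hasPartials_υ P).x, mul_ne_zero_iff, ne_eq, ex_ne_zero, not_false_eq_true, true_and]
  · obtain ⟨p, hp⟩ := exists_C_ne_zero hn hb0
    exact ⟨p, by rw [(hasPartials_υ P).y]; exact mul_ne_zero (ex_ne_zero P p) (mul_ne_zero hb0 hp)⟩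

end Nontriviality

end Case3

end KS

namespace KS

/-! ### Multipliers trigonometric in `x` and affine in `y` -/

namespace Case4

variable {P : Params}

theorem hasPartials_ex (P : Params) :
    HasPartials (ex P) (fun _ => 0) (fun _ => 0) fun p => rate P * ex P p :=
  hasPartials_exp _

/-- Now `∂_x` rotates the pairs `A, B` and `C, E` with factor `2 a`, while `A_y = C`, `B_y = E` and
both `C` and `E` are free of `y`. -/
theorem hasPartials_A (P : Params) :
    HasPartials (A P) (fun p => 2 * P.a * B P p) (C P) fun _ => 0 := by
  refine hasPartials_of_hasDerivAt ?_ (fun x y t => ?_) (fun x y t => ?_) fun x y t =>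
    hasDerivAt_const t (A P (x, y, 0))
  · unfold A
    fun_prop
  · simp only [A, B]
    have hc := hasDerivAt_cos_mul (2 * P.a) x
    have hs := hasDerivAt_sin_mul (2 * P.a) x
    refine ((hc.const_mul _).fun_add (hs.const_mul _)).congr_deriv ?_
    ring
  · simp only [A, C]
    have h₁ := hasDerivAt_linear_add P.c₁ P.c₂ y
    have h₂ := hasDerivAt_linear_add P.c₃ P.c₄ y
    refine ((h₁.mul_const _).fun_add (h₂.mul_const _)).congr_deriv ?_
    ring

theorem hasPartials_B (P : Params) :
    HasPartials (B P) (fun p => -(2 * P.a * A P p)) (E P) fun _ => 0 := by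
  refine hasPartials_of_hasDerivAt ?_ (fun x y t => ?_) (fun x y t => ?_) fun x y t =>
    hasDerivAt_const t (B P (x, y, 0))
  · unfold B
    fun_prop
  · simp only [B, A]
    have hc := hasDerivAt_cos_mul (2 * P.a) x
    have hs := hasDerivAt_sin_mul (2 * P.a) x
    refine ((hc.const_mul _).fun_sub (hs.const_mul _)).congr_deriv ?_
    ring
  · simp only [B, E]
    have h₁ := hasDerivAt_linear_add P.c₁ P.c₂ y
    have h₂ := hasDerivAt_linear_add P.c₃ P.c₄ y
    refine ((h₂.mul_const _).fun_sub (h₁.mul_const _)).congr_deriv ?_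
    ring

theorem hasPartials_C (P : Params) :
    HasPartials (C P) (fun p => 2 * P.a * E P p) (fun _ => 0) fun _ => 0 := by
  refine hasPartials_of_hasDerivAt ?_ (fun x y t => ?_) (fun x y t => ?_) fun x y t =>
    hasDerivAt_const t (C P (x, y, 0))
  · unfold C
    fun_prop
  · simp only [C, E]
    have hc := hasDerivAt_cos_mul (2 * P.a) x
    have hs := hasDerivAt_sin_mul (2 * P.a) x
    refine ((hc.const_mul _).fun_add (hs.const_mul _)).congr_deriv ?_
    ring
  · exact hasDerivAt_const y (C P (x, 0, t))

theorem hasPartials_E (P : Params) :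
    HasPartials (E P) (fun p => -(2 * P.a * C P p)) (fun _ => 0) fun _ => 0 := by
  refine hasPartials_of_hasDerivAt ?_ (fun x y t => ?_) (fun x y t => ?_) fun x y t =>
    hasDerivAt_const t (E P (x, y, 0))
  · unfold E
    fun_prop
  · simp only [E, C]
    have hc := hasDerivAt_cos_mul (2 * P.a) x
    have hs := hasDerivAt_sin_mul (2 * P.a) x
    refine ((hc.const_mul _).fun_sub (hs.const_mul _)).congr_deriv ?_
    ring
  · exact hasDerivAt_const y (E P (x, 0, t))

theorem hasPartials_υ (P : Params) :
    HasPartials (υ P) (fun p => ex P p * (2 * P.a * B P p)) (fun p => ex P p * C P p)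
      fun p => rate P * (ex P p * A P p) :=
  (hasPartials_ex P).exp_mul (hasPartials_A P)

/-- The frequency `2 a` gives `υ_xx = -4 α υ`, which cancels the coefficient of `u`; `υ_yy = 0`
removes `g(u)`, and the rate absorbs the rest. -/
theorem solvesAdjoint (hg : ContDiff ℝ ∞ P.g) (ha : P.a ^ 2 = P.α) :
    SolvesAdjoint (eqn P) (υ P) := by
  intro j
  have hf : (deriv fun w => P.α * w ^ 2 + P.β * w + P.γ) = fun w => 2 * P.α * w + P.β := by
    funext w
    have h := ((((hasDerivAt_id w).fun_pow 2).const_mul P.α).add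
      ((hasDerivAt_id w).const_mul P.β)).add_const P.γ
    refine h.deriv.trans ?_
    simp
    ring
  rw [eqn, euler_lagr_of_half (hasPartials_υ P).contDiff (by fun_prop) hg, hf]
  have hA := (hasPartials_ex P).exp_mul (hasPartials_A P)
  have hB := (hasPartials_ex P).exp_mul (hasPartials_B P)
  have hC := (hasPartials_ex P).exp_mul (hasPartials_C P)
  have hυ : υ P = fun p => ex P p * A P p := rfl
  simp only [hυ, d, Function.iterate_succ_apply', Function.iterate_zero_apply, hA.x, hA.y, hA.t,
    hB.x, hC.y, mul_left_comm (ex P _), mul_neg, mul_zero, pd_const_mul, pd_neg, pd_const]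
  simp only [rate]
  push_cast
  rw [← ha]
  ring

section Vectors

theorem div_Ct (hg : ContDiff ℝ ∞ P.g) (ha : P.a ^ 2 = P.α) (j : Jet) :
    div (Ct P) j = -(pd 2 (υ P) j.1 * eqn P j) := by
  have hx := hasPartials_ex P
  have hA := hasPartials_A P
  have hB := hasPartials_B P
  have hC := hasPartials_C P
  simp only [(hasPartials_υ P).t, div, Fin.sum_univ_three, Ct, eqn, Delta, Matrix.cons_val_zero,
    Matrix.cons_val_one, Matrix.cons_val, coords]
  simp (maxDischargeDepth := 200) only [D_rules, isDiffFun_rules, D_coords, hx.D, hx.isDiffFun, hA.D, hA.isDiffFun, hB.D, hB.isDiffFun, hC.D, hC.isDiffFun,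
    D_fun_u hg, isDiffFun_fun_u hg, e, Matrix.cons_val, Nat.reduceAdd]
  simp only [rate, A, B, C]
  push_cast
  rw [← ha]
  ring

theorem div_Cx (hg : ContDiff ℝ ∞ P.g) (ha : P.a ^ 2 = P.α) (j : Jet) :
    div (Cx P) j = -(pd 0 (υ P) j.1 * eqn P j) := by
  have hx := hasPartials_ex P
  have hA := hasPartials_A P
  have hB := hasPartials_B P
  have hC := hasPartials_C P
  -- The `γ`-terms contain `(c₁ y + 2 c₂) y` and `(c₃ y + 2 c₄) y`, twice the antiderivatives in `y`
  -- of the affine factors, multiplied by a bare sine or cosine.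
  have hu : HasPartials (fun p => Complex.cos (2 * P.a * p.1))
      (fun p => -(2 * P.a * Complex.sin (2 * P.a * p.1))) (fun _ => 0) fun _ => 0 :=
    hasPartials_of_hasDerivAt (by fun_prop) (fun x _ _ => hasDerivAt_cos_mul (2 * P.a) x)
      (fun x y _ => hasDerivAt_const y (Complex.cos (2 * P.a * x)))
      fun x _ t => hasDerivAt_const t (Complex.cos (2 * P.a * x))
  have hv : HasPartials (fun p => Complex.sin (2 * P.a * p.1))
      (fun p => 2 * P.a * Complex.cos (2 * P.a * p.1)) (fun _ => 0) fun _ => 0 :=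
    hasPartials_of_hasDerivAt (by fun_prop) (fun x _ _ => hasDerivAt_sin_mul (2 * P.a) x)
      (fun x y _ => hasDerivAt_const y (Complex.sin (2 * P.a * x)))
      fun x _ t => hasDerivAt_const t (Complex.sin (2 * P.a * x))
  simp only [(hasPartials_υ P).x, div, Fin.sum_univ_three, Cx, eqn, Delta, Matrix.cons_val_zero,
    Matrix.cons_val_one, Matrix.cons_val, coords]
  simp (maxDischargeDepth := 200) only [D_rules, isDiffFun_rules, D_coords, hx.D, hx.isDiffFun, hA.D, hA.isDiffFun, hB.D, hB.isDiffFun, hC.D, hC.isDiffFun, hu.D, hu.isDiffFun, hv.D, hv.isDiffFun,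
    D_fun_u hg, isDiffFun_fun_u hg, e, Matrix.cons_val, Nat.reduceAdd]
  simp only [rate, A, B, C, E]
  push_cast
  rw [← ha]
  ring

theorem div_Cy (hg : ContDiff ℝ ∞ P.g) (ha : P.a ^ 2 = P.α) (j : Jet) :
    div (Cy P) j = -(pd 1 (υ P) j.1 * eqn P j) := by
  have hx := hasPartials_ex P
  have hC := hasPartials_C P
  have hE := hasPartials_E P
  simp only [(hasPartials_υ P).y, div, Fin.sum_univ_three, Cy, eqn, Delta, Matrix.cons_val_zero,
    Matrix.cons_val_one, Matrix.cons_val, coords]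
  simp (maxDischargeDepth := 200) only [D_rules, isDiffFun_rules, D_coords, hx.D, hx.isDiffFun, hC.D, hC.isDiffFun, hE.D, hE.isDiffFun,
    D_fun_u hg, isDiffFun_fun_u hg, e, Matrix.cons_val, Nat.reduceAdd]
  simp only [rate, C, E]
  push_cast
  rw [← ha]
  ring

theorem isDiffFun_Ct (hg : ContDiff ℝ ∞ P.g) (i : Fin 3) : IsDiffFun (Ct P i) := by
  have hx := hasPartials_ex P
  have hA := hasPartials_A P
  have hB := hasPartials_B P
  have hC := hasPartials_C P
  fin_cases i <;> simp (maxDischargeDepth := 200) only [Ct, Fin.zero_eta, Fin.mk_one,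
    Fin.reduceFinMk, Matrix.cons_val, coords, isDiffFun_rules, isDiffFun_fun_u hg, hx.isDiffFun, hA.isDiffFun, hB.isDiffFun, hC.isDiffFun]

theorem isDiffFun_Cx (hg : ContDiff ℝ ∞ P.g) (i : Fin 3) : IsDiffFun (Cx P i) := by
  have hx := hasPartials_ex P
  have hA := hasPartials_A P
  have hB := hasPartials_B P
  have hC := hasPartials_C P
  have hu : HasPartials (fun p => Complex.cos (2 * P.a * p.1))
      (fun p => -(2 * P.a * Complex.sin (2 * P.a * p.1))) (fun _ => 0) fun _ => 0 :=
    hasPartials_of_hasDerivAt (by fun_prop) (fun x _ _ => hasDerivAt_cos_mul (2 * P.a) x)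
      (fun x y _ => hasDerivAt_const y (Complex.cos (2 * P.a * x)))
      fun x _ t => hasDerivAt_const t (Complex.cos (2 * P.a * x))
  have hv : HasPartials (fun p => Complex.sin (2 * P.a * p.1))
      (fun p => 2 * P.a * Complex.cos (2 * P.a * p.1)) (fun _ => 0) fun _ => 0 :=
    hasPartials_of_hasDerivAt (by fun_prop) (fun x _ _ => hasDerivAt_sin_mul (2 * P.a) x)
      (fun x y _ => hasDerivAt_const y (Complex.sin (2 * P.a * x)))
      fun x _ t => hasDerivAt_const t (Complex.sin (2 * P.a * x))
  fin_cases i <;> simp (maxDischargeDepth := 200) only [Cx, Fin.zero_eta, Fin.mk_one,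
    Fin.reduceFinMk, Matrix.cons_val, coords, isDiffFun_rules, isDiffFun_fun_u hg, hx.isDiffFun, hA.isDiffFun, hB.isDiffFun, hC.isDiffFun, hu.isDiffFun, hv.isDiffFun]

theorem isDiffFun_Cy (hg : ContDiff ℝ ∞ P.g) (i : Fin 3) : IsDiffFun (Cy P i) := by
  have hx := hasPartials_ex P
  have hC := hasPartials_C P
  have hE := hasPartials_E P
  fin_cases i <;> simp (maxDischargeDepth := 200) only [Cy, Fin.zero_eta, Fin.mk_one,
    Fin.reduceFinMk, Matrix.cons_val, coords, isDiffFun_rules, isDiffFun_fun_u hg, hx.isDiffFun, hC.isDiffFun, hE.isDiffFun]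

theorem builtFrom_Ct (hg : ContDiff ℝ ∞ P.g) (ha : P.a ^ 2 = P.α) :
    BuiltFrom (eqn P) (υ P) (Generator.translation 2) (Ct P) ∧
      (¬ IsTrivial (eqn P) (Ct P) ↔ ∃ p, pd 2 (υ P) p ≠ 0) := by
  have hx := hasPartials_ex P
  have hC := hasPartials_C P
  -- The term `ex C g(u) u_y` of the density is `D_y (ex C G(u))`, because `ex` and `C` do not
  -- depend on `y`.
  obtain ⟨G, hG⟩ := exists_antideriv hg
  have hGc := contDiff_of_hasDerivAt hg hG
  have hGd : deriv G = P.g := funext fun w => (hG w).deriv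
  have hN : IsDiffFun fun j => ex P j.1 * C P j.1 * G (j.2 (0, 0, 0)) := by
    simp (maxDischargeDepth := 200) only [isDiffFun_rules, hx.isDiffFun, hC.isDiffFun,
      isDiffFun_fun_u hGc]
  refine builtFrom_translation (a := fun p => -ex P p * A P p * P.γ) 2 (hasPartials_υ P).contDiff (by fun_prop) hg
    (contDiff_deriv hg) (by fun_prop) (solvesAdjoint hg ha) (isDiffFun_Ct hg)
    (div_Ct hg ha) (isDiffFun_const 0) hN fun j => ?_
  simp (maxDischargeDepth := 200) only [D_rules, isDiffFun_rules, hx.D, hC.D, hx.isDiffFun,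
    hC.isDiffFun, D_fun_u hGc, isDiffFun_fun_u hGc, hGd, (hasPartials_υ P).t, Ct, Matrix.cons_val,
    coords, e]
  push_cast
  ring

theorem builtFrom_Cx (hg : ContDiff ℝ ∞ P.g) (ha : P.a ^ 2 = P.α) :
    BuiltFrom (eqn P) (υ P) (Generator.translation 0) (Cx P) ∧
      (¬ IsTrivial (eqn P) (Cx P) ↔ ∃ p, pd 0 (υ P) p ≠ 0) := by
  refine builtFrom_translation (a := fun _ => 0) 0 (hasPartials_υ P).contDiff (by fun_prop) hg
    (contDiff_deriv hg) (by fun_prop) (solvesAdjoint hg ha) (isDiffFun_Cx hg)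
    (div_Cx hg ha) (isDiffFun_const 0) (isDiffFun_const 0) fun j => ?_
  simp only [D_const, Cx, Matrix.cons_val, (hasPartials_υ P).x]
  ring

theorem builtFrom_Cy (hg : ContDiff ℝ ∞ P.g) (ha : P.a ^ 2 = P.α) :
    BuiltFrom (eqn P) (υ P) (Generator.translation 1) (Cy P) ∧
      (¬ IsTrivial (eqn P) (Cy P) ↔ ∃ p, pd 1 (υ P) p ≠ 0) := by
  refine builtFrom_translation (a := fun _ => 0) 1 (hasPartials_υ P).contDiff (by fun_prop) hg
    (contDiff_deriv hg) (by fun_prop) (solvesAdjoint hg ha) (isDiffFun_Cy hg)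
    (div_Cy hg ha) (isDiffFun_const 0) (isDiffFun_const 0) fun j => ?_
  simp only [D_const, Cy, Matrix.cons_val, (hasPartials_υ P).y]
  ring

end Vectors

section Nontriviality

theorem exists_A_ne_zero (hP : P.NonzeroConsts) (ha : P.a ≠ 0) : ∃ p, A P p ≠ 0 := by
  by_contra! h
  have h1 := fun y : ℝ => eq_zero_of_cos_add_sin (l := P.c₁ * y + P.c₂)
    (m := P.c₃ * y + P.c₄) (mul_ne_zero two_ne_zero ha) fun x => h (x, y, 0)
  have h2 := eq_zero_of_affine fun y => (add_comm _ _).trans (h1 y).1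
  have h3 := eq_zero_of_affine fun y => (add_comm _ _).trans (h1 y).2
  exact hP ⟨h2.2, h2.1, h3.2, h3.1⟩

theorem exists_B_ne_zero (hP : P.NonzeroConsts) (ha : P.a ≠ 0) : ∃ p, B P p ≠ 0 := by
  by_contra! h
  have h1 := fun y : ℝ => eq_zero_of_cos_add_sin (l := P.c₃ * y + P.c₄)
    (m := -(P.c₁ * y + P.c₂)) (mul_ne_zero two_ne_zero ha) fun x => (by simp only [B]; ring : _ = B P (x, y, 0)).trans (h _)
  have h2 := eq_zero_of_affine fun y => (add_comm _ _).trans (h1 y).1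
  have h3 := eq_zero_of_affine fun y => (add_comm _ _).trans (neg_eq_zero.1 (h1 y).2)
  exact hP ⟨h3.2, h3.1, h2.2, h2.1⟩

theorem exists_C_ne_zero (ha : P.a ≠ 0) : (∃ p, C P p ≠ 0) ↔ P.c₁ ≠ 0 ∨ P.c₃ ≠ 0 := by
  constructor
  · contrapose!
    rintro ⟨h1, h3⟩ p
    simp [C, h1, h3]
  · contrapose!
    exact fun h => eq_zero_of_cos_add_sin (mul_ne_zero two_ne_zero ha) fun x => h (x, 0, 0)

theorem ex_ne_zero (P : Params) (p : ℝ × ℝ × ℝ) : ex P p ≠ 0 := Complex.exp_ne_zero _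

/-- The characteristics are `rate * A`, `2 a * B` and `C` up to the exponential; only `c₁` and `c₃`
survive in `C`. -/
theorem main (hP : P.Admissible) (hα : P.α ≠ 0) (ha : P.a ^ 2 = P.α) (hn : P.NonzeroConsts) :
    SolvesAdjoint (eqn P) (υ P) ∧
      (BuiltFrom (eqn P) (υ P) (Generator.translation 2) (Ct P) ∧
        (¬ IsTrivial (eqn P) (Ct P) ↔ rate P ≠ 0)) ∧
      (BuiltFrom (eqn P) (υ P) (Generator.translation 0) (Cx P) ∧ ¬ IsTrivial (eqn P) (Cx P)) ∧
      (BuiltFrom (eqn P) (υ P) (Generator.translation 1) (Cy P) ∧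
        (¬ IsTrivial (eqn P) (Cy P) ↔ P.c₁ ≠ 0 ∨ P.c₃ ≠ 0)) := by
  have hg := hP.1
  have ha0 : P.a ≠ 0 := by
    rintro h
    exact hα (by simpa [h] using ha.symm)
  obtain ⟨hCt, hCt'⟩ := builtFrom_Ct hg ha
  obtain ⟨hCx, hCx'⟩ := builtFrom_Cx hg ha
  obtain ⟨hCy, hCy'⟩ := builtFrom_Cy hg ha
  refine ⟨solvesAdjoint hg ha, ⟨hCt, hCt'.trans ?_⟩, ⟨hCx, hCx'.2 ?_⟩, hCy, hCy'.trans ?_⟩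
  · obtain ⟨p, hp⟩ := exists_A_ne_zero hn ha0
    simp only [(hasPartials_υ P).t, mul_ne_zero_iff, Complex.ofReal_ne_zero]
    exact ⟨fun ⟨_, h⟩ => h.1, fun h => ⟨p, h, ex_ne_zero P p, hp⟩⟩
  · obtain ⟨p, hp⟩ := exists_B_ne_zero hn ha0
    exact ⟨p, by
      rw [(hasPartials_υ P).x]
      exact mul_ne_zero (ex_ne_zero P p) (mul_ne_zero (mul_ne_zero two_ne_zero ha0) hp)⟩
  · rw [← exists_C_ne_zero ha0]
    simp only [(hasPartials_υ P).y, mul_ne_zero_iff, ne_eq, ex_ne_zero, not_false_eq_true, true_and]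

end Nontriviality

end Case4

end KS

namespace KS

/-! ### Multipliers affine in each of `x` and `y` -/

namespace Case5

variable {P : Params}

theorem hasPartials_ex (P : Params) :
    HasPartials (ex P) (fun _ => 0) (fun _ => 0) fun p => rate P * ex P p :=
  hasPartials_exp _

/-- `A` is bilinear with `A_x = B` and `A_y = C`, and the only further nonzero derivatives are `B_y
= C_x = c₂`. -/
theorem hasPartials_A (P : Params) :
    HasPartials (A P) (B P) (C P) fun _ => 0 := by
  refine hasPartials_of_hasDerivAt ?_ (fun x y t => ?_) (fun x y t => ?_) fun x y t =>
    hasDerivAt_const t (A P (x, y, 0))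
  · unfold A
    fun_prop
  · simp only [A, B]
    refine ((((hasDerivAt_affine P.c₁ P.c₂ x).mul_const _).add_const _).fun_add
      (Complex.ofRealCLM.hasDerivAt.const_mul _)).congr_deriv ?_
    simp
  · simp only [A, C]
    refine (((Complex.ofRealCLM.hasDerivAt.const_mul _).add_const _).add_const _).congr_deriv ?_
    simp

theorem hasPartials_B (P : Params) :
    HasPartials (B P) (fun _ => 0) (fun _ => P.c₂) fun _ => 0 := by
  refine hasPartials_of_hasDerivAt ?_ (fun x y t => ?_) (fun x y t => ?_) fun x y t =>
    hasDerivAt_const t (B P (x, y, 0))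
  · unfold B
    fun_prop
  · exact hasDerivAt_const x (B P (0, y, t))
  · exact hasDerivAt_linear_add P.c₂ P.c₄ y

theorem hasPartials_C (P : Params) :
    HasPartials (C P) (fun _ => P.c₂) (fun _ => 0) fun _ => 0 := by
  refine hasPartials_of_hasDerivAt ?_ (fun x y t => ?_) (fun x y t => ?_) fun x y t =>
    hasDerivAt_const t (C P (x, y, 0))
  · unfold C
    fun_prop
  · exact hasDerivAt_affine P.c₁ P.c₂ x
  · exact hasDerivAt_const y (C P (x, 0, t))

theorem hasPartials_υ (P : Params) :
    HasPartials (υ P) (fun p => ex P p * B P p) (fun p => ex P p * C P p)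
      fun p => rate P * (ex P p * A P p) :=
  (hasPartials_ex P).exp_mul (hasPartials_A P)

/-- Both `υ_xx` and `υ_yy` vanish, so the adjoint equation reduces to `α υ + υ_t = 0`. -/
theorem solvesAdjoint (hg : ContDiff ℝ ∞ P.g) : SolvesAdjoint (eqn P) (υ P) := by
  intro j
  have hf : (deriv fun w => P.α * w + P.β) = fun _ => P.α := by
    funext w
    simp
  rw [eqn, euler_lagr_of_half (hasPartials_υ P).contDiff (by fun_prop) hg, hf]
  have hA := (hasPartials_ex P).exp_mul (hasPartials_A P)
  have hB := (hasPartials_ex P).exp_mul (hasPartials_B P)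
  have hC := (hasPartials_ex P).exp_mul (hasPartials_C P)
  have hυ : υ P = fun p => ex P p * A P p := rfl
  simp only [hυ, d, Function.iterate_succ_apply', Function.iterate_zero_apply, hA.x, hA.y, hA.t,
    hB.x, hC.y, mul_zero, pd_const]
  simp only [rate]
  push_cast
  ring

section Vectors

theorem div_Ct (hg : ContDiff ℝ ∞ P.g) (j : Jet) :
    div (Ct P) j = -(pd 2 (υ P) j.1 * eqn P j) := by
  have hx := hasPartials_ex P
  have hA := hasPartials_A P
  have hB := hasPartials_B P
  have hC := hasPartials_C P
  simp only [(hasPartials_υ P).t, div, Fin.sum_univ_three, Ct, eqn, Delta, Matrix.cons_val_zero,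
    Matrix.cons_val_one, Matrix.cons_val, coords]
  simp (maxDischargeDepth := 200) only [D_rules, isDiffFun_rules, D_coords, hx.D, hx.isDiffFun, hA.D, hA.isDiffFun, hB.D, hB.isDiffFun, hC.D, hC.isDiffFun,
    D_fun_u hg, isDiffFun_fun_u hg, e, Matrix.cons_val, Nat.reduceAdd]
  simp only [rate, A, B, C]
  push_cast
  ring

theorem div_Cx (hg : ContDiff ℝ ∞ P.g) (j : Jet) :
    div (Cx P) j = -(pd 0 (υ P) j.1 * eqn P j) := by
  have hx := hasPartials_ex P
  have hB := hasPartials_B P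
  simp only [(hasPartials_υ P).x, div, Fin.sum_univ_three, Cx, eqn, Delta, Matrix.cons_val_zero,
    Matrix.cons_val_one, Matrix.cons_val, coords]
  simp (maxDischargeDepth := 200) only [D_rules, isDiffFun_rules, D_coords, hx.D, hx.isDiffFun, hB.D, hB.isDiffFun,
    D_fun_u hg, isDiffFun_fun_u hg, e, Matrix.cons_val, Nat.reduceAdd]
  simp only [rate, B]
  push_cast
  ring

theorem div_Cy (hg : ContDiff ℝ ∞ P.g) (j : Jet) :
    div (Cy P) j = -(pd 1 (υ P) j.1 * eqn P j) := by
  have hx := hasPartials_ex P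
  have hC := hasPartials_C P
  simp only [(hasPartials_υ P).y, div, Fin.sum_univ_three, Cy, eqn, Delta, Matrix.cons_val_zero,
    Matrix.cons_val_one, Matrix.cons_val, coords]
  simp (maxDischargeDepth := 200) only [D_rules, isDiffFun_rules, D_coords, hx.D, hx.isDiffFun, hC.D, hC.isDiffFun,
    D_fun_u hg, isDiffFun_fun_u hg, e, Matrix.cons_val, Nat.reduceAdd]
  simp only [rate, C]
  push_cast
  ring

theorem isDiffFun_Ct (hg : ContDiff ℝ ∞ P.g) (i : Fin 3) : IsDiffFun (Ct P i) := by
  have hx := hasPartials_ex P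
  have hA := hasPartials_A P
  have hB := hasPartials_B P
  have hC := hasPartials_C P
  fin_cases i <;> simp (maxDischargeDepth := 200) only [Ct, Fin.zero_eta, Fin.mk_one,
    Fin.reduceFinMk, Matrix.cons_val, coords, isDiffFun_rules, isDiffFun_fun_u hg, hx.isDiffFun, hA.isDiffFun, hB.isDiffFun, hC.isDiffFun]

theorem isDiffFun_Cx (hg : ContDiff ℝ ∞ P.g) (i : Fin 3) : IsDiffFun (Cx P i) := by
  have hx := hasPartials_ex P
  have hB := hasPartials_B P
  fin_cases i <;> simp (maxDischargeDepth := 200) only [Cx, Fin.zero_eta, Fin.mk_one,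
    Fin.reduceFinMk, Matrix.cons_val, coords, isDiffFun_rules, isDiffFun_fun_u hg, hx.isDiffFun, hB.isDiffFun]

theorem isDiffFun_Cy (hg : ContDiff ℝ ∞ P.g) (i : Fin 3) : IsDiffFun (Cy P i) := by
  have hx := hasPartials_ex P
  have hC := hasPartials_C P
  fin_cases i <;> simp (maxDischargeDepth := 200) only [Cy, Fin.zero_eta, Fin.mk_one,
    Fin.reduceFinMk, Matrix.cons_val, coords, isDiffFun_rules, isDiffFun_fun_u hg, hx.isDiffFun, hC.isDiffFun]

theorem builtFrom_Ct (hg : ContDiff ℝ ∞ P.g) :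
    BuiltFrom (eqn P) (υ P) (Generator.translation 2) (Ct P) ∧
      (¬ IsTrivial (eqn P) (Ct P) ↔ ∃ p, pd 2 (υ P) p ≠ 0) := by
  have hx := hasPartials_ex P
  have hC := hasPartials_C P
  -- As `C` is free of `y`, the density term `ex C g(u) u_y` is the total `y`-derivative of `ex C
  -- G(u)`.
  obtain ⟨G, hG⟩ := exists_antideriv hg
  have hGc := contDiff_of_hasDerivAt hg hG
  have hGd : deriv G = P.g := funext fun w => (hG w).deriv
  have hN : IsDiffFun fun j => ex P j.1 * C P j.1 * G (j.2 (0, 0, 0)) := by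
    simp (maxDischargeDepth := 200) only [isDiffFun_rules, hx.isDiffFun, hC.isDiffFun,
      isDiffFun_fun_u hGc]
  refine builtFrom_translation (a := fun p => -ex P p * A P p * P.β) 2 (hasPartials_υ P).contDiff (by fun_prop) hg
    (contDiff_deriv hg) (by fun_prop) (solvesAdjoint hg) (isDiffFun_Ct hg)
    (div_Ct hg) (isDiffFun_const 0) hN fun j => ?_
  simp (maxDischargeDepth := 200) only [D_rules, isDiffFun_rules, hx.D, hC.D, hx.isDiffFun,
    hC.isDiffFun, D_fun_u hGc, isDiffFun_fun_u hGc, hGd, (hasPartials_υ P).t, Ct, Matrix.cons_val,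
    coords, e]
  simp only [rate]
  push_cast
  ring

theorem builtFrom_Cx (hg : ContDiff ℝ ∞ P.g) :
    BuiltFrom (eqn P) (υ P) (Generator.translation 0) (Cx P) ∧
      (¬ IsTrivial (eqn P) (Cx P) ↔ ∃ p, pd 0 (υ P) p ≠ 0) := by
  refine builtFrom_translation (a := fun _ => 0) 0 (hasPartials_υ P).contDiff (by fun_prop) hg
    (contDiff_deriv hg) (by fun_prop) (solvesAdjoint hg) (isDiffFun_Cx hg)
    (div_Cx hg) (isDiffFun_const 0) (isDiffFun_const 0) fun j => ?_
  simp only [D_const, Cx, Matrix.cons_val, (hasPartials_υ P).x]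
  ring

theorem builtFrom_Cy (hg : ContDiff ℝ ∞ P.g) :
    BuiltFrom (eqn P) (υ P) (Generator.translation 1) (Cy P) ∧
      (¬ IsTrivial (eqn P) (Cy P) ↔ ∃ p, pd 1 (υ P) p ≠ 0) := by
  refine builtFrom_translation (a := fun _ => 0) 1 (hasPartials_υ P).contDiff (by fun_prop) hg
    (contDiff_deriv hg) (by fun_prop) (solvesAdjoint hg) (isDiffFun_Cy hg)
    (div_Cy hg) (isDiffFun_const 0) (isDiffFun_const 0) fun j => ?_
  simp only [D_const, Cy, Matrix.cons_val, (hasPartials_υ P).y]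
  ring

end Vectors

section Nontriviality

theorem exists_B_ne_zero : (∃ p, B P p ≠ 0) ↔ P.c₂ ≠ 0 ∨ P.c₄ ≠ 0 := by
  constructor
  · contrapose!
    rintro ⟨h2, h4⟩ p
    simp [B, h2, h4]
  · contrapose!
    exact fun h => (eq_zero_of_affine fun y => (add_comm _ _).trans (h (0, y, 0))).symm

theorem exists_C_ne_zero : (∃ p, C P p ≠ 0) ↔ P.c₁ ≠ 0 ∨ P.c₂ ≠ 0 := by
  constructor
  · contrapose!
    rintro ⟨h1, h2⟩ p
    simp [C, h1, h2]
  · contrapose!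
    exact fun h => eq_zero_of_affine fun x => h (x, 0, 0)

theorem exists_A_ne_zero (hP : P.NonzeroConsts) : ∃ p, A P p ≠ 0 := by
  by_contra! h
  -- Regrouped as an affine function of `y` whose two coefficients are affine in `x`.
  have h1 := fun x : ℝ => eq_zero_of_affine (k := P.c₃ + P.c₄ * x) (l := P.c₁ + P.c₂ * x) fun y =>
    (by simp only [A]; ring : _ = A P (x, y, 0)).trans (h _)
  have h2 := eq_zero_of_affine fun x => (h1 x).1
  have h3 := eq_zero_of_affine fun x => (h1 x).2
  exact hP ⟨h3.1, h3.2, h2.1, h2.2⟩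

theorem ex_ne_zero (P : Params) (p : ℝ × ℝ × ℝ) : ex P p ≠ 0 := Complex.exp_ne_zero _

theorem main (hP : P.Admissible) (hn : P.NonzeroConsts) :
    SolvesAdjoint (eqn P) (υ P) ∧
      (BuiltFrom (eqn P) (υ P) (Generator.translation 2) (Ct P) ∧
        (¬ IsTrivial (eqn P) (Ct P) ↔ P.α ≠ 0)) ∧
      (BuiltFrom (eqn P) (υ P) (Generator.translation 0) (Cx P) ∧
        (¬ IsTrivial (eqn P) (Cx P) ↔ P.c₂ ≠ 0 ∨ P.c₄ ≠ 0)) ∧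
      (BuiltFrom (eqn P) (υ P) (Generator.translation 1) (Cy P) ∧
        (¬ IsTrivial (eqn P) (Cy P) ↔ P.c₁ ≠ 0 ∨ P.c₂ ≠ 0)) := by
  have hg := hP.1
  obtain ⟨hCt, hCt'⟩ := builtFrom_Ct hg
  obtain ⟨hCx, hCx'⟩ := builtFrom_Cx hg
  obtain ⟨hCy, hCy'⟩ := builtFrom_Cy hg
  refine ⟨solvesAdjoint hg, ⟨hCt, hCt'.trans ?_⟩, ⟨hCx, hCx'.trans ?_⟩, hCy, hCy'.trans ?_⟩
  · obtain ⟨p, hp⟩ := exists_A_ne_zero hn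
    simp only [(hasPartials_υ P).t, mul_ne_zero_iff, Complex.ofReal_ne_zero, rate, neg_ne_zero]
    exact ⟨fun ⟨_, h⟩ => h.1, fun h => ⟨p, h, ex_ne_zero P p, hp⟩⟩
  · rw [← exists_B_ne_zero]
    simp only [(hasPartials_υ P).x, mul_ne_zero_iff, ne_eq, ex_ne_zero, not_false_eq_true, true_and]
  · rw [← exists_C_ne_zero]
    simp only [(hasPartials_υ P).y, mul_ne_zero_iff, ne_eq, ex_ne_zero, not_false_eq_true, true_and]

end Nontriviality

end Case5

end KS

/-! ### The conservation laws in all cases -/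

theorem mainTheorem3 :
    -- quasi self-adjoint case: `f = α`, `r = u/2 + β`, `h = g'`, multiplier a nonzero constant
    (∀ (α β : ℝ) (g : ℝ → ℝ) (c : ℂ), ContDiff ℝ ∞ g → c ≠ 0 →
      SolvesAdjoint (Delta (fun _ => α) g (deriv g) (fun w => w / 2 + β)) (fun _ => c) ∧
      ∀ i : Fin 3,
        (Generator.translation i).IsSymmetry
          (Delta (fun _ => α) g (deriv g) (fun w => w / 2 + β)) ∧
        IsTrivial (Delta (fun _ => α) g (deriv g) (fun w => w / 2 + β))
          (noether (Generator.translation i)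
            (lagr (fun _ => c) (Delta (fun _ => α) g (deriv g) (fun w => w / 2 + β))))) ∧
    -- `r = u/2 + α`, `g = β u + γ`, `h = β`, `f = δ u² + ε u + ζ`
    (∀ (α β γ δ ε ζ : ℝ) (F : ℝ × ℝ × ℝ → ℂ), ContDiff ℝ ∞ F → Case1.System α β γ δ ε F →
      SolvesAdjoint (Case1.eqn α β γ δ ε ζ) F ∧
      (BuiltFrom (Case1.eqn α β γ δ ε ζ) F (Generator.translation 2)
          (Case1.Ct α β γ δ ζ F) ∧
        (¬ IsTrivial (Case1.eqn α β γ δ ε ζ) (Case1.Ct α β γ δ ζ F) ↔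
          ∃ p, d 0 0 1 F p ≠ 0)) ∧
      (BuiltFrom (Case1.eqn α β γ δ ε ζ) F (Generator.translation 0)
          (Case1.Cx α β γ δ ε ζ F) ∧
        (¬ IsTrivial (Case1.eqn α β γ δ ε ζ) (Case1.Cx α β γ δ ε ζ F) ↔
          ∃ p, d 1 0 0 F p ≠ 0)) ∧
      (BuiltFrom (Case1.eqn α β γ δ ε ζ) F (Generator.translation 1)
          (Case1.Cy α β γ δ ε ζ F) ∧
        (¬ IsTrivial (Case1.eqn α β γ δ ε ζ) (Case1.Cy α β γ δ ε ζ F) ↔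
          ∃ p, d 0 1 0 F p ≠ 0)) ∧
      (β = 1 / 2 → γ = α →
        BuiltFrom (Case1.eqn α β γ δ ε ζ) F Generator.rotation (Case1.Crot α δ ε ζ F) ∧
        (¬ IsTrivial (Case1.eqn α β γ δ ε ζ) (Case1.Crot α δ ε ζ F) ↔
          ¬ ∃ H : ℝ → ℝ → ℂ, ∀ x y t : ℝ, F (x, y, t) = H (x ^ 2 + y ^ 2) t))) ∧
    -- `r = u/2 + δ`, `h = g'`, `f = α u²/2 + β u + γ + c ∫ g du`
    (∀ P : Params, P.Admissible → P.Antideriv → P.α ≠ 0 → P.c ≠ 0 →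
      P.a ^ 2 = 2 * P.α → P.b ^ 2 = P.c → P.NonzeroConsts →
      SolvesAdjoint (Case2.eqn P) (Case2.υ P) ∧
      (BuiltFrom (Case2.eqn P) (Case2.υ P) (Generator.translation 2) (Case2.Ct P) ∧
        (¬ IsTrivial (Case2.eqn P) (Case2.Ct P) ↔ Case2.rate P ≠ 0)) ∧
      (BuiltFrom (Case2.eqn P) (Case2.υ P) (Generator.translation 0) (Case2.Cx P) ∧
        ¬ IsTrivial (Case2.eqn P) (Case2.Cx P)) ∧
      (BuiltFrom (Case2.eqn P) (Case2.υ P) (Generator.translation 1) (Case2.Cy P) ∧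
        ¬ IsTrivial (Case2.eqn P) (Case2.Cy P))) ∧
    -- `r = u/2 + γ`, `h = g'`, `f = α u + β + c ∫ g du`
    (∀ P : Params, P.Admissible → P.Antideriv → P.c ≠ 0 → P.b ^ 2 = P.c → P.NonzeroConsts →
      SolvesAdjoint (Case3.eqn P) (Case3.υ P) ∧
      (BuiltFrom (Case3.eqn P) (Case3.υ P) (Generator.translation 2) (Case3.Ct P) ∧
        (¬ IsTrivial (Case3.eqn P) (Case3.Ct P) ↔ Case3.rate P ≠ 0)) ∧
      (BuiltFrom (Case3.eqn P) (Case3.υ P) (Generator.translation 0) (Case3.Cx P) ∧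
        (¬ IsTrivial (Case3.eqn P) (Case3.Cx P) ↔ P.c₂ ≠ 0 ∨ P.c₄ ≠ 0)) ∧
      (BuiltFrom (Case3.eqn P) (Case3.υ P) (Generator.translation 1) (Case3.Cy P) ∧
        ¬ IsTrivial (Case3.eqn P) (Case3.Cy P))) ∧
    -- `r = u/2 + δ`, `h = g'`, `f = α u² + β u + γ`
    (∀ P : Params, P.Admissible → P.α ≠ 0 → P.a ^ 2 = P.α → P.NonzeroConsts →
      SolvesAdjoint (Case4.eqn P) (Case4.υ P) ∧
      (BuiltFrom (Case4.eqn P) (Case4.υ P) (Generator.translation 2) (Case4.Ct P) ∧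
        (¬ IsTrivial (Case4.eqn P) (Case4.Ct P) ↔ Case4.rate P ≠ 0)) ∧
      (BuiltFrom (Case4.eqn P) (Case4.υ P) (Generator.translation 0) (Case4.Cx P) ∧
        ¬ IsTrivial (Case4.eqn P) (Case4.Cx P)) ∧
      (BuiltFrom (Case4.eqn P) (Case4.υ P) (Generator.translation 1) (Case4.Cy P) ∧
        (¬ IsTrivial (Case4.eqn P) (Case4.Cy P) ↔ P.c₁ ≠ 0 ∨ P.c₃ ≠ 0))) ∧
    -- `r = u/2 + γ`, `h = g'`, `f = α u + β`
    (∀ P : Params, P.Admissible → P.NonzeroConsts →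
      SolvesAdjoint (Case5.eqn P) (Case5.υ P) ∧
      (BuiltFrom (Case5.eqn P) (Case5.υ P) (Generator.translation 2) (Case5.Ct P) ∧
        (¬ IsTrivial (Case5.eqn P) (Case5.Ct P) ↔ P.α ≠ 0)) ∧
      (BuiltFrom (Case5.eqn P) (Case5.υ P) (Generator.translation 0) (Case5.Cx P) ∧
        (¬ IsTrivial (Case5.eqn P) (Case5.Cx P) ↔ P.c₂ ≠ 0 ∨ P.c₄ ≠ 0)) ∧
      (BuiltFrom (Case5.eqn P) (Case5.υ P) (Generator.translation 1) (Case5.Cy P) ∧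
        (¬ IsTrivial (Case5.eqn P) (Case5.Cy P) ↔ P.c₁ ≠ 0 ∨ P.c₂ ≠ 0))) := by
  refine ⟨fun α β g c hg _ => ?_, fun α β γ δ ε ζ F hF hS => ?_, fun _ => Case2.main,
    fun _ => Case3.main, fun _ => Case4.main, fun _ => Case5.main⟩
  · have hr : ContDiff ℝ ∞ fun w : ℝ => w / 2 + β := by fun_prop
    have hE := solvesAdjoint_const α β hg c
    exact ⟨hE, fun i => ⟨isSymmetry_translation contDiff_const hg (contDiff_deriv hg) hr i,
      isTrivial_noether_const c i contDiff_const hg (contDiff_deriv hg) hr hE⟩⟩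
  · refine ⟨Case1.solvesAdjoint hF hS, Case1.builtFrom_Ct hF hS, Case1.builtFrom_Cx hF hS,
      Case1.builtFrom_Cy hF hS, ?_⟩
    rintro rfl rfl
    exact Case1.builtFrom_Crot hF hS
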